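/- **Setting.** Let $K,T\ge 1$. A Bayesian stochastic bandit with actions $\{1,\dots,K\}$ consists of a random distribution $p^*$ on $[0,1]^K$ (its law is the prior), reward vectors $Y_t=(Y_{t,a})_{a\le K}$, $1\le t\le T$, which conditionally on $p^*$ are i.i.d. with law $p^*$, and an optimal action $A^*\in\arg\max_a \mathbb E[Y_{t,a}\mid p^*]$ with prior law $\alpha_1=\mathbb P(A^*=\cdot)$ and Shannon entropy $H(\alpha_1)=-\sum_a\alpha_1(a)\log\alpha_1(a)$. Let $G_1,\dots,G_T$ be deterministic directed graphs on the actions, each with all self-loops. In round $t$ an action $A_t$ is played and exactly $A_t$ and the rewards $Y_{t,a}$ of the out-neighbours $a$ of $A_t$ in $G_t$ are observed; $\mathcal F_t$ is the $\sigma$-algebra generated by the observations made before round $t$. A policy draws $A_t$ from an $\mathcal F_t$-measurable distribution $\pi_t$, with randomness independent of the environment. The Bayesian regret is $\mathbb E[R(T,\pi)]=\mathbb E\big[\sum_{t=1}^T (Y_{t,A^*}-Y_{t,A_t})\big]$. The algorithm TS-U with parameter $\epsilon$ is the policy $\pi_t=(1-\epsilon)\alpha_t+\epsilon/K$, where $\alpha_t=\mathbb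 P(A^*=\cdot\mid\mathcal F_t)$. The independence number $\beta_0(G)$ of a directed graph $G$ is the largest size of a set of vertices no two distinct members of which are joined by an arc (in either orientation). **Theorem.** 1. For every $h>0$ there is a constant $C$ depending only on $h$ such that, for all $K$, all $T\ge1$, all $G_1,\dots,G_T$ and all priors with $H(\alpha_1)\log(KT)\ge h$, TS-U with $\epsilon=1/\sqrt T$ satisfies $$\mathbb E[R(T,\pi)]\le C\sqrt{\log(KT)\,\sum_{t=1}^T\beta_0(G_t)\,H(\alpha_1)} .$$ 2. There is a universal constant $C$ such that, for all $K$, all $T\ge 1$, all $G_1,\dots,G_T$ and all priors, TS-U with $\epsilon=1/\sqrt T$ satisfies $$\mathbb E[R(T,\pi)]\le \sqrt T+C\sqrt{\log(KT)\,\sum_{t=1}^T\beta_0(G_t)\,H(\alpha_1)} .$$ 3. The bound is optimal up to logarithmic factors: there is a universal constant $c>0$ such that, for every $K\ge2$, every directed graph $G$ on the $K$ actions with all self-loops and every $T\ge\beta_0(G)^3$, there is a prior under which the arms are independent (almost surely $p^*$ is a product measure, and its marginals are independent) and for which every policy, when $G_t=G$ for all $t$, satisfies $\mathbb E[R(T,\pi)]\ge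 c\sqrt{\beta_0(G)\,T}$. -/

import Mathlib

open MeasureTheory ProbabilityTheory
open scoped unitInterval

universe u

/-- The vector of rewards of one round: one number in `[0, 1]` for each of the `K` actions. -/
abbrev Rewards (K : ℕ) : Type := Fin K → I

/-- The independence number of a directed graph: the largest size of a set of vertices no two
(distinct) members of which are joined by an arc, in either orientation. -/
noncomputable def Digraph.independenceNumber {V : Type*} (G : Digraph V) : ℕ :=
  G.toSimpleGraphInclusive.indepNum

/-- The random variables of a Bayesian `K`-armed bandit played for `T` rounds, on a sample
space `Ω`. The rounds `1, …, T` are indexed by `Fin T`. -/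
structure BanditProcess (K T : ℕ) (Ω : Type u) where
  /-- the unknown true reward distribution `p*`, a random distribution on `[0,1]^K` -/
  pStar : Ω → Measure (Rewards K)
  /-- the true optimal action `A*` -/
  aStar : Ω → Fin K
  /-- the reward vectors `Y_t` -/
  Y : Fin T → Ω → Rewards K
  /-- the actions `A_t` of the decision maker -/
  A : Fin T → Ω → Fin K

namespace BanditProcess

variable {K T : ℕ} {Ω : Type u}

open Classical in
/-- What the decision maker observes at the end of round `t` when the latent graph of that round
is `G t`: the action `A_t`, and the reward of every out-neighbour of `A_t` (the other entries are
masked by `0`; which entries are masked is a function of `A_t`). -/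
noncomputable def observation (X : BanditProcess K T Ω) (G : Fin T → Digraph (Fin K))
    (t : Fin T) (ω : Ω) : Fin K × Rewards K :=
  (X.A t ω, fun a => if (G t).Adj (X.A t ω) a then X.Y t ω a else 0)

/-- The sigma-algebra `F_t` generated by the observations made before round `t`. -/
noncomputable abbrev history (X : BanditProcess K T Ω) (G : Fin T → Digraph (Fin K)) (t : Fin T) :
    MeasurableSpace Ω :=
  ⨆ s : Fin T, ⨆ _ : s < t, MeasurableSpace.comap (X.observation G s) inferInstance

/-- The sigma-algebra generated by the whole environment `(p*, A*, Y_1, …, Y_T)` and by the actions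
taken before round `t`. -/
abbrev environment (X : BanditProcess K T Ω) (t : Fin T) : MeasurableSpace Ω :=
  MeasurableSpace.comap X.pStar inferInstance ⊔ MeasurableSpace.comap X.aStar inferInstance ⊔
    (⨆ s : Fin T, MeasurableSpace.comap (X.Y s) inferInstance) ⊔
    (⨆ s : Fin T, ⨆ _ : s < t, MeasurableSpace.comap (X.A s) inferInstance)

/-- `X` is a Bayesian stochastic bandit with graph feedback, under the probability `P`, with
(deterministic, possibly directed) feedback graphs `G t`, in which the actions are chosen by some
randomized policy. The prior is the law of `p*` under `P`. -/
structure IsGraphBandit [MeasurableSpace Ω] (X : BanditProcess K T Ω)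
    (G : Fin T → Digraph (Fin K)) (P : Measure Ω) : Prop where
  measurable_pStar : Measurable X.pStar
  measurable_aStar : Measurable X.aStar
  measurable_Y : ∀ t, Measurable (X.Y t)
  measurable_A : ∀ t, Measurable (X.A t)
  isProbabilityMeasure_pStar : ∀ ω, IsProbabilityMeasure (X.pStar ω)
  /-- `A*` maximizes the mean reward under `p*`. -/
  aStar_optimal : ∀ᵐ ω ∂P, ∀ a,
    ∫ y, (y a : ℝ) ∂(X.pStar ω) ≤ ∫ y, (y (X.aStar ω) : ℝ) ∂(X.pStar ω)
  /-- Conditionally on `p*` (and on the way ties are broken in the choice of `A*`), the reward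
  vectors are independent with common distribution `p*`. -/
  reward_law : ∀ (B : Set (Measure (Rewards K))) (a : Fin K) (S : Fin T → Set (Rewards K)),
    MeasurableSet B → (∀ t, MeasurableSet (S t)) →
    P (X.pStar ⁻¹' B ∩ X.aStar ⁻¹' {a} ∩ ⋂ t, X.Y t ⁻¹' S t) =
      ∫⁻ ω in X.pStar ⁻¹' B ∩ X.aStar ⁻¹' {a}, ∏ t, X.pStar ω (S t) ∂P
  /-- The action of round `t` is drawn on the basis of the observed history only: given `F_t`, it
  is independent of the environment. -/
  action_law : ∀ (t : Fin T) (a : Fin K),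
    P⟦X.A t ⁻¹' {a} | X.environment t⟧ =ᵐ[P] P⟦X.A t ⁻¹' {a} | X.history G t⟧

/-- The actions are those of the algorithm TS-U with parameter `ε`: given the history, `A_t` has
the distribution `π_t = (1 - ε) α_t + ε / K`, where `α_t` is the posterior distribution of `A*`. -/
def IsTSU [MeasurableSpace Ω] (X : BanditProcess K T Ω) (G : Fin T → Digraph (Fin K))
    (P : Measure Ω) (ε : ℝ) : Prop :=
  ∀ (t : Fin T) (a : Fin K), P⟦X.A t ⁻¹' {a} | X.history G t⟧ =ᵐ[P]
    fun ω => (1 - ε) * (P⟦X.aStar ⁻¹' {a} | X.history G t⟧) ω + ε / K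

/-- The Bayesian regret `E[∑_t (Y_{t,A*} - Y_{t,A_t})]`. -/
noncomputable def regret [MeasurableSpace Ω] (X : BanditProcess K T Ω) (P : Measure Ω) : ℝ :=
  ∫ ω, ∑ t, ((X.Y t ω (X.aStar ω) : ℝ) - (X.Y t ω (X.A t ω) : ℝ)) ∂P

/-- The Shannon entropy (natural logarithm) `H(α₁)` of the prior distribution `α₁` of `A*`. -/
noncomputable def priorEntropy [MeasurableSpace Ω] (X : BanditProcess K T Ω)
    (P : Measure Ω) : ℝ :=
  -∑ a, P.real (X.aStar ⁻¹' {a}) * Real.log (P.real (X.aStar ⁻¹' {a}))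

/-- The rate `sqrt (log (K T) * ∑_t β₀(G_t) * H(α₁))`. -/
noncomputable def rate [MeasurableSpace Ω] (X : BanditProcess K T Ω)
    (G : Fin T → Digraph (Fin K)) (P : Measure Ω) : ℝ :=
  Real.sqrt (Real.log (K * T) * (∑ t, ((G t).independenceNumber : ℝ)) * X.priorEntropy P)

end BanditProcess

/-- A prior `ρ` on reward distributions under which the arms are independent: almost every reward
distribution is a product measure, and its marginals are independent random measures. -/
def IsIndependentArmsPrior {K : ℕ} (ρ : Measure (Measure (Rewards K))) : Prop :=
  (∀ᵐ p ∂ρ, IsProbabilityMeasure p ∧ p = Measure.pi (fun a => p.map (fun y => y a))) ∧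
    iIndepFun (fun (a : Fin K) (p : Measure (Rewards K)) => p.map (fun y => y a)) ρ

/-!
Upper bounds. Let `α` be the posterior of the optimal action before a round, `D` the posterior
after it, `π = (1 - ε) α + ε / K` the distribution of the action, and `s a` the in-weight of `a`
under `π`, that is, the conditional probability that the reward of `a` is observed. Up to `ε`, the
regret of the round is at most the sum over `a` of the covariances of `A* = a` with the reward of
`a` (`integral_regret_le`). Each covariance can be computed from the rounds in which `a` is
observed, with importance weight `1 / s a`; as the reward is then part of the history, the
indicator of `A* = a` may be replaced by `D a`, and the covariance becomes a mean of `(D a - α a) /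
s a`. A Pinsker type bound for the single terms of the relative entropy of `D` with respect to `α`,
and the arithmetic-geometric mean inequality with a parameter `l`, bound the sum over `a` by `2 l ∑
α a / s a` plus the information gain divided by `2 l` (`integral_covariance_le`). The information
gains telescope to the prior entropy (`regret_le_of_pos`), and `∑ π a / s a` is at most `1 + 2 β₀
log (K / ε)` (`Digraph.sum_div_inWeight_le`). The last fact holds for every directed graph with
self-loops: if all in-weights are at most `c`, then a greedy choice of vertices of small out-weight
yields an independent set with more than `n` members as soon as the total weight exceeds `2 c n`;
so a vertex of maximal in-weight contributes at most `2 β₀` times its share of the weight, and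
removing such vertices one by one sums these shares to a logarithm. It remains to optimise `l`
(`regret_le_add_rate`).

Lower bound. Let `S` be a maximum independent set, or a pair of arms if `β₀ = 1`, and `n` its size.
Under the prior, the arms of `S` have Bernoulli rewards of mean `1 / 2 + δ` with probability `1 /
n` and of mean `1 / 2` otherwise, independently; the other arms are clearly worse. An arm of `S` is
then observed only when it is itself played (or the other one, in the case of a pair) or when an
arm outside `S` is played, and the latter costs at least `1 / 4`. Changing the measure from "`a` is
good" to "`a` is not good" shows that a good arm `a` is hardly played more often than its prior
probability suggests unless it has been observed about `δ⁻²` times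
(`real_armEvent_true_inter_action_le`). The number of observations of the arms of `S` is at most `2
T` plus `n` times the number of rounds spent outside `S` (`sum_expectedSeen_le`), so that with `δ`
a small multiple of `√(n / T)` a constant fraction of the rounds has regret of order `δ`, where `T
≥ β₀ ^ 3` rules out that the exploration outside `S` pays off (`regret_ge`, `sqrt_le_of_gap`). The
change of measure is carried out on the finitely many records of binary observations, by a
recursion over the rounds.
-/

/-! ### In-weights and the independence number of a directed graph -/

namespace Digraph

variable {V : Type*}

open Classical in
/-- The total weight of the in-neighbours of `i` inside `U`. -/
noncomputable def inWeight (G : Digraph V) (p : V → ℝ) (U : Finset V) (i : V) : ℝ :=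
  ∑ j ∈ U, if G.Adj j i then p j else 0

lemma inWeight_mono (G : Digraph V) {p : V → ℝ} (hp : ∀ i, 0 < p i) {U W : Finset V}
    (h : U ⊆ W) (i : V) : G.inWeight p U i ≤ G.inWeight p W i := by
  classical
  refine Finset.sum_le_sum_of_subset_of_nonneg h fun j _ _ => ?_
  split_ifs
  · exact (hp j).le
  · exact le_rfl

lemma le_inWeight_self (G : Digraph V) (hG : ∀ i, G.Adj i i) {p : V → ℝ} (hp : ∀ i, 0 < p i)
    {U : Finset V} {i : V} (hi : i ∈ U) : p i ≤ G.inWeight p U i := by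
  classical
  have := Finset.single_le_sum (f := fun j => if G.Adj j i then p j else 0) (s := U)
    (fun j _ => by split_ifs; exacts [(hp j).le, le_rfl]) hi
  simpa [inWeight, hG] using this

/-- Greedy construction of independent sets. As the `p`-averages of in-weights and out-weights
agree, some vertex has out-weight at most `c`; selecting it and discarding its neighbours costs at
most `2 * c` of the total weight. -/
lemma exists_isIndepSet_of_inWeight_le (G : Digraph V) (hG : ∀ i, G.Adj i i) {p : V → ℝ}
    (hp : ∀ i, 0 < p i) {c : ℝ} (hc0 : 0 ≤ c) (n : ℕ) (U : Finset V)
    (hc : ∀ i ∈ U, G.inWeight p U i ≤ c) (hn : 2 * c * n < ∑ i ∈ U, p i) :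
    ∃ J ⊆ U, G.toSimpleGraphInclusive.IsIndepSet (J : Set V) ∧ J.card = n + 1 := by
  classical
  induction n generalizing U with
  | zero =>
    have hU : U.Nonempty := by
      rw [Finset.nonempty_iff_ne_empty]
      rintro rfl
      simp at hn
    obtain ⟨i, hi⟩ := hU
    exact ⟨{i}, by simpa using hi, by simp [SimpleGraph.isIndepSet_iff], by simp⟩
  | succ n ih =>
    have hcomm : ∑ i ∈ U, p i * ∑ j ∈ U, (if G.Adj i j then p j else 0)
        = ∑ i ∈ U, p i * G.inWeight p U i := by
      simp only [inWeight, Finset.mul_sum]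
      rw [Finset.sum_comm]
      refine Finset.sum_congr rfl fun i _ => Finset.sum_congr rfl fun j _ => ?_
      split_ifs <;> ring
    have hU : U.Nonempty := by
      rw [Finset.nonempty_iff_ne_empty]
      rintro rfl
      have : 0 ≤ 2 * c * ((n + 1 : ℕ) : ℝ) := by positivity
      simp only [Finset.sum_empty] at hn
      linarith
    obtain ⟨i, hi, hout⟩ : ∃ i ∈ U, p i * ∑ j ∈ U, (if G.Adj i j then p j else 0) ≤ p i * c := by
      refine Finset.exists_le_of_sum_le hU ?_
      rw [hcomm]
      exact Finset.sum_le_sum fun i hi => mul_le_mul_of_nonneg_left (hc i hi) (hp i).le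
    have hout := le_of_mul_le_mul_left hout (hp i)
    set U' := U.filter fun j => ¬ (G.Adj i j ∨ G.Adj j i) with hU'
    have hsub : U' ⊆ U := Finset.filter_subset _ _
    have hlost : ∑ j ∈ U, p j ≤ ∑ j ∈ U', p j + 2 * c := by
      have h1 : ∑ j ∈ U with (G.Adj i j ∨ G.Adj j i), p j
          ≤ ∑ j ∈ U, ((if G.Adj i j then p j else 0) + (if G.Adj j i then p j else 0)) := by
        rw [Finset.sum_filter]
        refine Finset.sum_le_sum fun j _ => ?_
        have := (hp j).le
        split_ifs <;> first | linarith | (exfalso; tauto)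
      rw [Finset.sum_add_distrib] at h1
      have h2 := hc i hi
      rw [inWeight] at h2
      rw [← Finset.sum_filter_add_sum_filter_not U (fun j => G.Adj i j ∨ G.Adj j i)]
      linarith
    obtain ⟨J, hJU, hJ, hcard⟩ := ih U'
      (fun j hj => (G.inWeight_mono hp hsub j).trans (hc j (hsub hj)))
      (by push_cast at hn; linarith)
    have hiJ : i ∉ J := fun h => by
      have := hJU h
      simp [hU', hG] at this
    refine ⟨insert i J, Finset.insert_subset hi (hJU.trans hsub), ?_, ?_⟩
    · have hadj : ∀ j ∈ J, ¬ G.Adj i j ∧ ¬ G.Adj j i := fun j hj => by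
        have := (Finset.mem_filter.1 (hJU hj)).2
        tauto
      intro a ha b hb hab h
      simp only [toSimpleGraphInclusive, SimpleGraph.fromRel_adj] at h
      rcases Finset.mem_insert.1 (Finset.mem_coe.1 ha) with rfl | ha'
      · rcases Finset.mem_insert.1 (Finset.mem_coe.1 hb) with rfl | hb'
        · exact hab rfl
        · have := hadj b hb'
          tauto
      · rcases Finset.mem_insert.1 (Finset.mem_coe.1 hb) with rfl | hb'
        · have := hadj a ha'
          tauto
        · exact hJ ha' hb' hab (by simpa [toSimpleGraphInclusive] using h)
    · rw [Finset.card_insert_of_notMem hiJ, hcard]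

lemma sum_le_two_mul_independenceNumber_mul [Finite V] (G : Digraph V) (hG : ∀ i, G.Adj i i)
    {p : V → ℝ} (hp : ∀ i, 0 < p i) {c : ℝ} (hc0 : 0 ≤ c) (U : Finset V)
    (hc : ∀ i ∈ U, G.inWeight p U i ≤ c) :
    ∑ i ∈ U, p i ≤ 2 * c * G.independenceNumber := by
  by_contra! h
  obtain ⟨J, -, hJ, hcard⟩ := G.exists_isIndepSet_of_inWeight_le hG hp hc0 _ U hc h
  have := hJ.card_le_indepNum
  rw [hcard, independenceNumber] at this
  omega

/-- The vertices are removed in order of decreasing in-weight: a vertex of maximal in-weight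
contributes at most `2 β₀ p i / W`, where `W` is the weight not yet removed, and these fractions
add up to a logarithm. -/
lemma sum_div_inWeight_le [Finite V] (G : Digraph V) (hG : ∀ i, G.Adj i i) {p : V → ℝ} {e : ℝ}
    (he : 0 < e) (hp : ∀ i, e ≤ p i) (U : Finset V) (hU : U.Nonempty) :
    ∑ i ∈ U, p i / G.inWeight p U i
      ≤ 1 + 2 * G.independenceNumber * Real.log ((∑ i ∈ U, p i) / e) := by
  classical
  have hp0 : ∀ i, 0 < p i := fun i => he.trans_le (hp i)
  induction hU using Finset.Nonempty.strong_induction with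
  | h₀ i =>
    have h1 : p i / G.inWeight p {i} i = 1 := by
      simp [inWeight, hG, (hp0 i).ne']
    have h2 : 0 ≤ Real.log (p i / e) := Real.log_nonneg ((one_le_div he).2 (hp i))
    simp only [Finset.sum_singleton, h1]
    have := mul_nonneg (mul_nonneg (zero_le_two (α := ℝ)) (Nat.cast_nonneg G.independenceNumber)) h2
    linarith
  | @h₁ U hU ih =>
    obtain ⟨i, hi, hmax⟩ := U.exists_max_image (G.inWeight p U) hU.nonempty
    have hU' : (U.erase i).Nonempty := (Finset.erase_nonempty hi).2 hU
    have hin : ∀ j ∈ U, 0 < G.inWeight p U j := fun j hj =>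
      (hp0 j).trans_le (G.le_inWeight_self hG hp0 hj)
    have hW := G.sum_le_two_mul_independenceNumber_mul hG hp0 (hin i hi).le U hmax
    have hWpos : 0 < ∑ j ∈ U, p j := Finset.sum_pos (fun j _ => hp0 j) hU.nonempty
    have hWpos' : 0 < ∑ j ∈ U.erase i, p j := Finset.sum_pos (fun j _ => hp0 j) hU'
    have hsplit : ∑ j ∈ U.erase i, p j + p i = ∑ j ∈ U, p j := Finset.sum_erase_add _ _ hi
    have h1 : p i / G.inWeight p U i
        ≤ 2 * G.independenceNumber * (p i / ∑ j ∈ U, p j) := by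
      rw [← mul_div_assoc, div_le_div_iff₀ (hin i hi) hWpos]
      nlinarith [hp0 i]
    have h2 : p i / ∑ j ∈ U, p j
        ≤ Real.log ((∑ j ∈ U, p j) / e) - Real.log ((∑ j ∈ U.erase i, p j) / e) := by
      have := Real.log_le_sub_one_of_pos (div_pos hWpos' hWpos)
      rw [Real.log_div hWpos'.ne' hWpos.ne'] at this
      rw [Real.log_div hWpos.ne' he.ne', Real.log_div hWpos'.ne' he.ne']
      have h3 : p i / ∑ j ∈ U, p j = 1 - (∑ j ∈ U.erase i, p j) / ∑ j ∈ U, p j := by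
        rw [eq_sub_iff_add_eq, ← add_div, div_eq_one_iff_eq hWpos.ne']
        linarith
      linarith
    have h3 : ∑ j ∈ U.erase i, p j / G.inWeight p U j
        ≤ ∑ j ∈ U.erase i, p j / G.inWeight p (U.erase i) j := by
      refine Finset.sum_le_sum fun j hj => ?_
      exact div_le_div_of_nonneg_left (hp0 j).le
        ((hp0 j).trans_le (G.le_inWeight_self hG hp0 hj))
        (G.inWeight_mono hp0 (Finset.erase_subset _ _) j)
    have h4 := ih _ hU' (Finset.erase_ssubset hi)
    rw [← Finset.sum_erase_add _ _ hi]
    have h5 := mul_le_mul_of_nonneg_left h2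
      (mul_nonneg (zero_le_two (α := ℝ)) (Nat.cast_nonneg G.independenceNumber))
    linarith

lemma one_le_independenceNumber [Finite V] [Nonempty V] (G : Digraph V) :
    1 ≤ G.independenceNumber := by
  obtain ⟨i⟩ := ‹Nonempty V›
  have : G.toSimpleGraphInclusive.IsIndepSet (({i} : Finset V) : Set V) := by
    simp [SimpleGraph.isIndepSet_iff]
  simpa [independenceNumber] using this.card_le_indepNum

end Digraph

/-! ### Histories, environments and conditional expectations -/

lemma MeasureTheory.integral_mul_condExp_of_bounded {Ω : Type*} {m m0 : MeasurableSpace Ω}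
    {P : Measure Ω} [IsFiniteMeasure P] (hm : m ≤ m0) {f W : Ω → ℝ} (hf : Integrable f P)
    (hW : StronglyMeasurable[m] W) {c : ℝ} (hc : ∀ᵐ ω ∂P, |W ω| ≤ c) :
    ∫ ω, W ω * f ω ∂P = ∫ ω, W ω * (P[f | m]) ω ∂P := by
  rw [← integral_condExp hm]
  exact integral_congr_ae (condExp_stronglyMeasurable_mul_of_bound hm hW hf c hc)

namespace BanditProcess

variable {K T : ℕ} {Ω : Type u}

/-- The sigma-algebra generated by the observations of the first `n` rounds. For `n = t` with
`t : Fin T` it is `X.history G t` by definition; unlike `history`, it is also defined for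
`n = T`. -/
noncomputable abbrev historyUpTo (X : BanditProcess K T Ω) (G : Fin T → Digraph (Fin K)) (n : ℕ) :
    MeasurableSpace Ω :=
  ⨆ s : Fin T, ⨆ _ : (s : ℕ) < n, MeasurableSpace.comap (X.observation G s) inferInstance

lemma historyUpTo_zero (X : BanditProcess K T Ω) (G : Fin T → Digraph (Fin K)) :
    X.historyUpTo G 0 = ⊥ := by
  simp [historyUpTo]

lemma historyUpTo_mono (X : BanditProcess K T Ω) (G : Fin T → Digraph (Fin K)) {n k : ℕ}
    (h : n ≤ k) : X.historyUpTo G n ≤ X.historyUpTo G k :=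
  iSup_mono fun _ => iSup_mono' fun hs => ⟨hs.trans_le h, le_rfl⟩

lemma measurable_observation_of {m : MeasurableSpace Ω} (X : BanditProcess K T Ω)
    (G : Fin T → Digraph (Fin K)) {s : Fin T} (hA : Measurable (X.A s))
    (hY : Measurable (X.Y s)) : Measurable (X.observation G s) := by
  classical
  refine hA.prodMk (measurable_pi_lambda _ fun a => ?_)
  refine Measurable.ite ?_ ((measurable_pi_apply a).comp hY) measurable_const
  exact hA (MeasurableSet.of_discrete (s := {i | (G s).Adj i a}))

lemma measurable_aStar_environment (X : BanditProcess K T Ω) (t : Fin T) :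
    Measurable[X.environment t] X.aStar :=
  (comap_measurable X.aStar).mono
    (le_sup_of_le_left (le_sup_of_le_left le_sup_right)) le_rfl

lemma measurable_pStar_environment (X : BanditProcess K T Ω) (t : Fin T) :
    Measurable[X.environment t] X.pStar :=
  (comap_measurable X.pStar).mono
    (le_sup_of_le_left (le_sup_of_le_left le_sup_left)) le_rfl

lemma measurable_Y_environment (X : BanditProcess K T Ω) (t s : Fin T) :
    Measurable[X.environment t] (X.Y s) :=
  (comap_measurable (X.Y s)).mono
    (le_sup_of_le_left (le_sup_of_le_right
      (le_iSup (fun s => MeasurableSpace.comap (X.Y s) inferInstance) s))) le_rfl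

lemma measurable_A_environment (X : BanditProcess K T Ω) {t s : Fin T} (h : s < t) :
    Measurable[X.environment t] (X.A s) :=
  (comap_measurable (X.A s)).mono
    (le_sup_of_le_right
      (le_iSup₂ (f := fun s (_ : s < t) => MeasurableSpace.comap (X.A s) inferInstance) s h))
    le_rfl

lemma historyUpTo_le_environment (X : BanditProcess K T Ω) (G : Fin T → Digraph (Fin K))
    (t : Fin T) : X.historyUpTo G t ≤ X.environment t :=
  iSup₂_le fun s hs => Measurable.comap_le
    (X.measurable_observation_of G (X.measurable_A_environment hs)
      (X.measurable_Y_environment t s))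

lemma measurable_observation_historyUpTo (X : BanditProcess K T Ω) (G : Fin T → Digraph (Fin K))
    (s : Fin T) {n : ℕ} (hs : (s : ℕ) < n) :
    Measurable[X.historyUpTo G n] (X.observation G s) :=
  (comap_measurable (X.observation G s)).mono
    (le_iSup₂ (f := fun (s : Fin T) (_ : (s : ℕ) < n) =>
      MeasurableSpace.comap (X.observation G s) inferInstance) s hs) le_rfl

variable [mΩ : MeasurableSpace Ω] {P : Measure Ω} {X : BanditProcess K T Ω}
  {G : Fin T → Digraph (Fin K)}

lemma IsGraphBandit.environment_le (hX : X.IsGraphBandit G P) (t : Fin T) :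
    X.environment t ≤ mΩ := by
  refine sup_le (sup_le (sup_le ?_ ?_) ?_) ?_
  · exact hX.measurable_pStar.comap_le
  · exact hX.measurable_aStar.comap_le
  · exact iSup_le fun s => (hX.measurable_Y s).comap_le
  · exact iSup₂_le fun s _ => (hX.measurable_A s).comap_le

lemma IsGraphBandit.historyUpTo_le (hX : X.IsGraphBandit G P) (n : ℕ) :
    X.historyUpTo G n ≤ mΩ :=
  iSup₂_le fun s _ =>
    (X.measurable_observation_of G (hX.measurable_A s) (hX.measurable_Y s)).comap_le

/-- Given the history, the action is independent of the environment: integrated against a function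
of the environment, the indicator of an action may be replaced by the policy. -/
lemma IsGraphBandit.integral_action_mul [IsProbabilityMeasure P] (hX : X.IsGraphBandit G P)
    (t : Fin T) (i : Fin K) {W : Ω → ℝ} (hW : StronglyMeasurable[X.environment t] W) {c : ℝ}
    (hc : ∀ᵐ ω ∂P, |W ω| ≤ c) :
    ∫ ω, W ω * (X.A t ⁻¹' {i}).indicator (fun _ => (1 : ℝ)) ω ∂P
      = ∫ ω, W ω * (P⟦X.A t ⁻¹' {i} | X.history G t⟧) ω ∂P := by
  rw [integral_mul_condExp_of_bounded (hX.environment_le t)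
    ((integrable_const 1).indicator (hX.measurable_A t (measurableSet_singleton i))) hW hc]
  refine integral_congr_ae ?_
  filter_upwards [hX.action_law t i] with ω hω
  simp only [hω]

/-! ### The posterior distribution of the optimal action -/

/-- The posterior probability `α(a)` of the event `A* = a` after `n` rounds. -/
noncomputable def posterior (X : BanditProcess K T Ω) (G : Fin T → Digraph (Fin K))
    (P : Measure Ω) (n : ℕ) (a : Fin K) : Ω → ℝ :=
  P⟦X.aStar ⁻¹' {a} | X.historyUpTo G n⟧

lemma stronglyMeasurable_posterior (n : ℕ) (a : Fin K) :
    StronglyMeasurable[X.historyUpTo G n] (X.posterior G P n a) :=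
  stronglyMeasurable_condExp

variable [IsProbabilityMeasure P]

lemma IsGraphBandit.integrable_indicator_aStar (hX : X.IsGraphBandit G P) (a : Fin K) :
    Integrable ((X.aStar ⁻¹' {a}).indicator (fun _ => (1 : ℝ))) P :=
  (integrable_const 1).indicator (hX.measurable_aStar (measurableSet_singleton a))

lemma IsGraphBandit.posterior_mem_Icc (hX : X.IsGraphBandit G P) (n : ℕ) :
    ∀ᵐ ω ∂P, ∀ a, X.posterior G P n a ω ∈ Set.Icc (0 : ℝ) 1 := by
  rw [ae_all_iff]
  intro a
  have h0 : 0 ≤ᵐ[P] X.posterior G P n a :=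
    condExp_nonneg (ae_of_all _ fun ω => Set.indicator_nonneg (fun _ _ => zero_le_one) ω)
  have h1 : X.posterior G P n a ≤ᵐ[P] P[(fun _ => (1 : ℝ)) | X.historyUpTo G n] :=
    condExp_mono (hX.integrable_indicator_aStar a) (integrable_const 1)
      (ae_of_all _ fun ω => Set.indicator_le_self' (fun _ _ => zero_le_one) ω)
  rw [condExp_const (hX.historyUpTo_le n)] at h1
  filter_upwards [h0, h1] with ω h0 h1 using ⟨h0, h1⟩

lemma IsGraphBandit.sum_posterior (hX : X.IsGraphBandit G P) (n : ℕ) :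
    ∀ᵐ ω ∂P, ∑ a, X.posterior G P n a ω = 1 := by
  have h := condExp_finsetSum (s := Finset.univ) (μ := P)
    (fun a _ => hX.integrable_indicator_aStar a) (X.historyUpTo G n)
  have h1 : ∑ a, (X.aStar ⁻¹' {a}).indicator (fun _ => (1 : ℝ)) = fun _ => 1 := by
    ext ω
    simp only [Finset.sum_apply, Set.indicator, Set.mem_preimage, Set.mem_singleton_iff]
    simp
  rw [h1, condExp_const (hX.historyUpTo_le n)] at h
  filter_upwards [h] with ω hω
  simpa [posterior] using hω.symm

lemma IsGraphBandit.integral_mul_posterior (hX : X.IsGraphBandit G P) (n : ℕ) (a : Fin K)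
    {W : Ω → ℝ} (hW : StronglyMeasurable[X.historyUpTo G n] W) {c : ℝ} (hc : ∀ᵐ ω ∂P, |W ω| ≤ c) :
    ∫ ω, W ω * X.posterior G P n a ω ∂P
      = ∫ ω, W ω * (X.aStar ⁻¹' {a}).indicator (fun _ => (1 : ℝ)) ω ∂P :=
  (integral_mul_condExp_of_bounded (hX.historyUpTo_le n)
    (hX.integrable_indicator_aStar a) hW hc).symm

end BanditProcess

/-! ### The regret of one round of TS-U -/

/-- A Pinsker type bound for a single term of the relative entropy. -/
lemma Real.sq_sub_le_two_mul_add_mul_log {x y : ℝ} (hx : 0 < x) (hy : 0 < y) :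
    (x - y) ^ 2 ≤ 2 * (x + y) * (x * Real.log x - x * Real.log y - x + y) := by
  obtain ⟨a, ha, rfl⟩ : ∃ a, 0 < a ∧ a ^ 2 = x := ⟨√x, Real.sqrt_pos.2 hx, Real.sq_sqrt hx.le⟩
  obtain ⟨b, hb, rfl⟩ : ∃ b, 0 < b ∧ b ^ 2 = y := ⟨√y, Real.sqrt_pos.2 hy, Real.sq_sqrt hy.le⟩
  have h1 : (a - b) ^ 2
      ≤ a ^ 2 * Real.log (a ^ 2) - a ^ 2 * Real.log (b ^ 2) - a ^ 2 + b ^ 2 := by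
    have h := Real.log_le_sub_one_of_pos (div_pos hb ha)
    rw [Real.log_div hb.ne' ha.ne'] at h
    have h2 : a ^ 2 * (Real.log b - Real.log a) ≤ a ^ 2 * (b / a - 1) :=
      mul_le_mul_of_nonneg_left h (sq_nonneg a)
    have h3 : a ^ 2 * (b / a - 1) = a * b - a ^ 2 := by field_simp
    rw [Real.log_pow, Real.log_pow]
    push_cast
    nlinarith
  calc (a ^ 2 - b ^ 2) ^ 2 = (a + b) ^ 2 * (a - b) ^ 2 := by ring
    _ ≤ (2 * (a ^ 2 + b ^ 2)) * (a - b) ^ 2 :=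
        mul_le_mul_of_nonneg_right (by nlinarith [sq_nonneg (a - b)]) (sq_nonneg _)
    _ ≤ _ := mul_le_mul_of_nonneg_left h1 (by positivity)

namespace BanditProcess

variable {K T : ℕ} {Ω : Type u} {X : BanditProcess K T Ω} {G : Fin T → Digraph (Fin K)}

open Classical in
/-- The indicator function of the event that the reward of `a` is observed in round `t`. -/
noncomputable def seen (X : BanditProcess K T Ω) (G : Fin T → Digraph (Fin K)) (t : Fin T)
    (a : Fin K) (ω : Ω) : ℝ :=
  if (G t).Adj (X.A t ω) a then 1 else 0

lemma seen_nonneg (t : Fin T) (a : Fin K) (ω : Ω) : 0 ≤ X.seen G t a ω := by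
  unfold seen; split_ifs <;> norm_num

lemma seen_le_one (t : Fin T) (a : Fin K) (ω : Ω) : X.seen G t a ω ≤ 1 := by
  unfold seen; split_ifs <;> norm_num

lemma seen_mul_self (t : Fin T) (a : Fin K) (ω : Ω) :
    X.seen G t a ω * X.seen G t a ω = X.seen G t a ω := by
  unfold seen; split_ifs <;> norm_num

lemma measurable_seen_historyUpTo (t : Fin T) (a : Fin K) {n : ℕ} (hn : (t : ℕ) < n) :
    Measurable[X.historyUpTo G n] (X.seen G t a) := by
  classical
  have h := (X.measurable_observation_historyUpTo G t hn).fst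
  exact Measurable.ite (h (MeasurableSet.of_discrete (s := {i | (G t).Adj i a})))
    measurable_const measurable_const

lemma measurable_reward_mul_seen_historyUpTo (t : Fin T) (a : Fin K) {n : ℕ}
    (hn : (t : ℕ) < n) :
    Measurable[X.historyUpTo G n] (fun ω => (X.Y t ω a : ℝ) * X.seen G t a ω) := by
  have h := (measurable_pi_apply a).comp (X.measurable_observation_historyUpTo G t hn).snd
  convert measurable_subtype_coe.comp h using 1
  ext ω
  simp only [seen, observation, Function.comp]
  split_ifs <;> simp

variable [mΩ : MeasurableSpace Ω] {P : Measure Ω} {ε : ℝ}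

/-- The probability that TS-U with parameter `ε` plays `i` after `n` rounds. -/
noncomputable def tsuProb (X : BanditProcess K T Ω) (G : Fin T → Digraph (Fin K))
    (P : Measure Ω) (ε : ℝ) (n : ℕ) (i : Fin K) (ω : Ω) : ℝ :=
  (1 - ε) * X.posterior G P n i ω + ε / K

lemma stronglyMeasurable_tsuProb (n : ℕ) (i : Fin K) :
    StronglyMeasurable[X.historyUpTo G n] (X.tsuProb G P ε n i) :=
  (stronglyMeasurable_const.mul (stronglyMeasurable_posterior n i)).add
    stronglyMeasurable_const

variable [IsProbabilityMeasure P]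

lemma IsGraphBandit.le_tsuProb (hX : X.IsGraphBandit G P) (hε : ε ≤ 1) (n : ℕ) :
    ∀ᵐ ω ∂P, ∀ i, ε / K ≤ X.tsuProb G P ε n i ω := by
  filter_upwards [hX.posterior_mem_Icc n] with ω hω i
  have := mul_nonneg (sub_nonneg.2 hε) (hω i).1
  unfold tsuProb
  linarith

lemma IsGraphBandit.sum_tsuProb (hX : X.IsGraphBandit G P) (hK : K ≠ 0) (n : ℕ) :
    ∀ᵐ ω ∂P, ∑ i, X.tsuProb G P ε n i ω = 1 := by
  filter_upwards [hX.sum_posterior n] with ω hω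
  have : (K : ℝ) ≠ 0 := by exact_mod_cast hK
  simp only [tsuProb, Finset.sum_add_distrib, ← Finset.mul_sum, hω, Finset.sum_const,
    Finset.card_univ, Fintype.card_fin, nsmul_eq_mul]
  field_simp
  ring

lemma IsGraphBandit.integral_action_mul_of_isTSU (hX : X.IsGraphBandit G P)
    (hTS : X.IsTSU G P ε) (t : Fin T) (i : Fin K) {W : Ω → ℝ}
    (hW : StronglyMeasurable[X.environment t] W) {c : ℝ} (hc : ∀ᵐ ω ∂P, |W ω| ≤ c) :
    ∫ ω, W ω * (X.A t ⁻¹' {i}).indicator (fun _ => (1 : ℝ)) ω ∂P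
      = ∫ ω, W ω * X.tsuProb G P ε t i ω ∂P := by
  rw [hX.integral_action_mul t i hW hc]
  refine integral_congr_ae ?_
  filter_upwards [hTS t i] with ω hω
  rw [hω]
  rfl

lemma IsGraphBandit.tsuProb_le_one (hX : X.IsGraphBandit G P) (hε0 : 0 ≤ ε) (hε : ε ≤ 1)
    (hK : K ≠ 0) (n : ℕ) :
    ∀ᵐ ω ∂P, ∀ i, X.tsuProb G P ε n i ω ∈ Set.Icc (0 : ℝ) 1 := by
  filter_upwards [hX.le_tsuProb hε n, hX.sum_tsuProb (ε := ε) hK n] with ω h1 h2 i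
  have h0 : ∀ i, 0 ≤ X.tsuProb G P ε n i ω := fun i =>
    (div_nonneg hε0 (Nat.cast_nonneg K)).trans (h1 i)
  exact ⟨h0 i, h2 ▸ Finset.single_le_sum (fun j _ => h0 j) (Finset.mem_univ i)⟩

/-- The conditional probability, given the history, that the reward of `a` is observed is the
in-weight of `a` with respect to the distribution of the action. -/
lemma IsGraphBandit.integral_mul_seen (hX : X.IsGraphBandit G P) (hTS : X.IsTSU G P ε)
    (hε0 : 0 ≤ ε) (hε : ε ≤ 1) (hK : K ≠ 0)
    (t : Fin T) (a : Fin K) {W : Ω → ℝ}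
    (hW : StronglyMeasurable[X.environment t] W) {c : ℝ} (hc : ∀ᵐ ω ∂P, |W ω| ≤ c) :
    ∫ ω, W ω * X.seen G t a ω ∂P
      = ∫ ω, W ω * (G t).inWeight (fun i => X.tsuProb G P ε t i ω) Finset.univ a ∂P := by
  classical
  have hW' : AEStronglyMeasurable W P := (hW.mono (hX.environment_le t)).aestronglyMeasurable
  have hπ : ∀ i, AEStronglyMeasurable (X.tsuProb G P ε t i) P := fun i =>
    ((stronglyMeasurable_tsuProb _ i).mono (hX.historyUpTo_le _)).aestronglyMeasurable
  have h1 : ∀ ω, W ω * X.seen G t a ω = ∑ i with (G t).Adj i a,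
      W ω * (X.A t ⁻¹' {i}).indicator (fun _ => (1 : ℝ)) ω := fun ω => by
    rw [← Finset.mul_sum]
    congr 1
    simp only [seen, Set.indicator, Set.mem_preimage, Set.mem_singleton_iff]
    simp
  have h2 : ∀ ω, W ω * (G t).inWeight (fun i => X.tsuProb G P ε t i ω) Finset.univ a
      = ∑ i with (G t).Adj i a, W ω * X.tsuProb G P ε t i ω := fun ω => by
    rw [← Finset.mul_sum, Finset.sum_filter]
    rfl
  simp only [h1, h2]
  rw [integral_finsetSum, integral_finsetSum]
  · exact Finset.sum_congr rfl fun i _ => hX.integral_action_mul_of_isTSU hTS t i hW hc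
  · intro i _
    refine Integrable.of_bound (hW'.mul (hπ i)) c ?_
    filter_upwards [hc, hX.tsuProb_le_one hε0 hε hK t] with ω h1 h2
    rw [Real.norm_eq_abs, abs_mul, abs_of_nonneg (h2 i).1]
    nlinarith [abs_nonneg (W ω), (h2 i).1, (h2 i).2]
  · intro i _
    refine Integrable.of_bound (hW'.mul (stronglyMeasurable_const.indicator
      (hX.measurable_A t (measurableSet_singleton i))).aestronglyMeasurable) c ?_
    filter_upwards [hc] with ω h1
    rw [Real.norm_eq_abs, abs_mul]
    have : |(X.A t ⁻¹' {i}).indicator (fun _ => (1 : ℝ)) ω| ≤ 1 := by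
      simp only [Set.indicator]
      split_ifs <;> simp
    nlinarith [abs_nonneg (W ω)]

/-- The regret of a round is, up to `ε`, at most the sum over the actions of the posterior
covariance of the events `A* = a` with the rewards of `a`. -/
lemma IsGraphBandit.integral_regret_le (hX : X.IsGraphBandit G P) (hTS : X.IsTSU G P ε)
    (hε0 : 0 ≤ ε) (hε : ε ≤ 1) (hK : K ≠ 0) (t : Fin T) :
    ∫ ω, ((X.Y t ω (X.aStar ω) : ℝ) - (X.Y t ω (X.A t ω) : ℝ)) ∂P
      ≤ ε + (1 - ε) * ∑ a, ∫ ω, ((X.aStar ⁻¹' {a}).indicator (fun _ => (1 : ℝ)) ω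
          - X.posterior G P t a ω) * X.Y t ω a ∂P := by
  classical
  have hy : ∀ a, Measurable fun ω => (X.Y t ω a : ℝ) := fun a =>
    measurable_subtype_coe.comp ((measurable_pi_apply a).comp (hX.measurable_Y t))
  have hye : ∀ a, StronglyMeasurable[X.environment t] fun ω => (X.Y t ω a : ℝ) := fun a =>
    (measurable_subtype_coe.comp
      ((measurable_pi_apply a).comp (X.measurable_Y_environment t t))).stronglyMeasurable
  have hy1 : ∀ a ω, |(X.Y t ω a : ℝ)| ≤ 1 := fun a ω => by
    rw [abs_of_nonneg (X.Y t ω a).2.1]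
    exact (X.Y t ω a).2.2
  have hα : ∀ a, AEStronglyMeasurable (X.posterior G P t a) P := fun a =>
    ((stronglyMeasurable_posterior _ a).mono (hX.historyUpTo_le _)).aestronglyMeasurable
  have hind : ∀ {s : Set Ω}, MeasurableSet s → ∀ a,
      Integrable (fun ω => (X.Y t ω a : ℝ) * s.indicator (fun _ => (1 : ℝ)) ω) P := by
    intro s hs a
    refine Integrable.of_bound ((hy a).mul (measurable_const.indicator hs)).aestronglyMeasurable 1
      (ae_of_all _ fun ω => ?_)
    rw [Real.norm_eq_abs, abs_mul, Set.indicator]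
    have := hy1 a ω
    split_ifs <;> simp [this]
  have hsum : ∀ f : Ω → Fin K, ∀ ω, (X.Y t ω (f ω) : ℝ)
      = ∑ a, (X.Y t ω a : ℝ) * (f ⁻¹' {a}).indicator (fun _ => (1 : ℝ)) ω := fun f ω => by
    simp only [Set.indicator, Set.mem_preimage, Set.mem_singleton_iff]
    simp
  have hIα : ∀ a, Integrable (fun ω => (X.Y t ω a : ℝ) * X.posterior G P t a ω) P := fun a => by
    refine Integrable.of_bound ((hy a).aestronglyMeasurable.mul (hα a)) 1 ?_
    filter_upwards [hX.posterior_mem_Icc t] with ω hω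
    rw [Real.norm_eq_abs, abs_mul, abs_of_nonneg (hω a).1]
    nlinarith [hy1 a ω, abs_nonneg (X.Y t ω a : ℝ), (hω a).1, (hω a).2]
  have h1 : ∀ a, ∫ ω, (X.Y t ω a : ℝ) * (X.A t ⁻¹' {a}).indicator (fun _ => (1 : ℝ)) ω ∂P
      ≥ (1 - ε) * ∫ ω, (X.Y t ω a : ℝ) * X.posterior G P t a ω ∂P := fun a => by
    rw [hX.integral_action_mul_of_isTSU hTS t a (hye a) (ae_of_all _ (hy1 a)),
      ← integral_const_mul]
    refine integral_mono_ae ((hIα a).const_mul _) ?_ (ae_of_all _ fun ω => ?_)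
    · refine Integrable.of_bound ((hy a).aestronglyMeasurable.mul
        ((stronglyMeasurable_tsuProb _ a).mono (hX.historyUpTo_le _)).aestronglyMeasurable) 1 ?_
      filter_upwards [hX.tsuProb_le_one hε0 hε hK t] with ω hω
      rw [Real.norm_eq_abs, abs_mul, abs_of_nonneg (hω a).1]
      nlinarith [hy1 a ω, abs_nonneg (X.Y t ω a : ℝ), (hω a).1, (hω a).2]
    · have := mul_nonneg (X.Y t ω a).2.1 (div_nonneg hε0 (Nat.cast_nonneg K))
      simp only [tsuProb]
      nlinarith
  have h2 : ∀ a, ∫ ω, ((X.aStar ⁻¹' {a}).indicator (fun _ => (1 : ℝ)) ω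
          - X.posterior G P t a ω) * X.Y t ω a ∂P
      = ∫ ω, (X.Y t ω a : ℝ) * (X.aStar ⁻¹' {a}).indicator (fun _ => (1 : ℝ)) ω ∂P
        - ∫ ω, (X.Y t ω a : ℝ) * X.posterior G P t a ω ∂P := fun a => by
    rw [← integral_sub (hind (hX.measurable_aStar (measurableSet_singleton a)) a) (hIα a)]
    exact integral_congr_ae (ae_of_all _ fun ω => by ring)
  have h3 : ∫ ω, ∑ a, (X.Y t ω a : ℝ) * (X.aStar ⁻¹' {a}).indicator (fun _ => (1 : ℝ)) ω ∂P
      ≤ 1 := by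
    simp only [← hsum X.aStar]
    calc _ ≤ ∫ _, (1 : ℝ) ∂P := integral_mono_of_nonneg (ae_of_all _ fun ω => (X.Y t ω _).2.1)
          (integrable_const 1) (ae_of_all _ fun ω => (X.Y t ω _).2.2)
      _ = 1 := by simp
  have h4 := hsum X.aStar
  have h5 := hsum (X.A t)
  simp only [h2, h4, h5]
  have hm1 : ∀ a ∈ Finset.univ, Integrable (fun ω => (X.Y t ω a : ℝ)
      * (X.aStar ⁻¹' {a}).indicator (fun _ => (1 : ℝ)) ω) P := fun a _ =>
    hind (hX.measurable_aStar (measurableSet_singleton a)) a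
  have hm2 : ∀ a ∈ Finset.univ, Integrable (fun ω => (X.Y t ω a : ℝ)
      * (X.A t ⁻¹' {a}).indicator (fun _ => (1 : ℝ)) ω) P := fun a _ =>
    hind (hX.measurable_A t (measurableSet_singleton a)) a
  rw [integral_sub (integrable_finsetSum _ hm1) (integrable_finsetSum _ hm2),
    integral_finsetSum _ hm1, integral_finsetSum _ hm2, Finset.sum_sub_distrib]
  rw [integral_finsetSum _ hm1] at h3
  have h6 := Finset.sum_le_sum (s := Finset.univ) fun a _ => h1 a
  rw [← Finset.mul_sum] at h6
  nlinarith

end BanditProcess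

/-! ### Information gain -/

namespace BanditProcess

variable {K T : ℕ} {Ω : Type u} [mΩ : MeasurableSpace Ω] {P : Measure Ω}
  {X : BanditProcess K T Ω} {G : Fin T → Digraph (Fin K)} {ε : ℝ}

/-- The contribution of the action `a` to the expected negative entropy of the posterior after `n`
rounds. The shift by `η` keeps the logarithms bounded; the limit `η → 0` is taken at the end. -/
noncomputable def negEntropyTerm (X : BanditProcess K T Ω) (G : Fin T → Digraph (Fin K))
    (P : Measure Ω) (η : ℝ) (n : ℕ) (a : Fin K) : ℝ :=
  ∫ ω, (X.posterior G P n a ω + η) * Real.log (X.posterior G P n a ω + η) ∂P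

/-- One term of the relative entropy of the posterior after `n + 1` rounds with respect to the
posterior after `n` rounds, shifted by `η`. -/
noncomputable def infoGain (X : BanditProcess K T Ω) (G : Fin T → Digraph (Fin K))
    (P : Measure Ω) (η : ℝ) (n : ℕ) (a : Fin K) (ω : Ω) : ℝ :=
  (X.posterior G P (n + 1) a ω + η) * Real.log (X.posterior G P (n + 1) a ω + η)
    - (X.posterior G P (n + 1) a ω + η) * Real.log (X.posterior G P n a ω + η)
    - (X.posterior G P (n + 1) a ω + η) + (X.posterior G P n a ω + η)

lemma abs_log_add_le {η x : ℝ} (hη : 0 < η) (hx : x ∈ Set.Icc (0 : ℝ) 1) :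
    |Real.log (x + η)| ≤ |Real.log η| + |Real.log (1 + η)| := by
  have h1 : Real.log η ≤ Real.log (x + η) := Real.log_le_log hη (by linarith [hx.1])
  have h2 : Real.log (x + η) ≤ Real.log (1 + η) :=
    Real.log_le_log (by linarith [hx.1]) (by linarith [hx.2])
  rw [abs_le]
  constructor <;>
    linarith [neg_abs_le (Real.log η), le_abs_self (Real.log (1 + η)),
      abs_nonneg (Real.log η), abs_nonneg (Real.log (1 + η))]

lemma IsGraphBandit.measurable_posterior (hX : X.IsGraphBandit G P) (n : ℕ) (a : Fin K) :
    Measurable (X.posterior G P n a) :=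
  ((stronglyMeasurable_posterior n a).mono (hX.historyUpTo_le n)).measurable

lemma sq_sub_le_infoGain {η : ℝ} (hη : 0 < η) {n : ℕ} {a : Fin K} {ω : Ω}
    (h0 : X.posterior G P n a ω ∈ Set.Icc (0 : ℝ) 1)
    (h1 : X.posterior G P (n + 1) a ω ∈ Set.Icc (0 : ℝ) 1) :
    (X.posterior G P (n + 1) a ω - X.posterior G P n a ω) ^ 2
      ≤ 2 * (X.posterior G P (n + 1) a ω + X.posterior G P n a ω + 2 * η)
        * X.infoGain G P η n a ω := by
  have := Real.sq_sub_le_two_mul_add_mul_log (x := X.posterior G P (n + 1) a ω + η)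
    (y := X.posterior G P n a ω + η) (by linarith [h1.1]) (by linarith [h0.1])
  calc _ = (X.posterior G P (n + 1) a ω + η - (X.posterior G P n a ω + η)) ^ 2 := by ring
    _ ≤ _ := this
    _ = _ := by simp only [infoGain]; ring

lemma infoGain_nonneg {η : ℝ} (hη : 0 < η) {n : ℕ} {a : Fin K} {ω : Ω}
    (h0 : X.posterior G P n a ω ∈ Set.Icc (0 : ℝ) 1)
    (h1 : X.posterior G P (n + 1) a ω ∈ Set.Icc (0 : ℝ) 1) : 0 ≤ X.infoGain G P η n a ω := by
  have h := sq_sub_le_infoGain hη h0 h1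
  have hw : 0 < 2 * (X.posterior G P (n + 1) a ω + X.posterior G P n a ω + 2 * η) := by
    linarith [h0.1, h1.1]
  by_contra hneg
  nlinarith [sq_nonneg (X.posterior G P (n + 1) a ω - X.posterior G P n a ω)]

lemma integrable_posterior (n : ℕ) (a : Fin K) : Integrable (X.posterior G P n a) P :=
  integrable_condExp

variable [IsProbabilityMeasure P]

lemma IsGraphBandit.integrable_posterior_mul_log (hX : X.IsGraphBandit G P) {η : ℝ} (hη : 0 < η)
    (n k : ℕ) (a : Fin K) :
    Integrable (fun ω => (X.posterior G P n a ω + η) * Real.log (X.posterior G P k a ω + η)) P := by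
  refine Integrable.of_bound (((hX.measurable_posterior n a).add_const η).mul
    (Real.measurable_log.comp ((hX.measurable_posterior k a).add_const η))).aestronglyMeasurable
    ((1 + η) * (|Real.log η| + |Real.log (1 + η)|)) ?_
  filter_upwards [hX.posterior_mem_Icc n, hX.posterior_mem_Icc k] with ω h1 h2
  rw [Real.norm_eq_abs, abs_mul]
  refine mul_le_mul ?_ (abs_log_add_le hη (h2 a)) (abs_nonneg _) (by linarith)
  rw [abs_of_nonneg (by linarith [(h1 a).1])]
  linarith [(h1 a).2]

lemma IsGraphBandit.integrable_infoGain (hX : X.IsGraphBandit G P) {η : ℝ} (hη : 0 < η)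
    (n : ℕ) (a : Fin K) : Integrable (X.infoGain G P η n a) P :=
  (((hX.integrable_posterior_mul_log hη (n + 1) (n + 1) a).sub
    (hX.integrable_posterior_mul_log hη (n + 1) n a)).sub
    ((integrable_posterior (n + 1) a).add (integrable_const η))).add
    ((integrable_posterior n a).add (integrable_const η))

/-- The posterior is a martingale, so a bounded function of the history integrates to the same
value against two consecutive posteriors. -/
lemma IsGraphBandit.integral_mul_posterior_succ (hX : X.IsGraphBandit G P) (n : ℕ) (a : Fin K)
    {W : Ω → ℝ} (hW : StronglyMeasurable[X.historyUpTo G n] W) {c : ℝ}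
    (hc : ∀ᵐ ω ∂P, |W ω| ≤ c) :
    ∫ ω, W ω * X.posterior G P (n + 1) a ω ∂P = ∫ ω, W ω * X.posterior G P n a ω ∂P := by
  rw [hX.integral_mul_posterior n a hW hc,
    hX.integral_mul_posterior (n + 1) a (hW.mono (X.historyUpTo_mono G n.le_succ)) hc]

lemma IsGraphBandit.integral_infoGain (hX : X.IsGraphBandit G P) {η : ℝ} (hη : 0 < η)
    (n : ℕ) (a : Fin K) :
    ∫ ω, X.infoGain G P η n a ω ∂P
      = X.negEntropyTerm G P η (n + 1) a - X.negEntropyTerm G P η n a := by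
  have hint := fun j k => hX.integrable_posterior_mul_log hη j k a
  have hW : StronglyMeasurable[X.historyUpTo G n]
      fun ω => Real.log (X.posterior G P n a ω + η) + 1 :=
    ((Real.measurable_log.comp
      ((stronglyMeasurable_posterior n a).measurable.add_const η)).add_const 1).stronglyMeasurable
  have hb : ∀ᵐ ω ∂P, |Real.log (X.posterior G P n a ω + η) + 1|
      ≤ |Real.log η| + |Real.log (1 + η)| + 1 := by
    filter_upwards [hX.posterior_mem_Icc n] with ω hω
    refine (abs_add_le _ _).trans ?_
    rw [abs_one]
    linarith [abs_log_add_le hη (hω a)]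
  have hI : ∀ k, Integrable (fun ω => (Real.log (X.posterior G P n a ω + η) + 1)
      * X.posterior G P k a ω) P := fun k => by
    refine Integrable.bdd_mul (c := |Real.log η| + |Real.log (1 + η)| + 1)
      (integrable_posterior k a) (hW.mono (hX.historyUpTo_le n)).aestronglyMeasurable hb
  have h := hX.integral_mul_posterior_succ n a hW hb
  calc ∫ ω, X.infoGain G P η n a ω ∂P
      = ∫ ω, (((X.posterior G P (n + 1) a ω + η) * Real.log (X.posterior G P (n + 1) a ω + η)
          - (X.posterior G P n a ω + η) * Real.log (X.posterior G P n a ω + η))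
          - ((Real.log (X.posterior G P n a ω + η) + 1) * X.posterior G P (n + 1) a ω
          - (Real.log (X.posterior G P n a ω + η) + 1) * X.posterior G P n a ω)) ∂P :=
        integral_congr_ae (ae_of_all _ fun ω => by simp only [infoGain]; ring)
    _ = _ := by
        refine (integral_sub' ((hint (n + 1) (n + 1)).sub (hint n n))
          ((hI (n + 1)).sub (hI n))).trans ?_
        rw [integral_sub' (hint _ _) (hint _ _), integral_sub' (hI _) (hI _), h, sub_self, sub_zero]
        rfl

/-- The covariance of `A* = a` with the reward of `a` is expressed through the rounds in which `a`
is observed, with importance weight `1 / s`, where `s` is the probability of observing `a`. In such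
a round it is bounded by the change of the posterior, hence by the information gain. -/
lemma IsGraphBandit.integral_covariance_le (hX : X.IsGraphBandit G P) (hTS : X.IsTSU G P ε)
    (hε0 : 0 < ε) (hε : ε ≤ 1) (hK : K ≠ 0) (hG : ∀ t i, (G t).Adj i i) (t : Fin T) (a : Fin K)
    {l η : ℝ} (hl : 0 < l) (hη : 0 < η) :
    ∫ ω, ((X.aStar ⁻¹' {a}).indicator (fun _ => (1 : ℝ)) ω
          - X.posterior G P t a ω) * X.Y t ω a ∂P
      ≤ 2 * l * ∫ ω, X.posterior G P t a ω
            / (G t).inWeight (fun i => X.tsuProb G P ε t i ω) Finset.univ a ∂P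
        + 2 * l * η * (K / ε) + (∫ ω, X.infoGain G P η t a ω ∂P) / (2 * l) := by
  classical
  set θ : Ω → ℝ := (X.aStar ⁻¹' {a}).indicator (fun _ => (1 : ℝ)) with hθ
  set α : Ω → ℝ := X.posterior G P t a with hα
  set D : Ω → ℝ := X.posterior G P (t + 1) a with hD
  set Z : Ω → ℝ := X.seen G t a with hZ
  set s : Ω → ℝ := fun ω => (G t).inWeight (fun i => X.tsuProb G P ε t i ω) Finset.univ a with hs
  set r : Ω → ℝ := fun ω => (s ω)⁻¹ with hr
  set y : Ω → ℝ := fun ω => (X.Y t ω a : ℝ) with hy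
  have hKε : 0 < ε / K := div_pos hε0 (by positivity)
  have hle := hX.historyUpTo_le (G := G)
  have hαm : Measurable[X.historyUpTo G t] α := (stronglyMeasurable_posterior _ a).measurable
  have hDm : Measurable[X.historyUpTo G (t + 1)] D := (stronglyMeasurable_posterior _ a).measurable
  have hsm : Measurable[X.historyUpTo G t] s := by
    refine Finset.measurable_fun_sum _ fun i _ => ?_
    by_cases h : (G t).Adj i a
    · simpa only [h, if_true] using (stronglyMeasurable_tsuProb _ i).measurable
    · simp only [h, if_false, measurable_const]
  have hrm : Measurable[X.historyUpTo G t] r := hsm.inv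
  have henv := X.historyUpTo_le_environment G t
  have hθe : Measurable[X.environment t] θ :=
    measurable_const.indicator (X.measurable_aStar_environment t (measurableSet_singleton a))
  have hye : Measurable[X.environment t] y :=
    measurable_subtype_coe.comp ((measurable_pi_apply a).comp (X.measurable_Y_environment t t))
  have hEle := hX.environment_le t
  have hmono := X.historyUpTo_mono G (Nat.le_succ t)
  have hZm : Measurable[X.historyUpTo G (t + 1)] Z :=
    measurable_seen_historyUpTo t a (Nat.lt_succ_self _)
  have hyZm : Measurable[X.historyUpTo G (t + 1)] fun ω => y ω * Z ω :=
    measurable_reward_mul_seen_historyUpTo t a (Nat.lt_succ_self _)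
  have hαM := hαm.mono (hle _) le_rfl
  have hDM := hDm.mono (hle _) le_rfl
  have hsM := hsm.mono (hle _) le_rfl
  have hrM := hrm.mono (hle _) le_rfl
  have hθM := hθe.mono hEle le_rfl
  have hyM := hye.mono hEle le_rfl
  have hZM := hZm.mono (hle _) le_rfl
  have hθ01 : ∀ ω, θ ω ∈ Set.Icc (0 : ℝ) 1 := fun ω => by
    simp only [hθ, Set.indicator]; split_ifs <;> simp
  have hy01 : ∀ ω, y ω ∈ Set.Icc (0 : ℝ) 1 := fun ω => (X.Y t ω a).2
  have hZ01 : ∀ ω, Z ω ∈ Set.Icc (0 : ℝ) 1 := fun ω => ⟨seen_nonneg t a ω, seen_le_one t a ω⟩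
  have hα01 : ∀ᵐ ω ∂P, α ω ∈ Set.Icc (0 : ℝ) 1 := by
    filter_upwards [hX.posterior_mem_Icc t] with ω h using h a
  have hD01 : ∀ᵐ ω ∂P, D ω ∈ Set.Icc (0 : ℝ) 1 := by
    filter_upwards [hX.posterior_mem_Icc (t + 1)] with ω h using h a
  have hsge : ∀ᵐ ω ∂P, ε / K ≤ s ω := by
    filter_upwards [hX.le_tsuProb (G := G) hε t] with ω h
    exact (h a).trans ((G t).le_inWeight_self (hG t) (fun i => hKε.trans_le (h i))
      (Finset.mem_univ a))
  have hr1 : ∀ᵐ ω ∂P, 0 ≤ r ω ∧ r ω ≤ K / ε ∧ r ω * s ω = 1 := by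
    filter_upwards [hsge] with ω h
    have hs0 := hKε.trans_le h
    refine ⟨(inv_pos.2 hs0).le, ?_, inv_mul_cancel₀ hs0.ne'⟩
    rw [← inv_div]
    exact inv_anti₀ hKε h
  have hKε' : 0 ≤ (K : ℝ) / ε := by positivity
  have hint : ∀ {f : Ω → ℝ} (C : ℝ), Measurable f → (∀ᵐ ω ∂P, |f ω| ≤ C) → Integrable f P :=
    fun C hf hC => Integrable.of_bound hf.aestronglyMeasurable C hC
  have hprod : ∀ {u v A B : ℝ}, |u| ≤ A → |v| ≤ B → |u * v| ≤ A * B := fun hu hv => by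
    rw [abs_mul]
    exact mul_le_mul hu hv (abs_nonneg _) ((abs_nonneg _).trans hu)
  have habs : ∀ {u A : ℝ}, 0 ≤ u → u ≤ A → |u| ≤ A := fun h0 h1 => by rwa [abs_of_nonneg h0]
  have hsub : ∀ {u v : ℝ}, u ∈ Set.Icc (0 : ℝ) 1 → v ∈ Set.Icc (0 : ℝ) 1 → |u - v| ≤ 1 :=
    fun hu hv => abs_le.2 ⟨by linarith [hu.1, hv.2], by linarith [hu.2, hv.1]⟩
  -- `r` is the inverse of the conditional mean of `Z`, and the environment is independent of `Z`
  -- given the history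
  have hC1 : ∫ ω, (θ ω - α ω) * y ω ∂P = ∫ ω, (r ω * ((θ ω - α ω) * y ω)) * Z ω ∂P := by
    rw [hX.integral_mul_seen hTS hε0.le hε hK t a (c := K / ε * (1 * 1))]
    · refine integral_congr_ae ?_
      filter_upwards [hr1] with ω h
      calc (θ ω - α ω) * y ω = (r ω * s ω) * ((θ ω - α ω) * y ω) := by rw [h.2.2, one_mul]
        _ = _ := by ring
    · exact ((hrm.mono henv le_rfl).mul
        ((hθe.sub (hαm.mono henv le_rfl)).mul hye)).stronglyMeasurable
    · filter_upwards [hr1, hα01] with ω h h'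
      exact hprod (habs h.1 h.2.1) (hprod (hsub (hθ01 ω) h') (habs (hy01 ω).1 (hy01 ω).2))
  have hryZm : StronglyMeasurable[X.historyUpTo G (t + 1)] fun ω => r ω * (y ω * Z ω) :=
    ((hrm.mono hmono le_rfl).mul hyZm).stronglyMeasurable
  have hryZb : ∀ᵐ ω ∂P, |r ω * (y ω * Z ω)| ≤ K / ε * (1 * 1) := by
    filter_upwards [hr1] with ω h
    exact hprod (habs h.1 h.2.1) (hprod (habs (hy01 ω).1 (hy01 ω).2) (habs (hZ01 ω).1 (hZ01 ω).2))
  have hryZM : Measurable fun ω => r ω * (y ω * Z ω) := hrM.mul (hyM.mul hZM)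
  have hbθ : ∀ {f : Ω → ℝ}, Measurable f → (∀ᵐ ω ∂P, f ω ∈ Set.Icc (0 : ℝ) 1) →
      Integrable (fun ω => r ω * (y ω * Z ω) * f ω) P := fun {f} hf h01 => by
    refine hint (K / ε * (1 * 1) * 1) (hryZM.mul hf) ?_
    filter_upwards [hryZb, h01] with ω h1 h2
    exact hprod h1 (habs h2.1 h2.2)
  have hC2 : ∫ ω, (r ω * ((θ ω - α ω) * y ω)) * Z ω ∂P
      = ∫ ω, (r ω * (y ω * Z ω)) * (D ω - α ω) ∂P := by
    have h := hX.integral_mul_posterior (t + 1) a hryZm hryZb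
    calc _ = ∫ ω, (r ω * (y ω * Z ω) * θ ω - r ω * (y ω * Z ω) * α ω) ∂P :=
          integral_congr_ae (ae_of_all _ fun ω => by ring)
      _ = ∫ ω, (r ω * (y ω * Z ω) * D ω - r ω * (y ω * Z ω) * α ω) ∂P := by
          rw [integral_sub (hbθ hθM (ae_of_all _ hθ01)) (hbθ hαM hα01), ← h,
            ← integral_sub (hbθ hDM hD01) (hbθ hαM hα01)]
      _ = _ := integral_congr_ae (ae_of_all _ fun ω => by ring)
  -- One of the two factors `r` cancels against the conditional mean of `Z`; so the integral of
  -- `r ^ 2 * Z` against `θ` is that of `r`, and the same follows for the posteriors `D` and `α`.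
  have hrZ : ∀ {f : Ω → ℝ}, Measurable f → (∀ᵐ ω ∂P, f ω ∈ Set.Icc (0 : ℝ) 1) →
      Integrable (fun ω => r ω * (r ω * f ω) * Z ω) P := fun {f} hf h01 => by
    refine hint (K / ε * (K / ε * 1) * 1) ((hrM.mul (hrM.mul hf)).mul hZM) ?_
    filter_upwards [hr1, h01] with ω h1 h2
    exact hprod (hprod (habs h1.1 h1.2.1) (hprod (habs h1.1 h1.2.1) (habs h2.1 h2.2)))
      (habs (hZ01 ω).1 (hZ01 ω).2)
  have hM : ∀ {f : Ω → ℝ}, Measurable[X.environment t] f →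
      (∀ᵐ ω ∂P, f ω ∈ Set.Icc (0 : ℝ) 1) →
      ∫ ω, r ω * (r ω * f ω) * Z ω ∂P = ∫ ω, r ω * f ω ∂P := fun {f} hf h01 => by
    rw [hX.integral_mul_seen hTS hε0.le hε hK t a (c := K / ε * (K / ε * 1))]
    · refine integral_congr_ae ?_
      filter_upwards [hr1] with ω h
      calc _ = (r ω * s ω) * (r ω * f ω) := by ring
        _ = _ := by rw [h.2.2, one_mul]
    · exact ((hrm.mono henv le_rfl).mul ((hrm.mono henv le_rfl).mul hf)).stronglyMeasurable
    · filter_upwards [hr1, h01] with ω h1 h2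
      exact hprod (habs h1.1 h1.2.1) (hprod (habs h1.1 h1.2.1) (habs h2.1 h2.2))
  have hMα := hM (hαm.mono henv le_rfl) hα01
  have hMθ := hM hθe (ae_of_all _ hθ01)
  have hM1 := hM (f := fun _ => 1) measurable_const (ae_of_all _ fun _ => by simp)
  have hθα : ∫ ω, r ω * θ ω ∂P = ∫ ω, r ω * α ω ∂P := by
    refine (hX.integral_mul_posterior t a hrm.stronglyMeasurable (c := K / ε) ?_).symm
    filter_upwards [hr1] with ω h using habs h.1 h.2.1
  have hMD : ∫ ω, r ω * (r ω * D ω) * Z ω ∂P = ∫ ω, r ω * α ω ∂P := by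
    have hm : StronglyMeasurable[X.historyUpTo G (t + 1)] fun ω => r ω * r ω * Z ω :=
      (((hrm.mono hmono le_rfl).mul (hrm.mono hmono le_rfl)).mul hZm).stronglyMeasurable
    have hb : ∀ᵐ ω ∂P, |r ω * r ω * Z ω| ≤ K / ε * (K / ε) * 1 := by
      filter_upwards [hr1] with ω h
      exact hprod (hprod (habs h.1 h.2.1) (habs h.1 h.2.1)) (habs (hZ01 ω).1 (hZ01 ω).2)
    rw [← hθα, ← hMθ]
    calc _ = ∫ ω, r ω * r ω * Z ω * D ω ∂P :=
          integral_congr_ae (ae_of_all _ fun ω => by ring)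
      _ = ∫ ω, r ω * r ω * Z ω * θ ω ∂P := hX.integral_mul_posterior (t + 1) a hm hb
      _ = _ := integral_congr_ae (ae_of_all _ fun ω => by ring)
  have hr_le : ∫ ω, r ω * 1 ∂P ≤ K / ε := by
    calc ∫ ω, r ω * 1 ∂P ≤ ∫ _, (K / ε : ℝ) ∂P := by
          refine integral_mono_of_nonneg ?_ (integrable_const _) ?_
          · filter_upwards [hr1] with ω h using by simpa using h.1
          · filter_upwards [hr1] with ω h using by simpa using h.2.1
      _ = _ := by simp
  -- the arithmetic-geometric mean inequality with parameter `l`, where `(D - α) ^ 2` is bounded by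
  -- the information gain
  have hpt : ∀ᵐ ω ∂P, (r ω * (y ω * Z ω)) * (D ω - α ω)
      ≤ l * (r ω * (r ω * D ω) * Z ω) + l * (r ω * (r ω * α ω) * Z ω)
        + 2 * l * η * (r ω * (r ω * 1) * Z ω) + X.infoGain G P η t a ω / (2 * l) := by
    filter_upwards [hr1, hα01, hD01] with ω h1 h2 h3
    set φ := X.infoGain G P η t a ω with hφ
    have hP : (D ω - α ω) ^ 2 ≤ 2 * (D ω + α ω + 2 * η) * φ := sq_sub_le_infoGain hη h2 h3
    have hw : 0 < 2 * (D ω + α ω + 2 * η) := by linarith [h3.1, h2.1]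
    have hφ0 : 0 ≤ φ := infoGain_nonneg hη h2 h3
    have hA : 0 ≤ l * (r ω ^ 2 * (D ω + α ω + 2 * η)) * Z ω :=
      mul_nonneg (mul_nonneg hl.le (mul_nonneg (sq_nonneg _) (by linarith))) (hZ01 ω).1
    have hB : 0 ≤ φ / (2 * l) := by positivity
    have hsq : (r ω * (y ω * Z ω) * (D ω - α ω)) ^ 2
        ≤ 4 * (l * (r ω ^ 2 * (D ω + α ω + 2 * η)) * Z ω) * (φ / (2 * l)) := by
      have hy2 : y ω ^ 2 ≤ 1 := by nlinarith [(hy01 ω).1, (hy01 ω).2]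
      have hZ2 : Z ω * Z ω = Z ω := seen_mul_self t a ω
      calc (r ω * (y ω * Z ω) * (D ω - α ω)) ^ 2
          = y ω ^ 2 * (r ω ^ 2 * (Z ω * Z ω) * (D ω - α ω) ^ 2) := by ring
        _ ≤ 1 * (r ω ^ 2 * (Z ω * Z ω) * (D ω - α ω) ^ 2) := by
            refine mul_le_mul_of_nonneg_right hy2 ?_
            have := mul_self_nonneg (Z ω)
            positivity
        _ ≤ 1 * (r ω ^ 2 * (Z ω * Z ω) * (2 * (D ω + α ω + 2 * η) * φ)) := by
            have := mul_self_nonneg (Z ω)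
            gcongr
        _ = _ := by
            rw [hZ2]
            field_simp
            ring
    have hsum : r ω * (y ω * Z ω) * (D ω - α ω)
        ≤ l * (r ω ^ 2 * (D ω + α ω + 2 * η)) * Z ω + φ / (2 * l) := by
      refine le_of_abs_le (abs_le_of_sq_le_sq ?_ (add_nonneg hA hB))
      nlinarith [sq_nonneg (l * (r ω ^ 2 * (D ω + α ω + 2 * η)) * Z ω - φ / (2 * l))]
    calc _ ≤ _ := hsum
      _ = _ := by ring
  have hI1 := (hrZ hDM hD01).const_mul l
  have hI2 := (hrZ hαM hα01).const_mul l
  have hI3 := (hrZ (f := fun _ => 1) measurable_const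
    (ae_of_all _ fun _ => by simp)).const_mul (2 * l * η)
  have hI4 := (hX.integrable_infoGain (G := G) hη t a).div_const (2 * l)
  have hfin := integral_mono_ae
    (by
      refine hint (K / ε * (1 * 1) * 1) (hryZM.mul (hDM.sub hαM)) ?_
      filter_upwards [hryZb, hD01, hα01] with ω h1 h2 h3
      exact hprod h1 (hsub h2 h3))
    (((hI1.add hI2).add hI3).add hI4) hpt
  rw [hC1, hC2]
  refine hfin.trans ?_
  rw [integral_add' ((hI1.add hI2).add hI3) hI4, integral_add' (hI1.add hI2) hI3,
    integral_add' hI1 hI2, integral_const_mul, integral_const_mul, integral_const_mul,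
    integral_div, hMD, hMα, hM1]
  have hdiv : ∫ ω, α ω / s ω ∂P = ∫ ω, r ω * α ω ∂P :=
    integral_congr_ae (ae_of_all _ fun ω => by simp only [hr]; ring)
  rw [hdiv]
  have := mul_le_mul_of_nonneg_left hr_le (mul_pos (mul_pos two_pos hl) hη).le
  linarith

end BanditProcess

/-! ### The regret bound for TS-U -/

namespace BanditProcess

variable {K T : ℕ} {Ω : Type u} [mΩ : MeasurableSpace Ω] {P : Measure Ω}
  {X : BanditProcess K T Ω} {G : Fin T → Digraph (Fin K)} {ε : ℝ}

/-- If `H(α₁) log (K T)` is bounded below, the cost `√T` of uniform exploration is dominated by the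
rate, as every independence number is at least one. -/
lemma sqrt_le_mul_rate (hG : ∀ t, 1 ≤ (G t).independenceNumber) {h : ℝ}
    (hh : 0 < h) (hH : h ≤ X.priorEntropy P * Real.log (K * T)) :
    √T ≤ (1 / √h) * X.rate G P := by
  rw [rate, div_mul_eq_mul_div, one_mul, le_div_iff₀ (Real.sqrt_pos.2 hh),
    ← Real.sqrt_mul (Nat.cast_nonneg T)]
  refine Real.sqrt_le_sqrt ?_
  have hsum : (T : ℝ) ≤ ∑ t, ((G t).independenceNumber : ℝ) := by
    calc (T : ℝ) = ∑ _ : Fin T, (1 : ℝ) := by simp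
      _ ≤ _ := Finset.sum_le_sum fun t _ => by exact_mod_cast hG t
  calc (T : ℝ) * h
      ≤ (∑ t, ((G t).independenceNumber : ℝ)) * (X.priorEntropy P * Real.log (K * T)) :=
        mul_le_mul hsum hH hh.le ((Nat.cast_nonneg T).trans hsum)
    _ = _ := by ring

variable [IsProbabilityMeasure P]

/-- The inverse observation probabilities, averaged over the posterior, are bounded by the
independence number of the graph: as `(1 - ε) α ≤ π`, this is `Digraph.sum_div_inWeight_le` for the
distribution `π` of the action, whose entries are at least `ε / K`. -/
lemma IsGraphBandit.sum_integral_posterior_div_le (hX : X.IsGraphBandit G P)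
    (hε0 : 0 < ε) (hε : ε ≤ 1) (hK : K ≠ 0) (hG : ∀ t i, (G t).Adj i i) (t : Fin T) :
    (1 - ε) * ∑ a, ∫ ω, X.posterior G P t a ω
        / (G t).inWeight (fun i => X.tsuProb G P ε t i ω) Finset.univ a ∂P
      ≤ 1 + 2 * (G t).independenceNumber * Real.log (K / ε) := by
  have hK0 : (0 : ℝ) < K := by exact_mod_cast Nat.pos_of_ne_zero hK
  have : Nonempty (Fin K) := Fin.pos_iff_nonempty.1 (Nat.pos_of_ne_zero hK)
  have hKε : 0 < ε / K := by positivity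
  have hint : ∀ a, Integrable (fun ω => X.tsuProb G P ε t a ω
      / (G t).inWeight (fun i => X.tsuProb G P ε t i ω) Finset.univ a) P := fun a => by
    have hπ := fun i => ((stronglyMeasurable_tsuProb (X := X) (G := G) (P := P) (ε := ε)
      t i).mono (hX.historyUpTo_le t)).measurable
    refine Integrable.of_bound (C := 1)
      ((hπ a).div (Finset.measurable_fun_sum _ fun i _ => ?_)).aestronglyMeasurable ?_
    · split_ifs
      exacts [hπ i, measurable_const]
    · filter_upwards [hX.le_tsuProb (G := G) hε t] with ω h2
      have h3 := fun i => hKε.trans_le (h2 i)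
      have h4 := (G t).le_inWeight_self (hG t) h3 (Finset.mem_univ a)
      rw [Real.norm_eq_abs, abs_of_nonneg (div_nonneg (h3 a).le ((h3 a).le.trans h4))]
      exact div_le_one_of_le₀ h4 ((h3 a).le.trans h4)
  rw [Finset.mul_sum]
  have hterm : ∀ a, (1 - ε) * ∫ ω, X.posterior G P t a ω
        / (G t).inWeight (fun i => X.tsuProb G P ε t i ω) Finset.univ a ∂P
      ≤ ∫ ω, X.tsuProb G P ε t a ω
        / (G t).inWeight (fun i => X.tsuProb G P ε t i ω) Finset.univ a ∂P := fun a => by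
    rw [← integral_const_mul]
    refine integral_mono_of_nonneg ?_ ?_ ?_
    · filter_upwards [hX.posterior_mem_Icc t, hX.le_tsuProb (G := G) hε t] with ω h1 h2
      refine mul_nonneg (sub_nonneg.2 hε) (div_nonneg (h1 a).1 ?_)
      exact ((hKε.trans_le (h2 a)).trans_le ((G t).le_inWeight_self (hG t)
        (fun i => hKε.trans_le (h2 i)) (Finset.mem_univ a))).le
    · exact hint a
    · filter_upwards [hX.le_tsuProb (G := G) hε t] with ω h2
      have h3 := fun i => hKε.trans_le (h2 i)
      have h4 := (h3 a).trans_le ((G t).le_inWeight_self (hG t) h3 (Finset.mem_univ a))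
      rw [← mul_div_assoc]
      refine div_le_div_of_nonneg_right ?_ h4.le
      unfold tsuProb
      linarith
  refine (Finset.sum_le_sum fun a _ => hterm a).trans ?_
  rw [← integral_finsetSum]
  · calc _ ≤ ∫ _, (1 + 2 * (G t).independenceNumber * Real.log (K / ε)) ∂P := by
          refine integral_mono_of_nonneg ?_ (integrable_const _) ?_
          · filter_upwards [hX.le_tsuProb (G := G) hε t] with ω h2
            refine Finset.sum_nonneg fun a _ => ?_
            have h3 := fun i => hKε.trans_le (h2 i)
            have h4 := (h3 a).trans_le ((G t).le_inWeight_self (hG t) h3 (Finset.mem_univ a))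
            exact div_nonneg (h3 a).le h4.le
          · filter_upwards [hX.le_tsuProb (G := G) hε t, hX.sum_tsuProb (G := G) (ε := ε) hK t]
              with ω h2 h5
            have := (G t).sum_div_inWeight_le (hG t) hKε h2 Finset.univ Finset.univ_nonempty
            rwa [h5, one_div_div] at this
      _ = _ := by simp
  · exact fun a _ => hint a

/-- The regret of a round is traded, with parameter `l`, for the information gained in it. -/
lemma IsGraphBandit.integral_regret_le_infoGain (hX : X.IsGraphBandit G P) (hTS : X.IsTSU G P ε)
    (hε0 : 0 < ε) (hε : ε ≤ 1) (hK : K ≠ 0) (hG : ∀ t i, (G t).Adj i i) (t : Fin T)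
    {l η : ℝ} (hl : 0 < l) (hη : 0 < η) :
    ∫ ω, ((X.Y t ω (X.aStar ω) : ℝ) - (X.Y t ω (X.A t ω) : ℝ)) ∂P
      ≤ ε + 2 * l * (1 + 2 * (G t).independenceNumber * Real.log (K / ε))
        + 2 * l * η * (K / ε) * K
        + (∑ a, X.negEntropyTerm G P η (t + 1) a - ∑ a, X.negEntropyTerm G P η t a)
          / (2 * l) := by
  have h1 := hX.integral_regret_le hTS hε0.le hε hK t
  have h2 := Finset.sum_le_sum (s := Finset.univ) fun a _ =>
    hX.integral_covariance_le hTS hε0 hε hK hG t a hl hη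
  have h3 := hX.sum_integral_posterior_div_le hε0 hε hK hG t
  have h4 : 0 ≤ ∑ a, ∫ ω, X.infoGain G P η t a ω ∂P := by
    refine Finset.sum_nonneg fun a _ => integral_nonneg_of_ae ?_
    filter_upwards [hX.posterior_mem_Icc t, hX.posterior_mem_Icc (t + 1)] with ω h h'
    exact infoGain_nonneg hη (h a) (h' a)
  rw [Finset.sum_add_distrib, Finset.sum_add_distrib, ← Finset.mul_sum, ← Finset.sum_div,
    Finset.sum_const, Finset.card_univ, Fintype.card_fin, nsmul_eq_mul] at h2
  have h5 : ∑ a, X.negEntropyTerm G P η (t + 1) a - ∑ a, X.negEntropyTerm G P η t a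
      = ∑ a, ∫ ω, X.infoGain G P η t a ω ∂P := by
    rw [← Finset.sum_sub_distrib]
    exact Finset.sum_congr rfl fun a _ => (hX.integral_infoGain hη t a).symm
  rw [h5]
  have h6 := mul_le_mul_of_nonneg_left h2 (sub_nonneg.2 hε)
  have h7 := mul_le_mul_of_nonneg_left h3 (mul_pos two_pos hl).le
  have h8 : 0 ≤ (∑ a, ∫ ω, X.infoGain G P η t a ω ∂P) / (2 * l) := by positivity
  have h9 : 0 ≤ (K : ℝ) * (2 * l * η * (K / ε)) := by positivity
  nlinarith [mul_nonneg hε0.le h8, mul_nonneg hε0.le h9]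

lemma IsGraphBandit.integrable_reward_comp (hX : X.IsGraphBandit G P) (t : Fin T)
    {f : Ω → Fin K} (hf : Measurable f) : Integrable (fun ω => (X.Y t ω (f ω) : ℝ)) P := by
  refine Integrable.of_bound (C := 1) ?_ (ae_of_all _ fun ω => ?_)
  · have : Measurable fun p : Rewards K × Fin K => p.1 p.2 :=
      measurable_from_prod_countable_left fun i => measurable_pi_apply i
    exact (measurable_subtype_coe.comp
      (this.comp ((hX.measurable_Y t).prodMk hf))).aestronglyMeasurable
  · rw [Real.norm_eq_abs, abs_of_nonneg (X.Y t ω _).2.1]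
    exact (X.Y t ω _).2.2

lemma IsGraphBandit.regret_eq_sum (hX : X.IsGraphBandit G P) :
    X.regret P = ∑ t, ∫ ω, ((X.Y t ω (X.aStar ω) : ℝ) - (X.Y t ω (X.A t ω) : ℝ)) ∂P :=
  integral_finsetSum _ fun t _ => (hX.integrable_reward_comp t hX.measurable_aStar).sub
    (hX.integrable_reward_comp t (hX.measurable_A t))

lemma negEntropyTerm_zero (η : ℝ) (a : Fin K) (hm : MeasurableSet (X.aStar ⁻¹' {a})) :
    X.negEntropyTerm G P η 0 a = (P.real (X.aStar ⁻¹' {a}) + η)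
      * Real.log (P.real (X.aStar ⁻¹' {a}) + η) := by
  have : X.posterior G P 0 a = fun _ => P.real (X.aStar ⁻¹' {a}) := by
    rw [posterior, historyUpTo_zero, condExp_bot, integral_indicator hm]
    simp
  simp [negEntropyTerm, this]

lemma IsGraphBandit.negEntropyTerm_le (hX : X.IsGraphBandit G P) {η : ℝ} (hη : 0 < η) (n : ℕ)
    (a : Fin K) : X.negEntropyTerm G P η n a ≤ (1 + η) * η := by
  calc X.negEntropyTerm G P η n a ≤ ∫ _, (1 + η) * η ∂P := by
        refine integral_mono_ae (hX.integrable_posterior_mul_log hη n n a) (integrable_const _) ?_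
        filter_upwards [hX.posterior_mem_Icc n] with ω hω
        have h0 : 0 < X.posterior G P n a ω + η := by linarith [(hω a).1]
        have := mul_le_mul_of_nonneg_left (Real.log_le_sub_one_of_pos h0) h0.le
        have h1 := (hω a).2
        have h2 := (hω a).1
        refine this.trans ?_
        nlinarith
    _ = _ := by simp

lemma priorEntropy_nonneg : 0 ≤ X.priorEntropy P := by
  rw [priorEntropy, ← Finset.sum_neg_distrib]
  refine Finset.sum_nonneg fun a _ => ?_
  have := Real.negMulLog_nonneg (x := P.real (X.aStar ⁻¹' {a})) measureReal_nonneg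
    measureReal_le_one
  rwa [Real.negMulLog, neg_mul] at this

/-- The information gains of the rounds telescope to at most the prior entropy, and the shift `η` of
the posterior tends to `0`. -/
lemma IsGraphBandit.regret_le_of_pos (hX : X.IsGraphBandit G P) (hTS : X.IsTSU G P ε)
    (hε0 : 0 < ε) (hε : ε ≤ 1) (hK : K ≠ 0) (hG : ∀ t i, (G t).Adj i i) {l : ℝ} (hl : 0 < l) :
    X.regret P ≤ T * ε
      + 2 * l * (∑ t, (1 + 2 * ((G t).independenceNumber : ℝ) * Real.log (K / ε)))
      + X.priorEntropy P / (2 * l) := by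
  set B := ∑ t, (1 + 2 * ((G t).independenceNumber : ℝ) * Real.log (K / ε))
  set p : Fin K → ℝ := fun a => P.real (X.aStar ⁻¹' {a}) with hp
  set F : ℝ → ℝ := fun η => T * ε + 2 * l * B + T * (2 * l * η * (K / ε) * K)
    + (K * ((1 + η) * η) - ∑ a, (p a + η) * Real.log (p a + η)) / (2 * l) with hF
  have hbound : ∀ η > 0, X.regret P ≤ F η := fun η hη => by
    rw [hX.regret_eq_sum]
    refine (Finset.sum_le_sum fun t _ =>
      hX.integral_regret_le_infoGain hTS hε0 hε hK hG t hl hη).trans ?_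
    rw [Finset.sum_add_distrib, Finset.sum_add_distrib, Finset.sum_add_distrib,
      ← Finset.mul_sum, ← Finset.sum_div,
      Fin.sum_univ_eq_sum_range (fun t => ∑ a, X.negEntropyTerm G P η (t + 1) a
        - ∑ a, X.negEntropyTerm G P η t a),
      Finset.sum_range_sub (fun t => ∑ a, X.negEntropyTerm G P η t a)]
    simp only [Finset.sum_const, Finset.card_univ, Fintype.card_fin, nsmul_eq_mul, hF]
    gcongr
    · calc _ ≤ ∑ _ : Fin K, (1 + η) * η :=
            Finset.sum_le_sum fun a _ => hX.negEntropyTerm_le hη T a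
        _ = _ := by simp
    · exact (negEntropyTerm_zero η _ (hX.measurable_aStar (measurableSet_singleton _))).ge
  -- `F` is continuous at `0` since `x log x` is
  have hcont : Continuous F := by
    have h : ∀ a, Continuous fun η : ℝ => (p a + η) * Real.log (p a + η) := fun a =>
      Real.continuous_mul_log.comp (continuous_const.add continuous_id)
    have h' : Continuous fun η : ℝ => ∑ a, (p a + η) * Real.log (p a + η) :=
      continuous_finsetSum _ fun a _ => h a
    fun_prop
  have hlim := ge_of_tendsto ((hcont.tendsto 0).mono_left nhdsWithin_le_nhds)
    (Filter.mem_of_superset (self_mem_nhdsWithin (s := Set.Ioi (0 : ℝ))) hbound)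
  refine hlim.trans (le_of_eq ?_)
  simp only [hF, hp, priorEntropy, add_zero, mul_zero, zero_mul, zero_sub]

/-- The choice `l = √H / (2 √B)`; when `H = 0`, the limit `l → 0` is needed instead. -/
lemma _root_.Real.le_two_mul_sqrt_of_forall_le {x B H : ℝ} (hB : 0 < B) (hH : 0 ≤ H)
    (h : ∀ l > 0, x ≤ 2 * l * B + H / (2 * l)) : x ≤ 2 * √(B * H) := by
  rcases hH.eq_or_lt with rfl | hH
  · simp only [mul_zero, Real.sqrt_zero, zero_div, add_zero] at h ⊢
    refine le_of_forall_pos_le_add fun e he => ?_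
    have := h (e / (2 * B)) (by positivity)
    calc x ≤ _ := this
      _ = 0 + e := by field_simp; ring
  · have hB' := Real.sqrt_pos.2 hB
    have hH' := Real.sqrt_pos.2 hH
    refine (h (√H / (2 * √B)) (by positivity)).trans (le_of_eq ?_)
    rw [Real.sqrt_mul hB.le]
    nth_rewrite 2 [← Real.sq_sqrt hB.le]
    nth_rewrite 2 [← Real.sq_sqrt hH.le]
    field_simp
    ring

/-- Uniform exploration with `ε = 1 / √T` costs `ε T = √T`, and makes every arm be observed with
probability at least `ε / K`, so that the logarithm in the graph theoretic bound is at most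
`log (K T)`. -/
lemma IsGraphBandit.regret_le_add_rate (hX : X.IsGraphBandit G P)
    (hTS : X.IsTSU G P (1 / √T)) (hT : 1 ≤ T) (hG : ∀ t i, (G t).Adj i i) :
    X.regret P ≤ √T + 4 * X.rate G P := by
  have hrate : 0 ≤ X.rate G P := Real.sqrt_nonneg _
  obtain ⟨ω₀⟩ : Nonempty Ω := nonempty_of_isProbabilityMeasure P
  have hK : 0 < K := (X.aStar ω₀).pos
  rcases eq_or_lt_of_le (Nat.succ_le_of_lt hK) with hK1 | hK2
  · -- with a single action there is no regret
    have : Subsingleton (Fin K) := by rw [← hK1]; infer_instance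
    have h0 : X.regret P = 0 := by
      rw [regret, ← integral_zero Ω ℝ]
      refine integral_congr_ae (ae_of_all _ fun ω => Finset.sum_eq_zero fun t _ => ?_)
      rw [Subsingleton.elim (X.aStar ω) (X.A t ω), sub_self]
    rw [h0]
    positivity
  · have hT' : (1 : ℝ) ≤ T := by exact_mod_cast hT
    have hK' : (2 : ℝ) ≤ K := by exact_mod_cast hK2
    have hsT : 1 ≤ √(T : ℝ) := Real.one_le_sqrt.2 hT'
    have : Nonempty (Fin K) := ⟨X.aStar ω₀⟩
    have hβ : ∀ t, (1 : ℝ) ≤ (G t).independenceNumber := fun t => by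
      exact_mod_cast (G t).one_le_independenceNumber
    have hmain : ∀ l > 0, X.regret P - √T ≤ 2 * l *
        (∑ t, (1 + 2 * ((G t).independenceNumber : ℝ) * Real.log (K / (1 / √T))))
        + X.priorEntropy P / (2 * l) := fun l hl => by
      have := hX.regret_le_of_pos hTS (by positivity) (by rw [div_le_one] <;> linarith)
        hK.ne' hG hl
      have hTs : (T : ℝ) * (1 / √T) = √T := by
        rw [mul_one_div, Real.div_sqrt]
      rw [hTs] at this
      linarith
    have hlogs : Real.log (K / (1 / √T)) ≤ Real.log (K * T) := by
      refine Real.log_le_log (by positivity) ?_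
      rw [div_div_eq_mul_div, div_one]
      refine mul_le_mul_of_nonneg_left ?_ (by positivity)
      nlinarith [Real.sq_sqrt (zero_le_one.trans hT')]
    -- this absorbs the summand `1` of the graph theoretic bound into the logarithmic one
    have hlog2 : 1 / 2 ≤ Real.log (K * T) := by
      have : Real.log 2 ≤ Real.log (K * T) := Real.log_le_log two_pos (by nlinarith)
      linarith [Real.log_two_gt_d9]
    have hlog0 : 0 ≤ Real.log (K / (1 / √T)) := by
      refine Real.log_nonneg ?_
      rw [div_div_eq_mul_div, div_one]
      nlinarith
    have hBpos : 0 < ∑ t, (1 + 2 * ((G t).independenceNumber : ℝ)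
        * Real.log (K / (1 / √T))) := by
      have : Nonempty (Fin T) := Fin.pos_iff_nonempty.1 hT
      refine Finset.sum_pos (fun t _ => ?_) Finset.univ_nonempty
      have := hβ t
      positivity
    have h1 := Real.le_two_mul_sqrt_of_forall_le hBpos priorEntropy_nonneg hmain
    have h2 : ∑ t, (1 + 2 * ((G t).independenceNumber : ℝ) * Real.log (K / (1 / √T)))
        ≤ 4 * (Real.log (K * T) * ∑ t, ((G t).independenceNumber : ℝ)) := by
      rw [Finset.mul_sum, Finset.mul_sum]
      refine Finset.sum_le_sum fun t _ => ?_
      have := hβ t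
      nlinarith [mul_le_mul_of_nonneg_left hlogs (zero_le_one.trans this)]
    have h3 : √((∑ t, (1 + 2 * ((G t).independenceNumber : ℝ) * Real.log (K / (1 / √T))))
        * X.priorEntropy P) ≤ 2 * X.rate G P := by
      rw [rate, ← Real.sqrt_sq (zero_le_two (α := ℝ)), ← Real.sqrt_mul (by norm_num)]
      refine Real.sqrt_le_sqrt ?_
      have := mul_le_mul_of_nonneg_right h2 (priorEntropy_nonneg (X := X) (P := P))
      linarith
    linarith

end BanditProcess

/-! ### Two-point priors -/

lemma MeasureTheory.Measure.ext_of_finite_support {α : Type*} [MeasurableSpace α]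
    [MeasurableSingletonClass α] {μ ν : Measure α} {F : Set α} (hF : F.Finite)
    (hμ : μ Fᶜ = 0) (hν : ν Fᶜ = 0) (h : ∀ x ∈ F, μ {x} = ν {x}) : μ = ν := by
  classical
  ext s _
  have key : ∀ m : Measure α, m Fᶜ = 0 → m s = ∑ x ∈ hF.toFinset with x ∈ s, m {x} := by
    intro m hm
    rw [← measure_inter_conull hm, sum_measure_singleton]
    congr 1
    ext x
    simp [and_comm]
  rw [key μ hμ, key ν hν]
  refine Finset.sum_congr rfl fun x hx => h x ?_
  simpa using (Finset.mem_filter.1 hx).1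

/-- A measure of finite support is determined by finitely many of its values; this makes its
singleton measurable even if the sigma-algebra of the space is not countably generated. -/
lemma MeasureTheory.Measure.measurableSet_singleton_of_finite_support {α : Type*}
    [MeasurableSpace α] [MeasurableSingletonClass α] {ν : Measure α} {F : Set α} (hF : F.Finite)
    (hν : ν Fᶜ = 0) : MeasurableSet ({ν} : Set (Measure α)) := by
  have : ({ν} : Set (Measure α)) = {p | p Fᶜ = 0} ∩ ⋂ x ∈ F, {p | p {x} = ν {x}} := by
    ext p
    simp only [Set.mem_singleton_iff, Set.mem_inter_iff, Set.mem_ofPred_eq, Set.mem_iInter]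
    refine ⟨?_, fun h => Measure.ext_of_finite_support hF h.1 hν h.2⟩
    rintro rfl
    exact ⟨hν, fun _ _ => rfl⟩
  rw [this]
  refine MeasurableSet.inter ?_ (hF.measurableSet_biInter fun x _ => ?_)
  · exact Measure.measurable_coe hF.measurableSet.compl (measurableSet_singleton 0)
  · exact Measure.measurable_coe (measurableSet_singleton x) (measurableSet_singleton _)

/-- The distribution of a coin that shows `v` with probability `x` and `u` otherwise. -/
noncomputable def coin {α : Type*} [MeasurableSpace α] (u v : α) (x : ℝ) : Measure α :=
  ENNReal.ofReal (1 - x) • Measure.dirac u + ENNReal.ofReal x • Measure.dirac v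

section coin

variable {α : Type*} [MeasurableSpace α] {u v : α} {x : ℝ}

lemma isProbabilityMeasure_coin (hx : x ∈ Set.Icc (0 : ℝ) 1) :
    IsProbabilityMeasure (coin u v x) := by
  constructor
  simp only [coin, Measure.add_apply, Measure.smul_apply, measure_univ, smul_eq_mul, mul_one]
  rw [← ENNReal.ofReal_add (by linarith [hx.2]) hx.1]
  simp

variable [MeasurableSingletonClass α]

lemma coin_real_singleton_right (huv : u ≠ v) (hx : x ∈ Set.Icc (0 : ℝ) 1) :
    (coin u v x).real {v} = x := by
  simp [coin, measureReal_def, huv, ENNReal.toReal_ofReal hx.1]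

lemma coin_real_singleton_left (huv : u ≠ v) (hx : x ∈ Set.Icc (0 : ℝ) 1) :
    (coin u v x).real {u} = 1 - x := by
  simp [coin, measureReal_def, huv.symm, ENNReal.toReal_ofReal (sub_nonneg.2 hx.2)]

lemma coin_compl_pair : coin u v x {u, v}ᶜ = 0 := by
  simp [coin]

end coin

/-- The law of independent Bernoulli rewards, where the arm `a` has mean `x a (θ a)`. -/
noncomputable def envLaw {K : ℕ} (x : Fin K → Bool → ℝ) (θ : Fin K → Bool) :
    Measure (Rewards K) :=
  Measure.pi fun a => coin 0 1 (x a (θ a))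

/-- The prior under which the coordinates of `θ` are independent and equal to `true` with
probability `q`, and the reward distribution is `envLaw x θ`. -/
noncomputable def twoPointPrior {K : ℕ} (x : Fin K → Bool → ℝ) (q : ℝ) :
    Measure (Measure (Rewards K)) :=
  (Measure.pi fun _ : Fin K => coin false true q).map (envLaw x)

section twoPointPrior

variable {K : ℕ} {x : Fin K → Bool → ℝ} {q : ℝ}

lemma isProbabilityMeasure_envLaw (hx : ∀ a b, x a b ∈ Set.Icc (0 : ℝ) 1) (θ : Fin K → Bool) :
    IsProbabilityMeasure (envLaw x θ) := by
  have := fun a => isProbabilityMeasure_coin (u := (0 : I)) (v := 1) (hx a (θ a))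
  unfold envLaw
  infer_instance

lemma envLaw_map_eval (hx : ∀ a b, x a b ∈ Set.Icc (0 : ℝ) 1) (θ : Fin K → Bool) (a : Fin K) :
    (envLaw x θ).map (fun y => y a) = coin 0 1 (x a (θ a)) := by
  have := fun a => isProbabilityMeasure_coin (u := (0 : I)) (v := 1) (hx a (θ a))
  exact (measurePreserving_eval (fun a => coin (0 : I) 1 (x a (θ a))) a).map_eq

lemma envLaw_real_eval (hx : ∀ a b, x a b ∈ Set.Icc (0 : ℝ) 1) (θ : Fin K → Bool) (a : Fin K) :
    (envLaw x θ).real {y | y a = 1} = x a (θ a) := by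
  rw [← coin_real_singleton_right (zero_ne_one (α := I)) (hx a (θ a)), ← envLaw_map_eval hx θ a,
    map_measureReal_apply (measurable_pi_apply a) (measurableSet_singleton 1)]
  rfl

lemma envLaw_injective (hx : ∀ a b, x a b ∈ Set.Icc (0 : ℝ) 1)
    (hx' : ∀ a, Function.Injective (x a)) : Function.Injective (envLaw x) := fun θ θ' h => by
  ext1 a
  exact hx' a (by rw [← envLaw_real_eval hx θ a, h, envLaw_real_eval hx θ' a])

/-- The reward vectors all of whose entries are `0` or `1`. -/
def binaryRewards (K : ℕ) : Set (Rewards K) := {y | ∀ a, y a ∈ ({0, 1} : Set I)}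

lemma finite_binaryRewards (K : ℕ) : (binaryRewards K).Finite :=
  Set.Finite.pi' fun _ => Set.toFinite _

lemma envLaw_compl_binaryRewards (hx : ∀ a b, x a b ∈ Set.Icc (0 : ℝ) 1) (θ : Fin K → Bool) :
    envLaw x θ (binaryRewards K)ᶜ = 0 := by
  have : (binaryRewards K)ᶜ = ⋃ a, (fun y : Rewards K => y a) ⁻¹' {0, 1}ᶜ := by
    ext y
    simp [binaryRewards]
  rw [this, measure_iUnion_null_iff]
  intro a
  rw [← Measure.map_apply (measurable_pi_apply a) (Set.toFinite _).measurableSet.compl,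
    envLaw_map_eval hx]
  exact coin_compl_pair

lemma measurableSet_singleton_envLaw (hx : ∀ a b, x a b ∈ Set.Icc (0 : ℝ) 1)
    (θ : Fin K → Bool) : MeasurableSet ({envLaw x θ} : Set (Measure (Rewards K))) :=
  Measure.measurableSet_singleton_of_finite_support (finite_binaryRewards K)
    (envLaw_compl_binaryRewards hx θ)

lemma measurableSet_range_envLaw (hx : ∀ a b, x a b ∈ Set.Icc (0 : ℝ) 1) :
    MeasurableSet (Set.range (envLaw x)) := by
  rw [← Set.iUnion_singleton_eq_range]
  exact MeasurableSet.iUnion fun θ => measurableSet_singleton_envLaw hx θ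

lemma measurable_envLaw : Measurable (envLaw x) := Measurable.of_discrete

lemma isProbabilityMeasure_twoPointPrior (hq : q ∈ Set.Icc (0 : ℝ) 1) :
    IsProbabilityMeasure (twoPointPrior x q) := by
  have := isProbabilityMeasure_coin (u := false) (v := true) hq
  exact Measure.isProbabilityMeasure_map measurable_envLaw.aemeasurable

lemma twoPointPrior_mem_range (hx : ∀ a b, x a b ∈ Set.Icc (0 : ℝ) 1) :
    ∀ᵐ p ∂(twoPointPrior x q), p ∈ Set.range (envLaw x) :=
  (ae_map_iff measurable_envLaw.aemeasurable (measurableSet_range_envLaw hx)).2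
    (ae_of_all _ fun θ => ⟨θ, rfl⟩)

lemma isIndependentArmsPrior_twoPointPrior (hx : ∀ a b, x a b ∈ Set.Icc (0 : ℝ) 1)
    (hq : q ∈ Set.Icc (0 : ℝ) 1) : IsIndependentArmsPrior (twoPointPrior x q) := by
  have := isProbabilityMeasure_coin (u := false) (v := true) hq
  refine ⟨?_, ?_⟩
  · filter_upwards [twoPointPrior_mem_range hx] with p hp
    obtain ⟨θ, rfl⟩ := hp
    refine ⟨isProbabilityMeasure_envLaw hx θ, ?_⟩
    simp only [envLaw_map_eval hx]
    rfl
  · have hind : iIndepFun (fun (a : Fin K) (θ : Fin K → Bool) =>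
        (coin 0 1 (x a (θ a)) : Measure I)) (Measure.pi fun _ : Fin K => coin false true q) :=
      iIndepFun_pi (X := fun a b => (coin 0 1 (x a b) : Measure I))
        fun a => (Measurable.of_discrete).aemeasurable
    have hm : ∀ a : Fin K, Measurable fun p : Measure (Rewards K) => p.map fun y => y a :=
      fun a => Measure.measurable_map _ (measurable_pi_apply a)
    rw [iIndepFun_iff_measure_inter_preimage_eq_mul] at hind ⊢
    intro S sets hsets
    have hpre : ∀ a, envLaw x ⁻¹' ((fun p : Measure (Rewards K) => p.map fun y => y a) ⁻¹' sets a)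
        = (fun θ : Fin K → Bool => (coin 0 1 (x a (θ a)) : Measure I)) ⁻¹' sets a := fun a => by
      ext θ
      simp only [Set.mem_preimage, envLaw_map_eval hx]
    rw [twoPointPrior, Measure.map_apply measurable_envLaw
      (Finset.measurableSet_biInter _ fun a ha => hm a (hsets a ha))]
    simp only [Set.preimage_iInter, hpre]
    rw [hind S hsets]
    refine Finset.prod_congr rfl fun a ha => ?_
    rw [Measure.map_apply measurable_envLaw (hm a (hsets a ha)), hpre]

open Classical in
/-- The parameter `θ` of a reward distribution `envLaw x θ`, which is unique if every `x a` is
injective. Distributions of another form do not occur under a two-point prior; they are given the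
parameter `fun _ => false`. -/
noncomputable def decodeEnv (x : Fin K → Bool → ℝ) (p : Measure (Rewards K)) : Fin K → Bool :=
  if h : ∃ θ, envLaw x θ = p then h.choose else fun _ => false

lemma envLaw_decodeEnv {p : Measure (Rewards K)} (hp : p ∈ Set.range (envLaw x)) :
    envLaw x (decodeEnv x p) = p := by
  have hp' : ∃ θ, envLaw x θ = p := hp
  rw [decodeEnv, dif_pos hp']
  exact hp'.choose_spec

lemma decodeEnv_envLaw (hx : ∀ a b, x a b ∈ Set.Icc (0 : ℝ) 1)
    (hx' : ∀ a, Function.Injective (x a)) (θ : Fin K → Bool) : decodeEnv x (envLaw x θ) = θ :=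
  envLaw_injective hx hx' (envLaw_decodeEnv ⟨θ, rfl⟩)

lemma measurable_decodeEnv (hx : ∀ a b, x a b ∈ Set.Icc (0 : ℝ) 1) :
    Measurable (decodeEnv x) := by
  refine measurable_to_countable' fun θ => ?_
  have : decodeEnv x ⁻¹' {θ} = (⋃ θ' ∈ {θ' | decodeEnv x (envLaw x θ') = θ}, {envLaw x θ'})
      ∪ ((Set.range (envLaw x))ᶜ ∩ {_p | θ = fun _ => false}) := by
    ext p
    simp only [Set.mem_preimage, Set.mem_singleton_iff, Set.mem_union, Set.mem_iUnion,
      Set.mem_ofPred_eq, exists_prop, Set.mem_inter_iff, Set.mem_compl_iff, Set.mem_range]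
    by_cases hp : ∃ θ, envLaw x θ = p
    · obtain ⟨θ', rfl⟩ := hp
      simp only [exists_apply_eq_apply, not_true_eq_false, false_and, or_false]
      refine ⟨fun h => ⟨θ', h, rfl⟩, ?_⟩
      rintro ⟨θ'', h, h'⟩
      rwa [h']
    · simp only [hp, not_false_eq_true, true_and]
      rw [decodeEnv, dif_neg hp]
      refine ⟨fun h => Or.inr h.symm, ?_⟩
      rintro (⟨θ', -, h⟩ | h)
      · exact absurd ⟨θ', h.symm⟩ hp
      · exact h.symm
  rw [this]
  exact ((Set.toFinite _).measurableSet_biUnion fun θ' _ =>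
    measurableSet_singleton_envLaw hx θ').union
    ((measurableSet_range_envLaw hx).compl.inter (MeasurableSet.const _))

end twoPointPrior

/-! ### The law of the observations under a two-point prior -/

lemma MeasureTheory.measureReal_eq_sum_inter_preimage {Ω ι : Type*} [MeasurableSpace Ω]
    [MeasurableSpace ι] [MeasurableSingletonClass ι] {P : Measure Ω} [IsFiniteMeasure P]
    {f : Ω → ι} (hf : Measurable f) (F : Finset ι) (hF : ∀ᵐ ω ∂P, f ω ∈ F) {E : Set Ω}
    (hE : MeasurableSet E) : P.real E = ∑ i ∈ F, P.real (E ∩ f ⁻¹' {i}) := by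
  rw [← measureReal_biUnion_finset]
  · refine measureReal_congr ?_
    filter_upwards [hF] with ω hω
    refine propext ⟨fun h => ?_, fun h => ?_⟩
    · exact Set.mem_biUnion (Finset.mem_coe.2 hω) ⟨h, rfl⟩
    · obtain ⟨i, -, hi⟩ := Set.mem_iUnion₂.1 h
      exact hi.1
  · intro i _ j _ hij
    exact Set.disjoint_left.2 fun ω h h' => hij (h.2.symm.trans h'.2)
  · exact fun i _ => hE.inter (hf (measurableSet_singleton i))

namespace BanditProcess

variable {K T : ℕ} {Ω : Type u}

/-- The parameter of the reward distribution `p*`, under a two-point prior. -/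
noncomputable def param (X : BanditProcess K T Ω) (x : Fin K → Bool → ℝ) (ω : Ω) : Fin K → Bool :=
  decodeEnv x (X.pStar ω)

/-- The observations of the first `n` rounds; the entries of the later rounds are `0`.
This is a random variable that generates `historyUpTo`, and under a two-point prior it takes almost
surely one of finitely many values. -/
noncomputable def record [NeZero K] (X : BanditProcess K T Ω) (G : Fin T → Digraph (Fin K))
    (n : ℕ) (ω : Ω) (s : Fin T) : Fin K × Rewards K :=
  if (s : ℕ) < n then X.observation G s ω else 0

open Classical in
/-- The reward vectors that are observed as `z` when the action `i` is played. -/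
def obsFiber (G : Digraph (Fin K)) (i : Fin K) (z : Rewards K) : Set (Rewards K) :=
  {y | (fun a => if G.Adj i a then y a else 0) = z}

open Classical in
lemma obsFiber_eq_pi (G : Digraph (Fin K)) (i : Fin K) (z : Rewards K) :
    obsFiber G i z = Set.pi Set.univ
      fun a => if G.Adj i a then {z a} else if z a = 0 then Set.univ else ∅ := by
  ext y
  simp only [obsFiber, Set.mem_ofPred_eq, Set.mem_univ_pi, funext_iff]
  refine forall_congr' fun a => ?_
  split_ifs with h1 h2
  · rfl
  · simp [h2]
  · simp [eq_comm (a := (0 : I)), h2]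

lemma measurableSet_obsFiber (G : Digraph (Fin K)) (i : Fin K) (z : Rewards K) :
    MeasurableSet (obsFiber G i z) := by
  classical
  rw [obsFiber_eq_pi]
  refine MeasurableSet.univ_pi fun a => ?_
  split_ifs
  exacts [measurableSet_singleton _, MeasurableSet.univ, MeasurableSet.empty]

variable {X : BanditProcess K T Ω} {G : Fin T → Digraph (Fin K)}

lemma observation_eq_iff {t : Fin T} {ω : Ω} {o : Fin K × Rewards K} :
    X.observation G t ω = o ↔ X.A t ω = o.1 ∧ X.Y t ω ∈ obsFiber (G t) o.1 o.2 := by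
  constructor
  · rintro rfl
    exact ⟨rfl, rfl⟩
  · rintro ⟨h1, h2⟩
    refine Prod.ext h1 ?_
    rw [← h1] at h2
    exact h2

section record

variable [NeZero K]

lemma record_zero (ω : Ω) : X.record G 0 ω = 0 := by
  ext1 s
  simp [record]

lemma measurable_record (n : ℕ) : Measurable[X.historyUpTo G n] (X.record G n) := by
  refine @measurable_pi_lambda _ _ _ (X.historyUpTo G n) _ _ fun s => ?_
  by_cases hs : (s : ℕ) < n
  · simpa only [record, hs, if_true] using X.measurable_observation_historyUpTo G s hs
  · simp only [record, hs, if_false, measurable_const]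

lemma historyUpTo_le_comap_record (n : ℕ) :
    X.historyUpTo G n ≤ MeasurableSpace.comap (X.record G n) inferInstance := by
  refine iSup₂_le fun s hs => ?_
  have : X.observation G s = (fun o => o s) ∘ X.record G n := by
    ext1 ω
    simp [record, hs]
  rw [this, ← MeasurableSpace.comap_comp]
  exact MeasurableSpace.comap_mono (measurable_pi_apply s).comap_le

lemma record_succ_preimage (t : Fin T) (o : Fin T → Fin K × Rewards K) :
    X.record G (t + 1) ⁻¹' {o} = X.record G t ⁻¹' {Function.update o t 0} ∩ X.A t ⁻¹' {(o t).1}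
      ∩ X.Y t ⁻¹' obsFiber (G t) (o t).1 (o t).2 := by
  ext ω
  rw [Set.inter_assoc]
  have h : X.record G (t + 1) ω = Function.update (X.record G t ω) t (X.observation G t ω) := by
    ext1 s
    by_cases hs : s = t
    · subst hs; simp [record]
    · have hs' : (s : ℕ) ≠ t := fun h => hs (Fin.ext h)
      simp only [record, Function.update_of_ne hs]
      have : (s : ℕ) < t + 1 ↔ (s : ℕ) < t := by omega
      simp only [this]
  have h0 : X.record G t ω t = 0 := by simp [record]
  have h1 := observation_eq_iff (X := X) (G := G) (t := t) (ω := ω) (o := o t)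
  simp only [Set.mem_preimage, Set.mem_singleton_iff, Set.mem_inter_iff, ← h1, h]
  constructor
  · rintro rfl
    refine ⟨?_, by simp⟩
    rw [Function.update_idem, ← h0, Function.update_eq_self]
  · rintro ⟨h2, h3⟩
    rw [h2, h3, Function.update_idem, Function.update_eq_self]

end record

lemma measurable_param_environment {x : Fin K → Bool → ℝ}
    (hx : ∀ a b, x a b ∈ Set.Icc (0 : ℝ) 1) (t : Fin T) :
    Measurable[X.environment t] (X.param x) :=
  (measurable_decodeEnv hx).comp (X.measurable_pStar_environment t)

variable [mΩ : MeasurableSpace Ω] {P : Measure Ω}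

section playProb

variable [NeZero K]

/-- The conditional probability that `i` is played in round `t` when the observations of the
previous rounds are `o`; it is `0` if these observations have probability zero. -/
noncomputable def playProb (X : BanditProcess K T Ω) (G : Fin T → Digraph (Fin K))
    (P : Measure Ω) (t : Fin T) (i : Fin K) (o : Fin T → Fin K × Rewards K) : ℝ :=
  P.real (X.record G t ⁻¹' {o} ∩ X.A t ⁻¹' {i}) / P.real (X.record G t ⁻¹' {o})

lemma playProb_nonneg (t : Fin T) (i : Fin K) (o : Fin T → Fin K × Rewards K) :
    0 ≤ X.playProb G P t i o := div_nonneg measureReal_nonneg measureReal_nonneg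

lemma IsGraphBandit.measurable_record (hX : X.IsGraphBandit G P) (n : ℕ) :
    Measurable (X.record G n) :=
  (BanditProcess.measurable_record n).mono (hX.historyUpTo_le n) le_rfl

variable [IsProbabilityMeasure P]

lemma playProb_le_one (t : Fin T) (i : Fin K) (o : Fin T → Fin K × Rewards K) :
    X.playProb G P t i o ≤ 1 :=
  div_le_one_of_le₀ (measureReal_mono Set.inter_subset_left) measureReal_nonneg

/-- The conditional distribution of an action is constant on the event that the past observations
equal `o`. -/
lemma IsGraphBandit.real_inter_record_inter_action (hX : X.IsGraphBandit G P) (t : Fin T)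
    (i : Fin K) (o : Fin T → Fin K × Rewards K) {E : Set Ω}
    (hE : MeasurableSet[X.environment t] E) :
    P.real (E ∩ X.record G t ⁻¹' {o} ∩ X.A t ⁻¹' {i})
      = X.playProb G P t i o * P.real (E ∩ X.record G t ⁻¹' {o}) := by
  obtain ⟨g, -, hg⟩ := (stronglyMeasurable_condExp
    (f := (X.A t ⁻¹' {i}).indicator (fun _ => (1 : ℝ))) (m := X.history G t)
    (μ := P)).mono (historyUpTo_le_comap_record t) |>.exists_eq_measurable_comp
  have hRm : MeasurableSet[X.environment t] (X.record G t ⁻¹' {o}) :=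
    X.historyUpTo_le_environment G t _
      (BanditProcess.measurable_record t (measurableSet_singleton o))
  have key : ∀ E, MeasurableSet[X.environment t] E →
      P.real (E ∩ X.record G t ⁻¹' {o} ∩ X.A t ⁻¹' {i})
        = g o * P.real (E ∩ X.record G t ⁻¹' {o}) := fun E hE => by
    have hER := hE.inter hRm
    have hER' := hX.environment_le t _ hER
    have hAm := hX.measurable_A t (measurableSet_singleton i)
    have h := hX.integral_action_mul t i (W := (E ∩ X.record G t ⁻¹' {o}).indicator fun _ => 1)
      (stronglyMeasurable_const.indicator hER) (c := 1)
      (ae_of_all _ fun ω => by simp only [Set.indicator]; split_ifs <;> simp)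
    rw [hg] at h
    have h1 : ∀ ω, (E ∩ X.record G t ⁻¹' {o}).indicator (fun _ => (1 : ℝ)) ω
        * (X.A t ⁻¹' {i}).indicator (fun _ => 1) ω
        = (E ∩ X.record G t ⁻¹' {o} ∩ X.A t ⁻¹' {i}).indicator (fun _ => 1) ω := fun ω => by
      rw [← Set.inter_indicator_mul]
      simp only [mul_one]
    have h2 : ∀ ω, (E ∩ X.record G t ⁻¹' {o}).indicator (fun _ => (1 : ℝ)) ω
        * (g ∘ X.record G t) ω
        = g o * (E ∩ X.record G t ⁻¹' {o}).indicator (fun _ => (1 : ℝ)) ω := fun ω => by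
      by_cases hω : ω ∈ E ∩ X.record G t ⁻¹' {o}
      · have : X.record G t ω = o := hω.2
        simp [hω, this]
      · simp [hω]
    simp only [h1, h2] at h
    rw [integral_const_mul, integral_indicator_const _ (hER'.inter hAm),
      integral_indicator_const _ hER'] at h
    simpa using h
  rw [key E hE, playProb]
  have h0 := key Set.univ MeasurableSet.univ
  rw [Set.univ_inter] at h0
  rw [h0]
  by_cases hz : P.real (X.record G t ⁻¹' {o}) = 0
  · have : P.real (E ∩ X.record G t ⁻¹' {o}) = 0 :=
      le_antisymm (hz ▸ measureReal_mono Set.inter_subset_right) measureReal_nonneg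
    simp [this]
  · rw [mul_div_cancel_right₀ _ hz]

end playProb

section law

variable {x : Fin K → Bool → ℝ} {q : ℝ}

lemma IsGraphBandit.measurable_param (hX : X.IsGraphBandit G P)
    (hx : ∀ a b, x a b ∈ Set.Icc (0 : ℝ) 1) : Measurable (X.param x) :=
  (measurable_decodeEnv hx).comp hX.measurable_pStar

lemma IsGraphBandit.envLaw_param (hX : X.IsGraphBandit G P)
    (hx : ∀ a b, x a b ∈ Set.Icc (0 : ℝ) 1) (hρ : P.map X.pStar = twoPointPrior x q) :
    ∀ᵐ ω ∂P, envLaw x (X.param x ω) = X.pStar ω := by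
  have h := twoPointPrior_mem_range (q := q) hx
  rw [← hρ] at h
  filter_upwards [ae_of_ae_map hX.measurable_pStar.aemeasurable h] with ω hω
  exact envLaw_decodeEnv hω

lemma IsGraphBandit.map_param (hX : X.IsGraphBandit G P)
    (hx : ∀ a b, x a b ∈ Set.Icc (0 : ℝ) 1) (hx' : ∀ a, Function.Injective (x a))
    (hρ : P.map X.pStar = twoPointPrior x q) :
    P.map (X.param x) = Measure.pi fun _ : Fin K => coin false true q := by
  have h1 : X.param x = decodeEnv x ∘ X.pStar := rfl
  have h2 : decodeEnv x ∘ envLaw x = id := funext (decodeEnv_envLaw hx hx')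
  rw [h1, ← Measure.map_map (measurable_decodeEnv hx) hX.measurable_pStar, hρ, twoPointPrior,
    Measure.map_map (measurable_decodeEnv hx) measurable_envLaw, h2, Measure.map_id]

lemma IsGraphBandit.real_param_inter_aStar_inter_reward (hX : X.IsGraphBandit G P)
    (hx : ∀ a b, x a b ∈ Set.Icc (0 : ℝ) 1) (hρ : P.map X.pStar = twoPointPrior x q)
    (θ : Fin K → Bool) (a : Fin K) {S : Fin T → Set (Rewards K)} (hS : ∀ t, MeasurableSet (S t)) :
    P.real (X.param x ⁻¹' {θ} ∩ X.aStar ⁻¹' {a} ∩ ⋂ t, X.Y t ⁻¹' S t)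
      = P.real (X.param x ⁻¹' {θ} ∩ X.aStar ⁻¹' {a}) * ∏ t, (envLaw x θ).real (S t) := by
  have h := hX.reward_law (decodeEnv x ⁻¹' {θ}) a S
    (measurable_decodeEnv hx (measurableSet_singleton θ)) hS
  have hpre : X.pStar ⁻¹' (decodeEnv x ⁻¹' {θ}) = X.param x ⁻¹' {θ} := rfl
  rw [hpre] at h
  have hm : MeasurableSet (X.param x ⁻¹' {θ} ∩ X.aStar ⁻¹' {a}) :=
    (hX.measurable_param hx (measurableSet_singleton θ)).inter
      (hX.measurable_aStar (measurableSet_singleton a))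
  have h' : ∫⁻ ω in X.param x ⁻¹' {θ} ∩ X.aStar ⁻¹' {a}, ∏ t, X.pStar ω (S t) ∂P
      = (∏ t, envLaw x θ (S t)) * P (X.param x ⁻¹' {θ} ∩ X.aStar ⁻¹' {a}) := by
    rw [← setLIntegral_const]
    refine setLIntegral_congr_fun_ae hm ?_
    filter_upwards [hX.envLaw_param hx hρ] with ω hω hmem
    have : X.param x ω = θ := hmem.1
    rw [← hω, this]
  rw [measureReal_def, h, h', ENNReal.toReal_mul, ENNReal.toReal_prod, mul_comm]
  rfl

variable [IsProbabilityMeasure P]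

lemma IsGraphBandit.real_param_inter_reward (hX : X.IsGraphBandit G P)
    (hx : ∀ a b, x a b ∈ Set.Icc (0 : ℝ) 1) (hρ : P.map X.pStar = twoPointPrior x q)
    (θ : Fin K → Bool) {S : Fin T → Set (Rewards K)} (hS : ∀ t, MeasurableSet (S t)) :
    P.real (X.param x ⁻¹' {θ} ∩ ⋂ t, X.Y t ⁻¹' S t)
      = P.real (X.param x ⁻¹' {θ}) * ∏ t, (envLaw x θ).real (S t) := by
  have hθ := hX.measurable_param hx (measurableSet_singleton θ)
  have hSm : MeasurableSet (⋂ t, X.Y t ⁻¹' S t) :=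
    MeasurableSet.iInter fun t => hX.measurable_Y t (hS t)
  rw [measureReal_eq_sum_inter_preimage hX.measurable_aStar Finset.univ (ae_of_all _ (by simp))
      (hθ.inter hSm),
    measureReal_eq_sum_inter_preimage hX.measurable_aStar Finset.univ (ae_of_all _ (by simp)) hθ,
    Finset.sum_mul]
  refine Finset.sum_congr rfl fun a _ => ?_
  rw [← hX.real_param_inter_aStar_inter_reward hx hρ θ a hS, Set.inter_right_comm]

lemma IsGraphBandit.reward_mem_binaryRewards (hX : X.IsGraphBandit G P)
    (hx : ∀ a b, x a b ∈ Set.Icc (0 : ℝ) 1) (hρ : P.map X.pStar = twoPointPrior x q) :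
    ∀ᵐ ω ∂P, ∀ t, X.Y t ω ∈ binaryRewards K := by
  rw [ae_all_iff]
  intro t
  have hB := (finite_binaryRewards K).measurableSet
  have hm : MeasurableSet (X.Y t ⁻¹' (binaryRewards K)ᶜ) := hX.measurable_Y t hB.compl
  change P (X.Y t ⁻¹' (binaryRewards K)ᶜ) = 0
  rw [← measureReal_eq_zero_iff, measureReal_eq_sum_inter_preimage (hX.measurable_param hx)
    Finset.univ (ae_of_all _ (by simp)) hm]
  refine Finset.sum_eq_zero fun θ _ => ?_
  set S : Fin T → Set (Rewards K) := Function.update (fun _ => Set.univ) t (binaryRewards K)ᶜ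
  have hS : ∀ s, MeasurableSet (S s) := fun s => by
    by_cases hs : s = t
    · subst hs; simpa [S] using hB
    · simp [S, hs]
  have hsub : X.Y t ⁻¹' (binaryRewards K)ᶜ ∩ X.param x ⁻¹' {θ}
      ⊆ X.param x ⁻¹' {θ} ∩ ⋂ s, X.Y s ⁻¹' S s := fun ω hω => by
    refine ⟨hω.2, Set.mem_iInter.2 fun s => ?_⟩
    by_cases hs : s = t
    · subst hs; simpa [S] using hω.1
    · simp [S, hs]
  refine le_antisymm ((measureReal_mono hsub).trans (le_of_eq ?_)) measureReal_nonneg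
  rw [hX.real_param_inter_reward hx hρ θ hS, Finset.prod_eq_zero (Finset.mem_univ t), mul_zero]
  simp [S, measureReal_def, envLaw_compl_binaryRewards hx θ]

variable [NeZero K]

/-- Under a two-point prior, the past observations and the coming rewards are independent given
the parameter. -/
lemma IsGraphBandit.real_param_inter_record_inter_reward (hX : X.IsGraphBandit G P)
    (hx : ∀ a b, x a b ∈ Set.Icc (0 : ℝ) 1) (hρ : P.map X.pStar = twoPointPrior x q)
    (θ : Fin K → Bool) (n : ℕ) (hn : n ≤ T) (o : Fin T → Fin K × Rewards K)
    {S : Fin T → Set (Rewards K)} (hS : ∀ t, MeasurableSet (S t))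
    (hSn : ∀ s : Fin T, (s : ℕ) < n → S s = Set.univ) :
    P.real (X.param x ⁻¹' {θ} ∩ X.record G n ⁻¹' {o} ∩ ⋂ t, X.Y t ⁻¹' S t)
      = P.real (X.param x ⁻¹' {θ} ∩ X.record G n ⁻¹' {o}) * ∏ t, (envLaw x θ).real (S t) := by
  have hprob := isProbabilityMeasure_envLaw hx θ
  induction n generalizing o S with
  | zero =>
    by_cases ho : o = 0
    · have : X.record G 0 ⁻¹' {o} = Set.univ := by
        ext ω; simp [record_zero, ho]
      rw [this, Set.inter_univ]
      exact hX.real_param_inter_reward hx hρ θ hS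
    · have : X.record G 0 ⁻¹' {o} = ∅ := by
        ext ω; simp [record_zero, eq_comm, ho]
      simp [this]
  | succ n ih =>
    set t : Fin T := ⟨n, hn⟩ with ht
    set M := obsFiber (G t) (o t).1 (o t).2 with hM
    have hMm : MeasurableSet M := measurableSet_obsFiber _ _ _
    set o' := Function.update o t 0
    have key : ∀ S : Fin T → Set (Rewards K), (∀ t, MeasurableSet (S t)) →
        (∀ s : Fin T, (s : ℕ) < n + 1 → S s = Set.univ) →
        P.real (X.param x ⁻¹' {θ} ∩ X.record G (n + 1) ⁻¹' {o} ∩ ⋂ t, X.Y t ⁻¹' S t)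
          = X.playProb G P t (o t).1 o' * P.real (X.param x ⁻¹' {θ} ∩ X.record G n ⁻¹' {o'})
            * (envLaw x θ).real M * ∏ t, (envLaw x θ).real (S t) := by
      intro S hS hSn
      set S' := Function.update S t M with hS'
      have hSt : S t = Set.univ := hSn t (Nat.lt_succ_self n)
      have hS'm : ∀ s, MeasurableSet (S' s) := fun s => by
        by_cases hs : s = t
        · subst hs; simpa [S'] using hMm
        · simpa [S', hs] using hS s
      have hset : X.param x ⁻¹' {θ} ∩ X.record G (n + 1) ⁻¹' {o} ∩ ⋂ t, X.Y t ⁻¹' S t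
          = (X.param x ⁻¹' {θ} ∩ ⋂ s, X.Y s ⁻¹' S' s) ∩ X.record G t ⁻¹' {o'}
            ∩ X.A t ⁻¹' {(o t).1} := by
        have hI : (⋂ s, X.Y s ⁻¹' S' s) = X.Y t ⁻¹' M ∩ ⋂ s, X.Y s ⁻¹' S s := by
          ext ω
          simp only [Set.mem_iInter, Set.mem_inter_iff, Set.mem_preimage]
          constructor
          · intro h
            refine ⟨by simpa [S'] using h t, fun s => ?_⟩
            by_cases hs : s = t
            · subst hs; simp [hSt]
            · simpa [S', hs] using h s
          · rintro ⟨h1, h2⟩ s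
            by_cases hs : s = t
            · subst hs; simpa [S'] using h1
            · simpa [S', hs] using h2 s
        have := record_succ_preimage (X := X) (G := G) t o
        rw [hI]
        change _ ∩ X.record G ((t : ℕ) + 1) ⁻¹' {o} ∩ _ = _
        rw [this]
        ext ω
        simp only [Set.mem_inter_iff]
        tauto
      have hEm : MeasurableSet[X.environment t] (X.param x ⁻¹' {θ} ∩ ⋂ s, X.Y s ⁻¹' S' s) :=
        (measurable_param_environment hx t (measurableSet_singleton θ)).inter
          (MeasurableSet.iInter fun s => X.measurable_Y_environment t s (hS'm s))
      rw [hset, hX.real_inter_record_inter_action t _ _ hEm, Set.inter_right_comm]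
      have h1 := ih (by omega) o' hS'm fun s hs => by
        have hst : s ≠ t := fun h => by simp [h, ht] at hs
        simpa [S', hst] using hSn s (by omega)
      change _ * P.real (_ ∩ X.record G n ⁻¹' {o'} ∩ _) = _
      rw [h1]
      have h2 : ∏ s, (envLaw x θ).real (S' s)
          = (envLaw x θ).real M * ∏ s, (envLaw x θ).real (S s) := by
        rw [← Finset.mul_prod_erase _ _ (Finset.mem_univ t),
          ← Finset.mul_prod_erase _ (fun s => (envLaw x θ).real (S s)) (Finset.mem_univ t), hSt]
        simp only [S', Function.update_self, probReal_univ, one_mul]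
        congr 1
        exact Finset.prod_congr rfl fun s hs => by
          rw [Function.update_of_ne (Finset.ne_of_mem_erase hs)]
      rw [h2]
      ring
    rw [key S hS hSn]
    congr 1
    have := key (fun _ => Set.univ) (fun _ => MeasurableSet.univ) (fun _ _ => rfl)
    simpa using this.symm

/-- Given the parameter, an action is drawn according to `playProb` and the reward vector of the
round afresh from `envLaw x θ`; this is the recursion for the law of the observations. -/
lemma IsGraphBandit.real_param_inter_record_succ (hX : X.IsGraphBandit G P)
    (hx : ∀ a b, x a b ∈ Set.Icc (0 : ℝ) 1) (hρ : P.map X.pStar = twoPointPrior x q)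
    (θ : Fin K → Bool) (t : Fin T) (o : Fin T → Fin K × Rewards K) (i : Fin K)
    {R : Set (Rewards K)} (hR : MeasurableSet R) :
    P.real (X.param x ⁻¹' {θ} ∩ X.record G t ⁻¹' {o} ∩ X.A t ⁻¹' {i} ∩ X.Y t ⁻¹' R)
      = X.playProb G P t i o * P.real (X.param x ⁻¹' {θ} ∩ X.record G t ⁻¹' {o})
        * (envLaw x θ).real R := by
  have hprob := isProbabilityMeasure_envLaw hx θ
  have hEm : MeasurableSet[X.environment t] (X.param x ⁻¹' {θ} ∩ X.Y t ⁻¹' R) :=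
    (measurable_param_environment hx t (measurableSet_singleton θ)).inter
      (X.measurable_Y_environment t t hR)
  set S : Fin T → Set (Rewards K) := Function.update (fun _ => Set.univ) t R with hS
  have hSm : ∀ s, MeasurableSet (S s) := fun s => by
    by_cases hs : s = t
    · subst hs; simpa [S] using hR
    · simp [S, hs]
  have h := hX.real_param_inter_record_inter_reward hx hρ θ t t.2.le o hSm fun s hs => by
    have hst : s ≠ t := fun h => by simp [h] at hs
    simp [S, hst]
  have hI : (⋂ s, X.Y s ⁻¹' S s) = X.Y t ⁻¹' R := by
    ext ω
    simp only [Set.mem_iInter, Set.mem_preimage]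
    refine ⟨fun h => by simpa [S] using h t, fun h s => ?_⟩
    by_cases hs : s = t
    · subst hs; simpa [S] using h
    · simp [S, hs]
  have hprod : ∏ s, (envLaw x θ).real (S s) = (envLaw x θ).real R := by
    rw [Finset.prod_eq_single t]
    · simp [S]
    · intro s _ hs
      simp [S, hs]
    · simp
  rw [hI, hprod] at h
  have hset : X.param x ⁻¹' {θ} ∩ X.record G t ⁻¹' {o} ∩ X.A t ⁻¹' {i} ∩ X.Y t ⁻¹' R
      = X.param x ⁻¹' {θ} ∩ X.Y t ⁻¹' R ∩ X.record G t ⁻¹' {o} ∩ X.A t ⁻¹' {i} := by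
    ext ω; simp only [Set.mem_inter_iff]; tauto
  rw [hset, hX.real_inter_record_inter_action t i o hEm, Set.inter_right_comm, h]
  ring

/-- The sequences of observations with rewards in `{0, 1}`. -/
noncomputable def binaryRecords (K T : ℕ) : Finset (Fin T → Fin K × Rewards K) :=
  Set.Finite.toFinset (s := {o | ∀ s, o s ∈ (Set.univ : Set (Fin K)) ×ˢ binaryRewards K})
    (Set.Finite.pi' fun _ => Set.finite_univ.prod (finite_binaryRewards K))

lemma IsGraphBandit.record_mem_binaryRecords (hX : X.IsGraphBandit G P)
    (hx : ∀ a b, x a b ∈ Set.Icc (0 : ℝ) 1) (hρ : P.map X.pStar = twoPointPrior x q) (n : ℕ) :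
    ∀ᵐ ω ∂P, X.record G n ω ∈ binaryRecords K T := by
  classical
  filter_upwards [hX.reward_mem_binaryRewards hx hρ] with ω hω
  simp only [binaryRecords, Set.Finite.mem_toFinset, Set.mem_ofPred_eq, Set.mem_prod,
    Set.mem_univ, true_and]
  intro s
  by_cases hs : (s : ℕ) < n
  · simp only [record, hs, if_true]
    intro a
    simp only [observation]
    split_ifs
    · exact hω s a
    · simp
  · simp only [record, hs, if_false]
    exact fun a => by simp

/-- The reward vector of a round is independent of the action of this round, given the
parameter. -/
lemma IsGraphBandit.real_param_inter_action_inter_reward (hX : X.IsGraphBandit G P)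
    (hx : ∀ a b, x a b ∈ Set.Icc (0 : ℝ) 1) (hρ : P.map X.pStar = twoPointPrior x q)
    (θ : Fin K → Bool) (t : Fin T) (i : Fin K) {R : Set (Rewards K)} (hR : MeasurableSet R) :
    P.real (X.param x ⁻¹' {θ} ∩ X.A t ⁻¹' {i} ∩ X.Y t ⁻¹' R)
      = P.real (X.param x ⁻¹' {θ} ∩ X.A t ⁻¹' {i}) * (envLaw x θ).real R := by
  have hprob := isProbabilityMeasure_envLaw hx θ
  have hθ := hX.measurable_param hx (measurableSet_singleton θ)
  have hA := hX.measurable_A t (measurableSet_singleton i)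
  have key : ∀ R : Set (Rewards K), MeasurableSet R →
      P.real (X.param x ⁻¹' {θ} ∩ X.A t ⁻¹' {i} ∩ X.Y t ⁻¹' R)
        = (∑ o ∈ binaryRecords K T, X.playProb G P t i o
            * P.real (X.param x ⁻¹' {θ} ∩ X.record G t ⁻¹' {o})) * (envLaw x θ).real R := by
    intro R hR
    rw [measureReal_eq_sum_inter_preimage (hX.measurable_record t) _
      (hX.record_mem_binaryRecords hx hρ t) ((hθ.inter hA).inter (hX.measurable_Y t hR)),
      Finset.sum_mul]
    refine Finset.sum_congr rfl fun o _ => ?_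
    rw [← hX.real_param_inter_record_succ hx hρ θ t o i hR]
    congr 1
    ext ω; simp only [Set.mem_inter_iff]; tauto
  have h := key Set.univ MeasurableSet.univ
  simp only [Set.preimage_univ, Set.inter_univ, probReal_univ, mul_one] at h
  rw [key R hR, h]

end law

end BanditProcess

/-! ### Change of measure for a single arm -/

/-- Le Cam's bound of the total variation distance of two finite measures of the same mass by their
relative entropy; `l` is the density of one with respect to the other. -/
lemma sum_abs_sub_one_mul_sq_le {ι : Type*} (F : Finset ι) {m l : ι → ℝ} {M : ℝ}
    (hm : ∀ i, 0 ≤ m i) (hl : ∀ i, 0 < l i) (h1 : ∑ i ∈ F, m i = M)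
    (h2 : ∑ i ∈ F, l i * m i = M) :
    (∑ i ∈ F, |l i - 1| * m i) ^ 2 ≤ (∑ i ∈ F, -Real.log (l i) * m i) * (4 * M) := by
  have hCS : (∑ i ∈ F, |l i - 1| * m i) ^ 2
      ≤ (∑ i ∈ F, (√(l i) - 1) ^ 2 * m i) * ∑ i ∈ F, (√(l i) + 1) ^ 2 * m i := by
    refine Finset.sum_sq_le_sum_mul_sum_of_sq_le_mul F (fun i _ => mul_nonneg (sq_nonneg _) (hm i))
      (fun i _ => mul_nonneg (sq_nonneg _) (hm i)) fun i _ => ?_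
    have h : l i - 1 = (√(l i) - 1) * (√(l i) + 1) := by
      nlinarith [Real.sq_sqrt (hl i).le]
    rw [mul_pow, sq_abs, h]
    exact le_of_eq (by ring)
  have hA : ∑ i ∈ F, (√(l i) - 1) ^ 2 * m i ≤ ∑ i ∈ F, -Real.log (l i) * m i := by
    have : ∑ i ∈ F, (√(l i) - 1) ^ 2 * m i ≤ ∑ i ∈ F, (-Real.log (l i) + l i - 1) * m i := by
      refine Finset.sum_le_sum fun i _ => mul_le_mul_of_nonneg_right ?_ (hm i)
      have h := Real.log_le_sub_one_of_pos (Real.sqrt_pos.2 (hl i))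
      rw [Real.log_sqrt (hl i).le] at h
      nlinarith [Real.sq_sqrt (hl i).le]
    refine this.trans (le_of_eq ?_)
    calc _ = ∑ i ∈ F, (-Real.log (l i) * m i + l i * m i - m i) :=
          Finset.sum_congr rfl fun i _ => by ring
      _ = _ := by
          rw [Finset.sum_sub_distrib, Finset.sum_add_distrib, h1, h2]
          ring
  have hB : ∑ i ∈ F, (√(l i) + 1) ^ 2 * m i ≤ 4 * M := by
    calc _ ≤ ∑ i ∈ F, (2 * (l i * m i) + 2 * m i) := by
          refine Finset.sum_le_sum fun i _ => ?_
          have : (√(l i) + 1) ^ 2 ≤ 2 * l i + 2 := by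
            nlinarith [Real.sq_sqrt (hl i).le, sq_nonneg (√(l i) - 1)]
          nlinarith [mul_le_mul_of_nonneg_right this (hm i)]
      _ = _ := by
          rw [Finset.sum_add_distrib, ← Finset.mul_sum, ← Finset.mul_sum, h1, h2]
          ring
  have hB0 : 0 ≤ ∑ i ∈ F, (√(l i) + 1) ^ 2 * m i :=
    Finset.sum_nonneg fun i _ => mul_nonneg (sq_nonneg _) (hm i)
  have hA0 : 0 ≤ ∑ i ∈ F, (√(l i) - 1) ^ 2 * m i :=
    Finset.sum_nonneg fun i _ => mul_nonneg (sq_nonneg _) (hm i)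
  exact hCS.trans (mul_le_mul hA hB hB0 (hA0.trans hA))

namespace BanditProcess

variable {K T : ℕ}

open Classical in
/-- The likelihood ratio of an observation when the mean of the arm `a` is raised from `1 / 2` to
`1 / 2 + δ`. -/
noncomputable def likelihoodStep (G : Digraph (Fin K)) (a : Fin K) (δ : ℝ)
    (o : Fin K × Rewards K) : ℝ :=
  if G.Adj o.1 a then (if o.2 a = 1 then 1 + 2 * δ else 1 - 2 * δ) else 1

/-- The likelihood ratio of the first `n` observations. The probabilities of the actions cancel, as
a policy cannot depend on the parameter. -/
noncomputable def likelihood (G : Fin T → Digraph (Fin K)) (a : Fin K) (δ : ℝ) (n : ℕ)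
    (o : Fin T → Fin K × Rewards K) : ℝ :=
  ∏ s : Fin T, if (s : ℕ) < n then likelihoodStep (G s) a δ (o s) else 1

lemma likelihoodStep_pos (G : Digraph (Fin K)) (a : Fin K) {δ : ℝ} (hδ0 : 0 < δ)
    (hδ : δ ≤ 1 / 4) (o : Fin K × Rewards K) : 0 < likelihoodStep G a δ o := by
  unfold likelihoodStep
  split_ifs <;> linarith

lemma likelihood_pos (G : Fin T → Digraph (Fin K)) (a : Fin K) {δ : ℝ} (hδ0 : 0 < δ)
    (hδ : δ ≤ 1 / 4) (n : ℕ) (o : Fin T → Fin K × Rewards K) : 0 < likelihood G a δ n o := by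
  refine Finset.prod_pos fun s _ => ?_
  split_ifs
  exacts [likelihoodStep_pos _ _ hδ0 hδ _, one_pos]

lemma likelihood_succ [NeZero K] (G : Fin T → Digraph (Fin K)) (a : Fin K) (δ : ℝ) (t : Fin T)
    (o : Fin T → Fin K × Rewards K) : likelihood G a δ (t + 1) o
      = likelihood G a δ t (Function.update o t 0) * likelihoodStep (G t) a δ (o t) := by
  unfold likelihood
  rw [← Finset.mul_prod_erase _ _ (Finset.mem_univ t),
    ← Finset.mul_prod_erase _ (fun s : Fin T => if (s : ℕ) < t then
      likelihoodStep (G s) a δ (Function.update o t 0 s) else 1) (Finset.mem_univ t)]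
  simp only [Nat.lt_succ_self, if_true, lt_irrefl, if_false, one_mul]
  rw [mul_comm]
  congr 1
  refine Finset.prod_congr rfl fun s hs => ?_
  have hst := Finset.ne_of_mem_erase hs
  have hst' : (s : ℕ) ≠ t := fun h => hst (Fin.ext h)
  have : (s : ℕ) < t + 1 ↔ (s : ℕ) < t := by omega
  simp only [this, Function.update_of_ne hst]

lemma envLaw_update_real_obsFiber {x : Fin K → Bool → ℝ} (hx : ∀ a b, x a b ∈ Set.Icc (0 : ℝ) 1)
    {a : Fin K} {δ : ℝ} (ha0 : x a false = 1 / 2) (ha1 : x a true = 1 / 2 + δ)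
    {θ : Fin K → Bool} (hθ : θ a = false) (G : Digraph (Fin K)) (i : Fin K) (z : Rewards K) :
    (envLaw x (Function.update θ a true)).real (obsFiber G i z)
      = likelihoodStep G a δ (i, z) * (envLaw x θ).real (obsFiber G i z) := by
  classical
  have hprob : ∀ θ : Fin K → Bool, ∀ a, IsProbabilityMeasure (coin (0 : I) 1 (x a (θ a))) :=
    fun θ a => isProbabilityMeasure_coin (hx a (θ a))
  have h := hprob θ
  have h' := hprob (Function.update θ a true)
  have hpi : ∀ θ : Fin K → Bool, (∀ a, IsProbabilityMeasure (coin (0 : I) 1 (x a (θ a)))) →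
      (envLaw x θ).real (obsFiber G i z) = ∏ b, (coin (0 : I) 1 (x b (θ b))).real
        (if G.Adj i b then {z b} else if z b = 0 then Set.univ else ∅) := fun θ hθ => by
    rw [obsFiber_eq_pi, measureReal_def, envLaw, Measure.pi_pi, ENNReal.toReal_prod]
    rfl
  rw [hpi _ h', hpi _ h, ← Finset.mul_prod_erase _ _ (Finset.mem_univ a),
    ← Finset.mul_prod_erase _ (fun b => (coin (0 : I) 1 (x b (θ b))).real _) (Finset.mem_univ a),
    ← mul_assoc]
  congr 1
  · have ha := h a
    have ha' := h' a
    rw [Function.update_self] at ha' ⊢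
    rw [hθ] at ha ⊢
    unfold likelihoodStep
    by_cases hadj : G.Adj i a
    · simp only [hadj, if_true]
      by_cases h1 : z a = 1
      · rw [if_pos h1, h1, coin_real_singleton_right zero_ne_one (hx a true),
          coin_real_singleton_right zero_ne_one (hx a false), ha0, ha1]
        ring
      · rw [if_neg h1]
        by_cases h0 : z a = 0
        · rw [h0, coin_real_singleton_left zero_ne_one (hx a true),
            coin_real_singleton_left zero_ne_one (hx a false), ha0, ha1]
          ring
        · have hz : ∀ y : ℝ, (coin (0 : I) 1 y).real {z a} = 0 := fun y => by
            refine (measureReal_eq_zero_iff ?_).2 (measure_mono_null ?_ (coin_compl_pair (x := y)))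
            · simp [coin, Ne.symm h0, Ne.symm h1]
            · simp [h0, h1]
          rw [hz, hz, mul_zero]
    · simp only [hadj, if_false, one_mul]
      split_ifs <;> simp
  · refine Finset.prod_congr rfl fun b hb => ?_
    rw [Function.update_of_ne (Finset.ne_of_mem_erase hb)]

variable {Ω : Type u} {X : BanditProcess K T Ω} {x : Fin K → Bool → ℝ}

/-- The event that the parameter of the arm `a` is `b`. -/
def armEvent (X : BanditProcess K T Ω) (x : Fin K → Bool → ℝ) (a : Fin K) (b : Bool) : Set Ω :=
  {ω | X.param x ω a = b}

lemma measurableSet_armEvent_environment (hx : ∀ a b, x a b ∈ Set.Icc (0 : ℝ) 1) (t : Fin T)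
    (a : Fin K) (b : Bool) : MeasurableSet[X.environment t] (X.armEvent x a b) :=
  ((measurable_pi_apply a).comp (measurable_param_environment hx t)) (measurableSet_singleton b)

variable [mΩ : MeasurableSpace Ω] {P : Measure Ω} {G : Fin T → Digraph (Fin K)} {q : ℝ}

lemma IsGraphBandit.measurableSet_armEvent (hX : X.IsGraphBandit G P)
    (hx : ∀ a b, x a b ∈ Set.Icc (0 : ℝ) 1) (a : Fin K) (b : Bool) :
    MeasurableSet (X.armEvent x a b) :=
  ((measurable_pi_apply a).comp (hX.measurable_param hx)) (measurableSet_singleton b)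

lemma IsGraphBandit.real_param_preimage (hX : X.IsGraphBandit G P)
    (hx : ∀ a b, x a b ∈ Set.Icc (0 : ℝ) 1) (hx' : ∀ a, Function.Injective (x a))
    (hq : q ∈ Set.Icc (0 : ℝ) 1) (hρ : P.map X.pStar = twoPointPrior x q)
    (s : Fin K → Set Bool) :
    P.real (X.param x ⁻¹' Set.pi Set.univ s) = ∏ a, (coin false true q).real (s a) := by
  have := isProbabilityMeasure_coin (u := false) (v := true) hq
  rw [← map_measureReal_apply (hX.measurable_param hx) MeasurableSet.of_discrete,
    hX.map_param hx hx' hρ, measureReal_def, Measure.pi_pi, ENNReal.toReal_prod]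
  rfl

lemma IsGraphBandit.real_param_singleton (hX : X.IsGraphBandit G P)
    (hx : ∀ a b, x a b ∈ Set.Icc (0 : ℝ) 1) (hx' : ∀ a, Function.Injective (x a))
    (hq : q ∈ Set.Icc (0 : ℝ) 1) (hρ : P.map X.pStar = twoPointPrior x q)
    (θ : Fin K → Bool) :
    P.real (X.param x ⁻¹' {θ}) = ∏ a, (coin false true q).real {θ a} := by
  rw [← hX.real_param_preimage hx hx' hq hρ, Set.univ_pi_singleton]

lemma IsGraphBandit.real_armEvent_true (hX : X.IsGraphBandit G P)
    (hx : ∀ a b, x a b ∈ Set.Icc (0 : ℝ) 1) (hx' : ∀ a, Function.Injective (x a))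
    (hq : q ∈ Set.Icc (0 : ℝ) 1) (hρ : P.map X.pStar = twoPointPrior x q) (a : Fin K) :
    P.real (X.armEvent x a true) = q := by
  have := isProbabilityMeasure_coin (u := false) (v := true) hq
  have h : X.armEvent x a true = X.param x ⁻¹' Set.pi Set.univ
      (Function.update (fun _ => Set.univ) a {true}) := by
    ext ω
    simp only [armEvent, Set.mem_ofPred_eq, Set.mem_preimage, Set.mem_univ_pi]
    refine ⟨fun h b => ?_, fun h => by simpa using h a⟩
    by_cases hb : b = a
    · subst hb; simpa using h
    · simp [hb]
  rw [h, hX.real_param_preimage hx hx' hq hρ, Finset.prod_eq_single a]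
  · rw [Function.update_self, coin_real_singleton_right (by simp) hq]
  · intro b _ hb
    rw [Function.update_of_ne hb]
    exact probReal_univ
  · simp

variable [IsProbabilityMeasure P]

lemma IsGraphBandit.real_armEvent_add (hX : X.IsGraphBandit G P)
    (hx : ∀ a b, x a b ∈ Set.Icc (0 : ℝ) 1) (a : Fin K) (E : Set Ω) :
    P.real (X.armEvent x a true ∩ E) + P.real (X.armEvent x a false ∩ E) = P.real E := by
  have h := measureReal_inter_add_sdiff (μ := P) (s := E) (hX.measurableSet_armEvent hx a true)
  rw [← h, Set.inter_comm]
  congr 2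
  ext ω
  simp [armEvent, and_comm]

lemma IsGraphBandit.real_armEvent_inter (hX : X.IsGraphBandit G P)
    (hx : ∀ a b, x a b ∈ Set.Icc (0 : ℝ) 1) (a : Fin K) (b : Bool) {E : Set Ω}
    (hE : MeasurableSet E) :
    P.real (X.armEvent x a b ∩ E)
      = ∑ θ : Fin K → Bool with θ a = b, P.real (X.param x ⁻¹' {θ} ∩ E) := by
  rw [measureReal_eq_sum_inter_preimage (hX.measurable_param hx) Finset.univ
    (ae_of_all _ (by simp)) ((hX.measurableSet_armEvent hx a b).inter hE), Finset.sum_filter]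
  refine Finset.sum_congr rfl fun θ _ => ?_
  split_ifs with h
  · congr 1
    ext ω
    simp only [armEvent, Set.mem_inter_iff, Set.mem_ofPred_eq, Set.mem_preimage,
      Set.mem_singleton_iff]
    constructor
    · tauto
    · rintro ⟨h1, h2⟩
      exact ⟨⟨h1 ▸ h, h2⟩, h1⟩
  · have : X.armEvent x a b ∩ E ∩ X.param x ⁻¹' {θ} = ∅ := by
      ext ω
      simp only [armEvent, Set.mem_inter_iff, Set.mem_ofPred_eq, Set.mem_preimage,
        Set.mem_singleton_iff, Set.mem_empty_iff_false, iff_false, not_and]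
      rintro ⟨h1, -⟩ h2
      exact h (h2 ▸ h1)
    rw [this, measureReal_empty]

/-- Given the parameter of an arm, its reward is independent of the action of the round. -/
lemma IsGraphBandit.real_armEvent_inter_action_inter_reward [NeZero K] (hX : X.IsGraphBandit G P)
    (hx : ∀ a b, x a b ∈ Set.Icc (0 : ℝ) 1) (hρ : P.map X.pStar = twoPointPrior x q)
    (a : Fin K) (b : Bool) (t : Fin T) (J : Set (Fin K)) :
    P.real (X.armEvent x a b ∩ (X.A t ⁻¹' J ∩ {ω | X.Y t ω a = 1}))
      = x a b * P.real (X.armEvent x a b ∩ X.A t ⁻¹' J) := by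
  classical
  have hJ : MeasurableSet (X.A t ⁻¹' J) := hX.measurable_A t MeasurableSet.of_discrete
  have hR : MeasurableSet {y : Rewards K | y a = 1} :=
    measurable_pi_apply a (measurableSet_singleton 1)
  have hY : MeasurableSet {ω | X.Y t ω a = 1} := hX.measurable_Y t hR
  rw [hX.real_armEvent_inter hx a b (hJ.inter hY), hX.real_armEvent_inter hx a b hJ,
    Finset.mul_sum]
  refine Finset.sum_congr rfl fun θ hθ => ?_
  have hθm := hX.measurable_param hx (measurableSet_singleton θ)
  rw [measureReal_eq_sum_inter_preimage (hX.measurable_A t) Finset.univ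
      (ae_of_all _ (by simp)) (hθm.inter (hJ.inter hY)),
    measureReal_eq_sum_inter_preimage (hX.measurable_A t) Finset.univ
      (ae_of_all _ (by simp)) (hθm.inter hJ), Finset.mul_sum]
  refine Finset.sum_congr rfl fun i _ => ?_
  by_cases hi : i ∈ J
  · have h := hX.real_param_inter_action_inter_reward hx hρ θ t i hR
    rw [envLaw_real_eval hx, (Finset.mem_filter.1 hθ).2] at h
    have h1 : X.param x ⁻¹' {θ} ∩ (X.A t ⁻¹' J ∩ {ω | X.Y t ω a = 1}) ∩ X.A t ⁻¹' {i}
        = X.param x ⁻¹' {θ} ∩ X.A t ⁻¹' {i} ∩ X.Y t ⁻¹' {y | y a = 1} := by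
      ext ω
      simp only [Set.mem_inter_iff, Set.mem_preimage, Set.mem_singleton_iff, Set.mem_ofPred_eq]
      constructor
      · tauto
      · rintro ⟨⟨h1, h2⟩, h3⟩
        exact ⟨⟨h1, h2 ▸ hi, h3⟩, h2⟩
    have h2 : X.param x ⁻¹' {θ} ∩ X.A t ⁻¹' J ∩ X.A t ⁻¹' {i}
        = X.param x ⁻¹' {θ} ∩ X.A t ⁻¹' {i} := by
      ext ω
      simp only [Set.mem_inter_iff, Set.mem_preimage, Set.mem_singleton_iff]
      constructor
      · tauto
      · rintro ⟨h1, h2⟩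
        exact ⟨⟨h1, h2 ▸ hi⟩, h2⟩
    rw [h1, h2, h, mul_comm]
  · have h0 : X.A t ⁻¹' J ∩ X.A t ⁻¹' {i} = ∅ := by
      ext ω
      simp only [Set.mem_inter_iff, Set.mem_preimage, Set.mem_singleton_iff,
        Set.mem_empty_iff_false, iff_false, not_and]
      rintro h1 h2
      exact hi (h2 ▸ h1)
    have h1 : X.param x ⁻¹' {θ} ∩ (X.A t ⁻¹' J ∩ {ω | X.Y t ω a = 1}) ∩ X.A t ⁻¹' {i} = ∅ :=
      Set.subset_empty_iff.1 fun ω hω => h0 ▸ ⟨hω.1.2.1, hω.2⟩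
    have h2 : X.param x ⁻¹' {θ} ∩ X.A t ⁻¹' J ∩ X.A t ⁻¹' {i} = ∅ :=
      Set.subset_empty_iff.1 fun ω hω => h0 ▸ ⟨hω.1.2, hω.2⟩
    rw [h1, h2, measureReal_empty, mul_zero]

section likelihood

variable [NeZero K] {a : Fin K} {δ : ℝ}

/-- The change of measure formula: the likelihood ratio is the density of the law of the
observations when the arm `a` is good with respect to the law when it is not. The factors `q` and
`1 - q` are the prior probabilities of the two cases. -/
lemma IsGraphBandit.real_param_update_inter_record (hX : X.IsGraphBandit G P)
    (hx : ∀ a b, x a b ∈ Set.Icc (0 : ℝ) 1) (hx' : ∀ a, Function.Injective (x a))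
    (hq : q ∈ Set.Icc (0 : ℝ) 1) (hρ : P.map X.pStar = twoPointPrior x q)
    (ha0 : x a false = 1 / 2) (ha1 : x a true = 1 / 2 + δ) {θ : Fin K → Bool}
    (hθ : θ a = false) (n : ℕ) (hn : n ≤ T) (o : Fin T → Fin K × Rewards K) :
    (1 - q) * P.real (X.param x ⁻¹' {Function.update θ a true} ∩ X.record G n ⁻¹' {o})
      = q * (likelihood G a δ n o * P.real (X.param x ⁻¹' {θ} ∩ X.record G n ⁻¹' {o})) := by
  induction n generalizing o with
  | zero =>
    by_cases ho : o = 0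
    · have : X.record G 0 ⁻¹' {o} = Set.univ := by
        ext ω; simp [record_zero, ho]
      rw [this, Set.inter_univ, Set.inter_univ, hX.real_param_singleton hx hx' hq hρ,
        hX.real_param_singleton hx hx' hq hρ, ← Finset.mul_prod_erase _ _ (Finset.mem_univ a),
        ← Finset.mul_prod_erase _ (fun b => (coin false true q).real {θ b}) (Finset.mem_univ a),
        Function.update_self, hθ, coin_real_singleton_right (by simp) hq,
        coin_real_singleton_left (by simp) hq]
      have h : ∏ b ∈ Finset.univ.erase a, (coin false true q).real {Function.update θ a true b}
          = ∏ b ∈ Finset.univ.erase a, (coin false true q).real {θ b} :=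
        Finset.prod_congr rfl fun b hb => by
          rw [Function.update_of_ne (Finset.ne_of_mem_erase hb)]
      rw [h]
      simp only [likelihood, not_lt_zero, if_false, Finset.prod_const_one]
      ring
    · have : X.record G 0 ⁻¹' {o} = ∅ := by
        ext ω; simp [record_zero, eq_comm, ho]
      simp [this]
  | succ n ih =>
    set t : Fin T := ⟨n, hn⟩ with ht
    have hrec : ∀ θ : Fin K → Bool, P.real (X.param x ⁻¹' {θ} ∩ X.record G (n + 1) ⁻¹' {o})
        = X.playProb G P t (o t).1 (Function.update o t 0)
          * P.real (X.param x ⁻¹' {θ} ∩ X.record G n ⁻¹' {Function.update o t 0})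
          * (envLaw x θ).real (obsFiber (G t) (o t).1 (o t).2) := fun θ => by
      have h1 := hX.real_param_inter_record_succ hx hρ θ t (Function.update o t 0) (o t).1
        (measurableSet_obsFiber (G t) (o t).1 (o t).2)
      have h2 := record_succ_preimage (X := X) (G := G) t o
      change P.real (_ ∩ X.record G ((t : ℕ) + 1) ⁻¹' {o}) = _
      rw [h2, ← Set.inter_assoc, ← Set.inter_assoc]
      exact h1
    have hl := likelihood_succ G a δ t o
    change likelihood G a δ (n + 1) o = likelihood G a δ n _ * _ at hl
    have hih := ih (by omega) (Function.update o t 0)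
    rw [hrec, hrec, hl, envLaw_update_real_obsFiber hx ha0 ha1 hθ]
    linear_combination (X.playProb G P t (o t).1 (Function.update o t 0)
      * (likelihoodStep (G t) a δ (o t)
        * (envLaw x θ).real (obsFiber (G t) (o t).1 (o t).2))) * hih

lemma IsGraphBandit.real_armEvent_inter_record (hX : X.IsGraphBandit G P)
    (hx : ∀ a b, x a b ∈ Set.Icc (0 : ℝ) 1) (hx' : ∀ a, Function.Injective (x a))
    (hq : q ∈ Set.Icc (0 : ℝ) 1) (hρ : P.map X.pStar = twoPointPrior x q)
    (ha0 : x a false = 1 / 2) (ha1 : x a true = 1 / 2 + δ) (n : ℕ) (hn : n ≤ T)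
    (o : Fin T → Fin K × Rewards K) :
    (1 - q) * P.real (X.armEvent x a true ∩ X.record G n ⁻¹' {o})
      = q * (likelihood G a δ n o
        * P.real (X.armEvent x a false ∩ X.record G n ⁻¹' {o})) := by
  have hR : MeasurableSet (X.record G n ⁻¹' {o}) :=
    hX.measurable_record n (measurableSet_singleton o)
  rw [hX.real_armEvent_inter hx a true hR, hX.real_armEvent_inter hx a false hR,
    Finset.mul_sum, Finset.mul_sum, Finset.mul_sum]
  symm
  refine Finset.sum_nbij' (fun θ => Function.update θ a true) (fun θ => Function.update θ a false)
    ?_ ?_ ?_ ?_ ?_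
  · intro θ _; simp
  · intro θ _; simp
  · intro θ hθ
    have := (Finset.mem_filter.1 hθ).2
    rw [Function.update_idem, ← this, Function.update_eq_self]
  · intro θ hθ
    have := (Finset.mem_filter.1 hθ).2
    rw [Function.update_idem, ← this, Function.update_eq_self]
  · intro θ hθ
    exact (hX.real_param_update_inter_record hx hx' hq hρ ha0 ha1
      (Finset.mem_filter.1 hθ).2 n hn o).symm

lemma IsGraphBandit.sum_filter_real_inter_record (hX : X.IsGraphBandit G P)
    (hx : ∀ a b, x a b ∈ Set.Icc (0 : ℝ) 1) (hρ : P.map X.pStar = twoPointPrior x q) (n : ℕ)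
    {E : Set Ω} (hE : MeasurableSet E) {Q : Set (Fin T → Fin K × Rewards K)}
    (hQ : MeasurableSet Q)
    [DecidablePred (· ∈ Q)] :
    ∑ o ∈ binaryRecords K T with o ∈ Q, P.real (E ∩ X.record G n ⁻¹' {o})
      = P.real (E ∩ X.record G n ⁻¹' Q) := by
  rw [measureReal_eq_sum_inter_preimage (hX.measurable_record n) _
    (hX.record_mem_binaryRecords hx hρ n) (hE.inter (hX.measurable_record n hQ)),
    Finset.sum_filter]
  refine Finset.sum_congr rfl fun o _ => ?_
  split_ifs with ho
  · congr 1
    ext ω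
    simp only [Set.mem_inter_iff, Set.mem_preimage, Set.mem_singleton_iff]
    constructor
    · rintro ⟨h1, h2⟩
      exact ⟨⟨h1, h2 ▸ ho⟩, h2⟩
    · tauto
  · have : E ∩ X.record G n ⁻¹' Q ∩ X.record G n ⁻¹' {o} = ∅ := by
      ext ω
      simp only [Set.mem_inter_iff, Set.mem_preimage, Set.mem_singleton_iff,
        Set.mem_empty_iff_false, iff_false, not_and]
      rintro ⟨-, h1⟩ h2
      exact ho (h2 ▸ h1)
    rw [this, measureReal_empty]

/-- A round in which `a` is observed contributes the relative entropy of two coins, and the other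
rounds contribute nothing. -/
lemma IsGraphBandit.sum_log_likelihoodStep (hX : X.IsGraphBandit G P)
    (hx : ∀ a b, x a b ∈ Set.Icc (0 : ℝ) 1) (hρ : P.map X.pStar = twoPointPrior x q)
    (ha0 : x a false = 1 / 2) {n : ℕ} (s : Fin T) (hs : (s : ℕ) < n) :
    ∑ o ∈ binaryRecords K T, Real.log (likelihoodStep (G s) a δ (o s))
        * P.real (X.armEvent x a false ∩ X.record G n ⁻¹' {o})
      = (Real.log (1 + 2 * δ) + Real.log (1 - 2 * δ)) / 2
        * P.real (X.armEvent x a false ∩ X.A s ⁻¹' {i | (G s).Adj i a}) := by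
  classical
  set Q : Set (Fin T → Fin K × Rewards K) := {o | (G s).Adj (o s).1 a} with hQ
  set R : Set (Fin T → Fin K × Rewards K) := {o | (o s).2 a = 1} with hR
  have hQm : MeasurableSet Q :=
    (measurable_pi_apply s).fst (MeasurableSet.of_discrete (s := {i | (G s).Adj i a}))
  have hRm : MeasurableSet R :=
    ((measurable_pi_apply a).comp (measurable_pi_apply s).snd) (measurableSet_singleton 1)
  have hE := hX.measurableSet_armEvent hx a false
  have hlog : ∀ o : Fin T → Fin K × Rewards K, Real.log (likelihoodStep (G s) a δ (o s))
      = (if o ∈ Q ∩ R then Real.log (1 + 2 * δ) else 0)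
        + (if o ∈ Q \ R then Real.log (1 - 2 * δ) else 0) := fun o => by
    simp only [likelihoodStep, hQ, hR, Set.mem_inter_iff, Set.mem_ofPred_eq, Set.mem_sdiff]
    by_cases h1 : (G s).Adj (o s).1 a <;> by_cases h2 : (o s).2 a = 1 <;> simp [h1, h2]
  have h1 := hX.sum_filter_real_inter_record hx hρ n hE (hQm.inter hRm)
  have h2 := hX.sum_filter_real_inter_record hx hρ n hE (hQm.diff hRm)
  have hobs : ∀ ω, X.record G n ω s = X.observation G s ω := fun ω => by simp [record, hs]
  have hp1 : X.record G n ⁻¹' (Q ∩ R)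
      = X.A s ⁻¹' {i | (G s).Adj i a} ∩ {ω | X.Y s ω a = 1} := by
    ext ω
    simp only [hQ, hR, Set.mem_preimage, Set.mem_inter_iff, Set.mem_ofPred_eq, hobs, observation]
    refine and_congr_right fun h => ?_
    rw [if_pos h]
  have hp2 : X.record G n ⁻¹' Q = X.A s ⁻¹' {i | (G s).Adj i a} := by
    ext ω
    simp only [hQ, Set.mem_preimage, Set.mem_ofPred_eq, hobs, observation]
  have hcoin := hX.real_armEvent_inter_action_inter_reward hx hρ a false s {i | (G s).Adj i a}
  have hsplit : P.real (X.armEvent x a false ∩ X.record G n ⁻¹' (Q ∩ R))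
      + P.real (X.armEvent x a false ∩ X.record G n ⁻¹' (Q \ R))
      = P.real (X.armEvent x a false ∩ X.record G n ⁻¹' Q) := by
    rw [← measureReal_inter_add_sdiff (μ := P)
      (s := X.armEvent x a false ∩ X.record G n ⁻¹' Q) (hX.measurable_record n hRm)]
    congr 2 <;> ext ω <;> simp only [Set.mem_inter_iff, Set.mem_sdiff, Set.mem_preimage] <;> tauto
  rw [hp1, hcoin, hp2, ha0] at hsplit
  rw [hp1, hcoin, ha0] at h1
  simp only [hlog, add_mul, Finset.sum_add_distrib, ite_mul, zero_mul]
  rw [← Finset.sum_filter, ← Finset.sum_filter, ← Finset.mul_sum, ← Finset.mul_sum, h1, h2]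
  linear_combination (Real.log (1 - 2 * δ)) * hsplit

lemma neg_half_log_le {δ : ℝ} (hδ0 : 0 < δ) (hδ : δ ≤ 1 / 4) :
    -((Real.log (1 + 2 * δ) + Real.log (1 - 2 * δ)) / 2) ≤ 4 * δ ^ 2 := by
  rw [← Real.log_mul (by linarith) (by linarith)]
  have hy : 0 < (1 + 2 * δ) * (1 - 2 * δ) := mul_pos (by linarith) (by linarith)
  have h := Real.log_le_sub_one_of_pos (inv_pos.2 hy)
  rw [Real.log_inv] at h
  have h2 : ((1 + 2 * δ) * (1 - 2 * δ))⁻¹ ≤ 1 + 8 * δ ^ 2 := by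
    rw [inv_le_iff_one_le_mul₀' hy]
    nlinarith [mul_nonneg (sq_nonneg δ) (sq_nonneg δ), sq_nonneg δ, mul_self_nonneg (δ - 1 / 4),
      mul_nonneg (sq_nonneg δ) (sub_nonneg.2 hδ)]
  linarith

/-- The sum over the rounds of the probabilities that `a` is observed. -/
noncomputable def expectedSeen (X : BanditProcess K T Ω) (G : Fin T → Digraph (Fin K))
    (P : Measure Ω) (a : Fin K) : ℝ :=
  ∑ s, P.real (X.A s ⁻¹' {i | (G s).Adj i a})

lemma IsGraphBandit.sum_neg_log_likelihood_le (hX : X.IsGraphBandit G P)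
    (hx : ∀ a b, x a b ∈ Set.Icc (0 : ℝ) 1) (hρ : P.map X.pStar = twoPointPrior x q)
    (ha0 : x a false = 1 / 2) (hδ0 : 0 < δ) (hδ : δ ≤ 1 / 4) (n : ℕ) :
    ∑ o ∈ binaryRecords K T, -Real.log (likelihood G a δ n o)
        * P.real (X.armEvent x a false ∩ X.record G n ⁻¹' {o})
      ≤ 4 * δ ^ 2 * X.expectedSeen G P a := by
  have hlog : ∀ o, -Real.log (likelihood G a δ n o)
      = ∑ s : Fin T, -(if (s : ℕ) < n then Real.log (likelihoodStep (G s) a δ (o s)) else 0) :=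
    fun o => by
      rw [likelihood, Real.log_prod, Finset.sum_neg_distrib]
      · congr 1
        refine Finset.sum_congr rfl fun s _ => ?_
        split_ifs <;> simp
      · intro s _
        split_ifs
        exacts [(likelihoodStep_pos _ _ hδ0 hδ _).ne', one_ne_zero]
  simp only [hlog, Finset.sum_mul]
  rw [Finset.sum_comm, expectedSeen, Finset.mul_sum]
  refine Finset.sum_le_sum fun s _ => ?_
  by_cases hs : (s : ℕ) < n
  · simp only [hs, if_true, neg_mul, Finset.sum_neg_distrib]
    rw [hX.sum_log_likelihoodStep hx hρ ha0 s hs, ← neg_mul]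
    exact mul_le_mul (neg_half_log_le hδ0 hδ) (measureReal_mono Set.inter_subset_right)
      measureReal_nonneg (by positivity)
  · simp only [hs, if_false, neg_zero, zero_mul, Finset.sum_const_zero]
    positivity

lemma IsGraphBandit.real_armEvent_inter_action (hX : X.IsGraphBandit G P)
    (hx : ∀ a b, x a b ∈ Set.Icc (0 : ℝ) 1) (hρ : P.map X.pStar = twoPointPrior x q)
    (b : Bool) (t : Fin T) (i : Fin K) :
    P.real (X.armEvent x a b ∩ X.A t ⁻¹' {i})
      = ∑ o ∈ binaryRecords K T, X.playProb G P t i o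
        * P.real (X.armEvent x a b ∩ X.record G t ⁻¹' {o}) := by
  rw [measureReal_eq_sum_inter_preimage (hX.measurable_record t) _
    (hX.record_mem_binaryRecords hx hρ t) ((hX.measurableSet_armEvent hx a b).inter
      (hX.measurable_A t (measurableSet_singleton i)))]
  refine Finset.sum_congr rfl fun o _ => ?_
  rw [Set.inter_right_comm, hX.real_inter_record_inter_action t i o
    (measurableSet_armEvent_environment hx t a b)]

/-- A good arm is played hardly more often than its prior probability suggests, as long as it has
not been observed often: by a change of measure from the event that the arm is good to the event
that it is not. -/
lemma IsGraphBandit.real_armEvent_true_inter_action_le (hX : X.IsGraphBandit G P)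
    (hx : ∀ a b, x a b ∈ Set.Icc (0 : ℝ) 1) (hx' : ∀ a, Function.Injective (x a))
    (hq0 : 0 < q) (hq1 : q < 1) (hρ : P.map X.pStar = twoPointPrior x q)
    (ha0 : x a false = 1 / 2) (ha1 : x a true = 1 / 2 + δ) (hδ0 : 0 < δ) (hδ : δ ≤ 1 / 4)
    (t : Fin T) (i : Fin K) :
    P.real (X.armEvent x a true ∩ X.A t ⁻¹' {i})
      ≤ q * P.real (X.A t ⁻¹' {i}) + q * (4 * δ * √(X.expectedSeen G P a)) := by
  have hq : q ∈ Set.Icc (0 : ℝ) 1 := ⟨hq0.le, hq1.le⟩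
  set F := binaryRecords K T
  set m : (Fin T → Fin K × Rewards K) → ℝ :=
    fun o => P.real (X.armEvent x a false ∩ X.record G t ⁻¹' {o}) with hm
  set l := likelihood G a δ t with hl
  have hLR := hX.real_armEvent_inter_record hx hx' hq hρ ha0 ha1 t t.2.le
  have hsum : ∀ b, P.real (X.armEvent x a b)
      = ∑ o ∈ F, P.real (X.armEvent x a b ∩ X.record G t ⁻¹' {o}) := fun b =>
    measureReal_eq_sum_inter_preimage (hX.measurable_record t) _
      (hX.record_mem_binaryRecords hx hρ t) (hX.measurableSet_armEvent hx a b)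
  have htrue := hX.real_armEvent_true hx hx' hq hρ a
  have hfalse : P.real (X.armEvent x a false) = 1 - q := by
    have := hX.real_armEvent_add hx a Set.univ
    simp only [Set.inter_univ, probReal_univ] at this
    linarith
  have hsumLR : ∀ g : (Fin T → Fin K × Rewards K) → ℝ,
      (1 - q) * ∑ o ∈ F, g o * P.real (X.armEvent x a true ∩ X.record G t ⁻¹' {o})
        = q * ∑ o ∈ F, g o * (l o * m o) := fun g => by
    rw [Finset.mul_sum, Finset.mul_sum]
    exact Finset.sum_congr rfl fun o _ => by linear_combination g o * hLR o
  have hD : ∑ o ∈ F, |l o - 1| * m o ≤ 4 * δ * √(X.expectedSeen G P a) := by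
    have h2 : ∑ o ∈ F, l o * m o = 1 - q := by
      have h := hsumLR fun _ => 1
      simp only [one_mul] at h
      rw [← hsum true, htrue, mul_comm] at h
      exact (mul_left_cancel₀ hq0.ne' h).symm
    have h3 := sum_abs_sub_one_mul_sq_le F (m := m) (l := l) (fun _ => measureReal_nonneg)
      (likelihood_pos G a hδ0 hδ t) (by rw [← hsum false, hfalse]) h2
    have h4 := hX.sum_neg_log_likelihood_le hx hρ ha0 hδ0 hδ t
    have h5 : 0 ≤ X.expectedSeen G P a := Finset.sum_nonneg fun _ _ => measureReal_nonneg
    refine le_of_abs_le (abs_le_of_sq_le_sq ?_ (by positivity))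
    calc _ ≤ _ := h3
      _ ≤ (4 * δ ^ 2 * X.expectedSeen G P a) * (4 * 1) := by
          refine mul_le_mul h4 (by linarith) (by linarith) (by positivity)
      _ = (4 * δ * √(X.expectedSeen G P a)) ^ 2 := by
          rw [mul_pow, Real.sq_sqrt h5]
          ring
  have h1 : (1 - q) * P.real (X.armEvent x a true ∩ X.A t ⁻¹' {i})
      ≤ q * (P.real (X.armEvent x a false ∩ X.A t ⁻¹' {i})
        + 4 * δ * √(X.expectedSeen G P a)) := by
    rw [hX.real_armEvent_inter_action hx hρ true t i, hsumLR]
    refine mul_le_mul_of_nonneg_left ?_ hq.1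
    rw [hX.real_armEvent_inter_action hx hρ false t i]
    refine le_trans ?_ (add_le_add_right hD _)
    rw [← Finset.sum_add_distrib]
    refine Finset.sum_le_sum fun o _ => ?_
    have hm0 : 0 ≤ m o := measureReal_nonneg
    have hg0 := playProb_nonneg (X := X) (G := G) (P := P) t i o
    have hg1 := playProb_le_one (X := X) (G := G) (P := P) t i o
    have : X.playProb G P t i o * (l o - 1) ≤ |l o - 1| := by
      refine (mul_le_mul_of_nonneg_left (le_abs_self _) hg0).trans ?_
      exact mul_le_of_le_one_left (abs_nonneg _) hg1
    nlinarith
  have h2 := hX.real_armEvent_add hx a (X.A t ⁻¹' {i})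
  nlinarith

end likelihood

end BanditProcess

/-! ### The lower bound -/

section binary

variable {K : ℕ} {x : Fin K → Bool → ℝ}

lemma integral_envLaw (hx : ∀ a b, x a b ∈ Set.Icc (0 : ℝ) 1) (θ : Fin K → Bool) (a : Fin K) :
    ∫ y, (y a : ℝ) ∂(envLaw x θ) = x a (θ a) := by
  have hm : MeasurableSet {y : Rewards K | y a = 1} :=
    measurable_pi_apply a (measurableSet_singleton 1)
  have h : (fun y : Rewards K => (y a : ℝ)) =ᵐ[envLaw x θ]
      {y : Rewards K | y a = 1}.indicator fun _ => 1 := by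
    have h0 : ∀ᵐ y ∂(envLaw x θ), y ∈ binaryRewards K := envLaw_compl_binaryRewards hx θ
    filter_upwards [h0] with y hy
    rcases hy a with h | h
    · simp [Set.indicator, h]
    · have h' : y a = 1 := h
      simp [Set.indicator, h']
  rw [integral_congr_ae h, integral_indicator_const _ hm, envLaw_real_eval hx]
  simp

end binary

namespace BanditProcess

variable {K T : ℕ} {Ω : Type u} [mΩ : MeasurableSpace Ω] {P : Measure Ω}
  {X : BanditProcess K T Ω} {G : Fin T → Digraph (Fin K)} {x : Fin K → Bool → ℝ} {q : ℝ}

lemma IsGraphBandit.measurableSet_reward_eq_one (hX : X.IsGraphBandit G P) (t : Fin T)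
    (a : Fin K) : MeasurableSet {ω | X.Y t ω a = 1} :=
  hX.measurable_Y t (measurable_pi_apply a (measurableSet_singleton 1))

lemma IsGraphBandit.real_param_inter_aStar_inter_reward_eq (hX : X.IsGraphBandit G P)
    (hx : ∀ a b, x a b ∈ Set.Icc (0 : ℝ) 1) (hρ : P.map X.pStar = twoPointPrior x q)
    (θ : Fin K → Bool) (a : Fin K) (t : Fin T) :
    P.real (X.param x ⁻¹' {θ} ∩ X.aStar ⁻¹' {a} ∩ {ω | X.Y t ω a = 1})
      = P.real (X.param x ⁻¹' {θ} ∩ X.aStar ⁻¹' {a}) * x a (θ a) := by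
  have hprob := isProbabilityMeasure_envLaw hx θ
  set R : Set (Rewards K) := {y | y a = 1} with hR
  have hRm : MeasurableSet R := measurable_pi_apply a (measurableSet_singleton 1)
  set S : Fin T → Set (Rewards K) := Function.update (fun _ => Set.univ) t R with hS
  have hSm : ∀ s, MeasurableSet (S s) := fun s => by
    by_cases hs : s = t
    · subst hs; simpa [S] using hRm
    · simp [S, hs]
  have h := hX.real_param_inter_aStar_inter_reward hx hρ θ a hSm
  have hI : (⋂ s, X.Y s ⁻¹' S s) = {ω | X.Y t ω a = 1} := by
    ext ω
    simp only [Set.mem_iInter, Set.mem_preimage, Set.mem_ofPred_eq]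
    refine ⟨fun h => by simpa [S, R] using h t, fun h s => ?_⟩
    by_cases hs : s = t
    · subst hs; simpa [S, R] using h
    · simp [S, hs]
  have hprod : ∏ s, (envLaw x θ).real (S s) = x a (θ a) := by
    rw [Finset.prod_eq_single t]
    · simp only [S, Function.update_self, R, envLaw_real_eval hx]
    · intro s _ hs
      simp [S, hs]
    · simp
  rwa [hI, hprod] at h

variable [IsProbabilityMeasure P]

lemma IsGraphBandit.integral_reward_comp (hX : X.IsGraphBandit G P)
    (hx : ∀ a b, x a b ∈ Set.Icc (0 : ℝ) 1) (hρ : P.map X.pStar = twoPointPrior x q) (t : Fin T)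
    {f : Ω → Fin K} (hf : Measurable f) :
    ∫ ω, (X.Y t ω (f ω) : ℝ) ∂P = ∑ a, P.real (f ⁻¹' {a} ∩ {ω | X.Y t ω a = 1}) := by
  have hm : ∀ a, MeasurableSet (f ⁻¹' {a} ∩ {ω | X.Y t ω a = 1}) := fun a =>
    (hf (measurableSet_singleton a)).inter (hX.measurableSet_reward_eq_one t a)
  have h : (fun ω => (X.Y t ω (f ω) : ℝ)) =ᵐ[P]
      fun ω => ∑ a, (f ⁻¹' {a} ∩ {ω | X.Y t ω a = 1}).indicator (fun _ => (1 : ℝ)) ω := by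
    filter_upwards [hX.reward_mem_binaryRewards hx hρ] with ω hω
    rw [Finset.sum_eq_single (f ω)]
    · rcases hω t (f ω) with h | h
      · simp [Set.indicator, h]
      · have h' : X.Y t ω (f ω) = 1 := h
        simp [Set.indicator, h']
    · intro a _ ha
      refine Set.indicator_of_notMem (fun h => ha ?_) _
      exact h.1.symm
    · simp
  rw [integral_congr_ae h,
    integral_finsetSum _ fun a _ => (integrable_const (1 : ℝ)).indicator (hm a)]
  refine Finset.sum_congr rfl fun a _ => ?_
  rw [integral_indicator_const _ (hm a)]
  simp

lemma IsGraphBandit.integral_reward_action [NeZero K] (hX : X.IsGraphBandit G P)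
    (hx : ∀ a b, x a b ∈ Set.Icc (0 : ℝ) 1) (hρ : P.map X.pStar = twoPointPrior x q)
    (t : Fin T) :
    ∫ ω, (X.Y t ω (X.A t ω) : ℝ) ∂P
      = ∑ a, (x a true * P.real (X.armEvent x a true ∩ X.A t ⁻¹' {a})
        + x a false * P.real (X.armEvent x a false ∩ X.A t ⁻¹' {a})) := by
  rw [hX.integral_reward_comp hx hρ t (hX.measurable_A t)]
  refine Finset.sum_congr rfl fun a _ => ?_
  rw [← hX.real_armEvent_add hx a, hX.real_armEvent_inter_action_inter_reward hx hρ,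
    hX.real_armEvent_inter_action_inter_reward hx hρ]

/-- The reward of the optimal action is at least the prior mean of any function bounded by the
largest mean of the arms. -/
lemma IsGraphBandit.le_integral_reward_aStar (hX : X.IsGraphBandit G P)
    (hx : ∀ a b, x a b ∈ Set.Icc (0 : ℝ) 1) (hρ : P.map X.pStar = twoPointPrior x q)
    (t : Fin T) {μ : (Fin K → Bool) → ℝ} (hμ : ∀ θ, ∃ b, μ θ ≤ x b (θ b)) :
    ∑ θ, P.real (X.param x ⁻¹' {θ}) * μ θ ≤ ∫ ω, (X.Y t ω (X.aStar ω) : ℝ) ∂P := by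
  have hθm := fun θ => hX.measurable_param hx (measurableSet_singleton θ)
  have ham := fun a => hX.measurable_aStar (measurableSet_singleton a)
  rw [hX.integral_reward_comp hx hρ t hX.measurable_aStar]
  have h1 : ∀ a, P.real (X.aStar ⁻¹' {a} ∩ {ω | X.Y t ω a = 1})
      = ∑ θ, P.real (X.param x ⁻¹' {θ} ∩ X.aStar ⁻¹' {a}) * x a (θ a) := fun a => by
    rw [measureReal_eq_sum_inter_preimage (hX.measurable_param hx) Finset.univ
      (ae_of_all _ (by simp)) ((ham a).inter (hX.measurableSet_reward_eq_one t a))]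
    refine Finset.sum_congr rfl fun θ _ => ?_
    rw [← hX.real_param_inter_aStar_inter_reward_eq hx hρ θ a t]
    congr 1
    ext ω
    simp only [Set.mem_inter_iff]
    tauto
  have h2 : ∀ θ, P.real (X.param x ⁻¹' {θ})
      = ∑ a, P.real (X.param x ⁻¹' {θ} ∩ X.aStar ⁻¹' {a}) := fun θ =>
    measureReal_eq_sum_inter_preimage hX.measurable_aStar Finset.univ (ae_of_all _ (by simp))
      (hθm θ)
  simp only [h1]
  rw [Finset.sum_comm]
  refine Finset.sum_le_sum fun θ _ => ?_
  rw [h2, Finset.sum_mul]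
  refine Finset.sum_le_sum fun a _ => ?_
  obtain ⟨b, hb⟩ := hμ θ
  by_cases hlt : x b (θ b) ≤ x a (θ a)
  · exact mul_le_mul_of_nonneg_left (hb.trans hlt) measureReal_nonneg
  · -- almost surely, `a` is not the optimal action under the parameter `θ`
    have h0 : P.real (X.param x ⁻¹' {θ} ∩ X.aStar ⁻¹' {a}) = 0 := by
      rw [measureReal_eq_zero_iff, measure_eq_zero_iff_ae_notMem]
      filter_upwards [hX.aStar_optimal, hX.envLaw_param hx hρ] with ω h1 h2 hω
      have h3 : X.param x ω = θ := hω.1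
      have h4 : X.aStar ω = a := hω.2
      have h5 := h1 b
      rw [← h2, integral_envLaw hx, integral_envLaw hx, h3, h4] at h5
      exact hlt h5
    rw [h0, zero_mul, zero_mul]

/-- The means of the arms in the hard instances: the arms of `S` have mean `1 / 2` or `1 / 2 + δ`,
and the other arms are clearly worse. The two means of an arm outside `S` differ only in order that
the reward distribution determines the parameter. -/
noncomputable def hardMean (S : Finset (Fin K)) (δ : ℝ) (a : Fin K) (b : Bool) : ℝ :=
  if a ∈ S then (if b then 1 / 2 + δ else 1 / 2) else (if b then 1 / 4 else 0)

lemma hardMean_mem_Icc (S : Finset (Fin K)) {δ : ℝ} (hδ0 : 0 < δ) (hδ : δ ≤ 1 / 4) (a : Fin K)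
    (b : Bool) : hardMean S δ a b ∈ Set.Icc (0 : ℝ) 1 := by
  unfold hardMean
  split_ifs <;> constructor <;> linarith

lemma hardMean_injective (S : Finset (Fin K)) {δ : ℝ} (hδ0 : 0 < δ) (a : Fin K) :
    Function.Injective (hardMean S δ a) := by
  intro b b' h
  unfold hardMean at h
  by_cases ha : a ∈ S <;> cases b <;> cases b' <;> simp [ha] at h ⊢
  · exact hδ0.ne' h
  · exact hδ0.ne' h

lemma IsGraphBandit.sum_real_action (hX : X.IsGraphBandit G P) (t : Fin T) :
    ∑ a, P.real (X.A t ⁻¹' {a}) = 1 := by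
  have h := measureReal_eq_sum_inter_preimage (P := P) (hX.measurable_A t) Finset.univ
    (ae_of_all _ (by simp)) MeasurableSet.univ
  simpa using h.symm

/-- If every vertex of `S` has at most two out-neighbours in `S`, then the arms of `S` are observed
at most twice in a round in which an arm of `S` is played. -/
lemma IsGraphBandit.sum_expectedSeen_le (hX : X.IsGraphBandit G P) {S : Finset (Fin K)}
    (hS : ∀ t, ∀ i ∈ S, ∀ U ⊆ S, (∀ a ∈ U, (G t).Adj i a) → U.card ≤ 2) :
    ∑ a ∈ S, X.expectedSeen G P a
      ≤ 2 * T + S.card * ∑ t, ∑ a ∈ Sᶜ, P.real (X.A t ⁻¹' {a}) := by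
  classical
  unfold expectedSeen
  rw [Finset.sum_comm, Finset.mul_sum]
  have hT : (2 : ℝ) * T = ∑ _ : Fin T, 2 := by simp [mul_comm]
  rw [hT, ← Finset.sum_add_distrib]
  refine Finset.sum_le_sum fun t _ => ?_
  have h1 : ∀ a, P.real (X.A t ⁻¹' {i | (G t).Adj i a})
      = ∑ i, if (G t).Adj i a then P.real (X.A t ⁻¹' {i}) else 0 := fun a => by
    rw [measureReal_eq_sum_inter_preimage (hX.measurable_A t) Finset.univ
      (ae_of_all _ (by simp)) (hX.measurable_A t MeasurableSet.of_discrete)]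
    refine Finset.sum_congr rfl fun i _ => ?_
    rw [← Set.preimage_inter]
    split_ifs with h
    · congr 2
      ext j
      simp only [Set.mem_inter_iff, Set.mem_ofPred_eq, Set.mem_singleton_iff]
      exact ⟨fun hj => hj.2, fun hj => ⟨hj ▸ h, hj⟩⟩
    · have : {i | (G t).Adj i a} ∩ {i} = ∅ := by
        ext j
        simp only [Set.mem_inter_iff, Set.mem_ofPred_eq, Set.mem_singleton_iff,
          Set.mem_empty_iff_false, iff_false, not_and]
        exact fun hj hji => h (hji ▸ hj)
      rw [this, Set.preimage_empty, measureReal_empty]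
  simp only [h1]
  rw [Finset.sum_comm]
  have h2 : ∀ i, ∑ a ∈ S, (if (G t).Adj i a then P.real (X.A t ⁻¹' {i}) else 0)
      = (S.filter fun a => (G t).Adj i a).card * P.real (X.A t ⁻¹' {i}) := fun i => by
    rw [← Finset.sum_filter, Finset.sum_const, nsmul_eq_mul]
  simp only [h2]
  rw [← Finset.sum_add_sum_compl S, Finset.mul_sum]
  refine add_le_add ?_ (Finset.sum_le_sum fun i _ => ?_)
  · calc _ ≤ ∑ i ∈ S, 2 * P.real (X.A t ⁻¹' {i}) := by
          refine Finset.sum_le_sum fun i hi => mul_le_mul_of_nonneg_right ?_ measureReal_nonneg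
          exact_mod_cast hS t i hi _ (Finset.filter_subset _ _)
            fun a ha => (Finset.mem_filter.1 ha).2
      _ ≤ 2 * ∑ i, P.real (X.A t ⁻¹' {i}) := by
          rw [← Finset.mul_sum]
          exact mul_le_mul_of_nonneg_left (Finset.sum_le_univ_sum_of_nonneg
            fun _ => measureReal_nonneg) zero_le_two
      _ = 2 := by rw [hX.sum_real_action, mul_one]
  · exact mul_le_mul_of_nonneg_right (by exact_mod_cast Finset.card_filter_le _ _)
      measureReal_nonneg

/-- The prior probability that `S` contains a good arm. -/
lemma IsGraphBandit.real_exists_good (hX : X.IsGraphBandit G P) {S : Finset (Fin K)}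
    (hx : ∀ a b, x a b ∈ Set.Icc (0 : ℝ) 1) (hx' : ∀ a, Function.Injective (x a))
    (hq : q ∈ Set.Icc (0 : ℝ) 1) (hρ : P.map X.pStar = twoPointPrior x q) :
    ∑ θ, P.real (X.param x ⁻¹' {θ}) * (if ∃ a ∈ S, θ a = true then 1 else 0)
      = 1 - (1 - q) ^ S.card := by
  classical
  have hprob := isProbabilityMeasure_coin (u := false) (v := true) hq
  set N := X.param x ⁻¹' Set.pi Set.univ (fun a => if a ∈ S then {false} else Set.univ) with hN
  have hNm : MeasurableSet N := hX.measurable_param hx MeasurableSet.of_discrete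
  have h1 : P.real N = (1 - q) ^ S.card := by
    rw [hN, hX.real_param_preimage hx hx' hq hρ]
    have : ∀ a, (coin false true q).real (if a ∈ S then {false} else Set.univ)
        = if a ∈ S then 1 - q else 1 := fun a => by
      split_ifs
      exacts [coin_real_singleton_left (by simp) hq, probReal_univ]
    simp only [this]
    rw [Finset.prod_ite_mem, Finset.univ_inter, Finset.prod_const]
  rw [← h1, ← probReal_compl_eq_one_sub hNm,
    measureReal_eq_sum_inter_preimage (hX.measurable_param hx) Finset.univ
      (ae_of_all _ (by simp)) hNm.compl]
  refine Finset.sum_congr rfl fun θ _ => ?_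
  have hmem : ∀ ω, X.param x ω = θ → (ω ∈ Nᶜ ↔ ∃ a ∈ S, θ a = true) := fun ω hω => by
    simp only [hN, Set.mem_compl_iff, Set.mem_preimage, Set.mem_univ_pi, hω, not_forall]
    refine exists_congr fun a => ?_
    by_cases ha : a ∈ S <;> simp [ha]
  split_ifs with h
  · rw [mul_one]
    congr 1
    ext ω
    exact ⟨fun hω => ⟨(hmem ω hω).2 h, hω⟩, fun hω => hω.2⟩
  · have : Nᶜ ∩ X.param x ⁻¹' {θ} = ∅ := by
      ext ω
      simp only [Set.mem_inter_iff, Set.mem_empty_iff_false, iff_false, not_and]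
      exact fun h1 h2 => h ((hmem ω h2).1 h1)
    rw [mul_zero, this, measureReal_empty]

/-- With `n` arms that are good with probability `1 / n` each, some arm is good with probability at
least `1 / 4 + 1 / n`: better than a single arm by a constant. -/
lemma one_sub_inv_pow_le {n : ℕ} (hn : 2 ≤ n) :
    (1 - (n : ℝ)⁻¹) ^ n ≤ 3 / 4 - (n : ℝ)⁻¹ := by
  rcases hn.eq_or_lt with rfl | hn
  · norm_num
  · have h3 : (3 : ℝ) ≤ n := by exact_mod_cast hn
    have h1 := Real.one_sub_div_pow_le_exp_neg (n := n) (t := 1) (by linarith)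
    have h2 : (n : ℝ)⁻¹ ≤ 3⁻¹ := inv_anti₀ (by norm_num) h3
    have h4 := Real.exp_neg_one_lt_d9
    rw [one_div] at h1
    linarith

/-- A lower bound for the regret in terms of the expected number `N` of rounds in which an arm
outside `S` is played. Such a round costs at least `1 / 4`. In the other rounds, some arm is good
with probability `1 / 4 + 1 / n`, whereas the arm played is good with probability about `1 / n`; the
last term bounds what is learnt from the observations of `S`, of which there are at most
`2 T + n N`. -/
lemma IsGraphBandit.regret_ge (hX : X.IsGraphBandit G P) {S : Finset (Fin K)}
    (hScard : 2 ≤ S.card)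
    (hS : ∀ t, ∀ i ∈ S, ∀ U ⊆ S, (∀ a ∈ U, (G t).Adj i a) → U.card ≤ 2)
    {δ : ℝ} (hδ0 : 0 < δ) (hδ : δ ≤ 1 / 4)
    (hρ : P.map X.pStar = twoPointPrior (hardMean S δ) (S.card : ℝ)⁻¹) :
    ∃ N : ℝ, 0 ≤ N ∧ T * (δ / 4) + N / 4
      - 4 * δ ^ 2 * (S.card : ℝ)⁻¹ * T * √(S.card * (2 * T + S.card * N)) ≤ X.regret P := by
  classical
  set x := hardMean S δ with hxdef
  set q : ℝ := (S.card : ℝ)⁻¹ with hqdef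
  have hn : (2 : ℝ) ≤ S.card := by exact_mod_cast hScard
  have hSne : S.Nonempty := Finset.card_pos.1 (by omega)
  obtain ⟨a₀, ha₀⟩ := hSne
  have : NeZero K := ⟨(a₀.pos).ne'⟩
  have hx : ∀ a b, x a b ∈ Set.Icc (0 : ℝ) 1 := hardMean_mem_Icc S hδ0 hδ
  have hx' : ∀ a, Function.Injective (x a) := hardMean_injective S hδ0
  have hq0 : 0 < q := by positivity
  have hq1 : q < 1 := inv_lt_one_of_one_lt₀ (by linarith)
  have hq : q ∈ Set.Icc (0 : ℝ) 1 := ⟨hq0.le, hq1.le⟩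
  set out : Fin T → ℝ := fun t => ∑ a ∈ Sᶜ, P.real (X.A t ⁻¹' {a}) with hout
  have hout0 : ∀ t, 0 ≤ out t := fun t => Finset.sum_nonneg fun _ _ => measureReal_nonneg
  set W := √(S.card * (2 * T + S.card * ∑ t, out t)) with hW
  -- by the Cauchy-Schwarz inequality
  have hroot : ∑ a ∈ S, √(X.expectedSeen G P a) ≤ W := by
    refine Real.le_sqrt_of_sq_le ?_
    refine sq_sum_le_card_mul_sum_sq.trans ?_
    refine mul_le_mul_of_nonneg_left ?_ (by positivity)
    refine le_trans (le_of_eq (Finset.sum_congr rfl fun a _ => Real.sq_sqrt ?_))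
      (hX.sum_expectedSeen_le hS)
    exact Finset.sum_nonneg fun _ _ => measureReal_nonneg
  have hgood : 1 / 4 + q ≤ 1 - (1 - q) ^ S.card := by
    have := one_sub_inv_pow_le hScard
    linarith
  have hstar : ∀ t, 1 / 2 + δ * (1 / 4 + q) ≤ ∫ ω, (X.Y t ω (X.aStar ω) : ℝ) ∂P := fun t => by
    have h := hX.le_integral_reward_aStar hx hρ t
      (μ := fun θ => 1 / 2 + δ * (if ∃ a ∈ S, θ a = true then 1 else 0)) fun θ => by
        by_cases hθ : ∃ a ∈ S, θ a = true
        · obtain ⟨a, ha, hθa⟩ := hθ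
          refine ⟨a, ?_⟩
          rw [if_pos ⟨a, ha, hθa⟩, hxdef, hardMean, if_pos ha, if_pos hθa, mul_one]
        · have : θ a₀ = false := by
            by_contra h
            exact hθ ⟨a₀, ha₀, by simpa using h⟩
          refine ⟨a₀, ?_⟩
          rw [if_neg hθ, hxdef, hardMean, if_pos ha₀, this]
          simp
    refine le_trans ?_ h
    have h1 : ∑ θ, P.real (X.param x ⁻¹' {θ}) = 1 := by
      have h := measureReal_eq_sum_inter_preimage (P := P) (hX.measurable_param hx) Finset.univ
        (ae_of_all _ (by simp)) MeasurableSet.univ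
      simpa using h.symm
    have h2 := hX.real_exists_good (S := S) hx hx' hq hρ
    have h3 : ∑ θ, P.real (X.param x ⁻¹' {θ})
        * (1 / 2 + δ * (if ∃ a ∈ S, θ a = true then 1 else 0))
        = 1 / 2 * ∑ θ, P.real (X.param x ⁻¹' {θ})
        + δ * ∑ θ, P.real (X.param x ⁻¹' {θ}) * (if ∃ a ∈ S, θ a = true then 1 else 0) := by
      rw [Finset.mul_sum, Finset.mul_sum, ← Finset.sum_add_distrib]
      exact Finset.sum_congr rfl fun θ _ => by ring
    rw [h3, h1, h2]
    nlinarith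
  have hact : ∀ t, ∫ ω, (X.Y t ω (X.A t ω) : ℝ) ∂P
      ≤ 1 / 2 + δ * q - out t / 4 + 4 * δ ^ 2 * q * W := fun t => by
    rw [hX.integral_reward_action hx hρ t, ← Finset.sum_add_sum_compl S]
    have hsum := hX.sum_real_action t
    rw [← Finset.sum_add_sum_compl S] at hsum
    have hin : ∑ a ∈ S, (x a true * P.real (X.armEvent x a true ∩ X.A t ⁻¹' {a})
        + x a false * P.real (X.armEvent x a false ∩ X.A t ⁻¹' {a}))
        ≤ ∑ a ∈ S, ((1 / 2 + δ * q) * P.real (X.A t ⁻¹' {a})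
          + 4 * δ ^ 2 * q * √(X.expectedSeen G P a)) := by
      refine Finset.sum_le_sum fun a ha => ?_
      have h0 : x a false = 1 / 2 := by simp [hxdef, hardMean, ha]
      have h1 : x a true = 1 / 2 + δ := by simp [hxdef, hardMean, ha]
      have h2 := hX.real_armEvent_true_inter_action_le hx hx' hq0 hq1 hρ h0 h1 hδ0 hδ t a
      have h3 := hX.real_armEvent_add hx a (X.A t ⁻¹' {a})
      rw [h0, h1]
      nlinarith [mul_le_mul_of_nonneg_left h2 hδ0.le]
    have hoff : ∑ a ∈ Sᶜ, (x a true * P.real (X.armEvent x a true ∩ X.A t ⁻¹' {a})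
        + x a false * P.real (X.armEvent x a false ∩ X.A t ⁻¹' {a}))
        ≤ ∑ a ∈ Sᶜ, 1 / 4 * P.real (X.A t ⁻¹' {a}) := by
      refine Finset.sum_le_sum fun a ha => ?_
      have ha' : a ∉ S := Finset.mem_compl.1 ha
      have h0 : x a false = 0 := by simp [hxdef, hardMean, ha']
      have h1 : x a true = 1 / 4 := by simp [hxdef, hardMean, ha']
      have h3 : P.real (X.armEvent x a true ∩ X.A t ⁻¹' {a}) ≤ P.real (X.A t ⁻¹' {a}) :=
        measureReal_mono Set.inter_subset_right
      rw [h0, h1]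
      linarith
    have hin' : ∑ a ∈ S, ((1 / 2 + δ * q) * P.real (X.A t ⁻¹' {a})
          + 4 * δ ^ 2 * q * √(X.expectedSeen G P a))
        = (1 / 2 + δ * q) * ∑ a ∈ S, P.real (X.A t ⁻¹' {a})
          + 4 * δ ^ 2 * q * ∑ a ∈ S, √(X.expectedSeen G P a) := by
      rw [Finset.sum_add_distrib, ← Finset.mul_sum, ← Finset.mul_sum]
    rw [hin'] at hin
    have hoff' : ∑ a ∈ Sᶜ, 1 / 4 * P.real (X.A t ⁻¹' {a}) = 1 / 4 * out t := by
      rw [← Finset.mul_sum]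
    rw [hoff'] at hoff
    have h4 := mul_le_mul_of_nonneg_left hroot (by positivity : 0 ≤ 4 * δ ^ 2 * q)
    have h5 := hout0 t
    have h6 : ∑ a ∈ S, P.real (X.A t ⁻¹' {a}) = 1 - out t := by linarith
    rw [h6] at hin
    nlinarith [mul_nonneg (mul_pos hδ0 hq0).le h5]
  refine ⟨∑ t, out t, Finset.sum_nonneg fun t _ => hout0 t, ?_⟩
  have hterm : ∀ t, δ / 4 + out t / 4 - 4 * δ ^ 2 * q * W
      ≤ ∫ ω, ((X.Y t ω (X.aStar ω) : ℝ) - (X.Y t ω (X.A t ω) : ℝ)) ∂P := fun t => by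
    rw [integral_sub (hX.integrable_reward_comp t hX.measurable_aStar)
      (hX.integrable_reward_comp t (hX.measurable_A t))]
    have := hstar t
    have := hact t
    linarith
  rw [hX.regret_eq_sum]
  refine le_trans (le_of_eq ?_) (Finset.sum_le_sum fun t _ => hterm t)
  have hsum : ∑ t, out t / 4 = (∑ t, out t) / 4 := (Finset.sum_div _ _ _).symm
  rw [Finset.sum_sub_distrib, Finset.sum_add_distrib, hsum, ← hW]
  simp only [Finset.sum_const, Finset.card_univ, Fintype.card_fin, nsmul_eq_mul]
  ring

/-- The choice `δ = √(n / T) / 64` of the gap balances the cost of missing a good arm against the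
information that is needed to find one. -/
lemma sqrt_le_of_gap {n T N δ : ℝ} (hn : 2 ≤ n) (hT : 0 < T) (hnT : n ^ 3 ≤ 8 * T) (hN : 0 ≤ N)
    (hδ : δ = √(n / T) / 64) :
    1 / 1024 * √(n * T) ≤ T * (δ / 4) + N / 4
      - 4 * δ ^ 2 * n⁻¹ * T * √(n * (2 * T + n * N)) := by
  have hn0 : 0 < n := by linarith
  set z := √(n * T) with hz
  have hz0 : 0 ≤ z := Real.sqrt_nonneg _
  have hz2 : z ^ 2 = n * T := Real.sq_sqrt (by positivity)
  have h1 : T * (δ / 4) = z / 256 := by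
    have : T * √(n / T) = z := by
      rw [hz, show n * T = T ^ 2 * (n / T) by field_simp, Real.sqrt_mul (sq_nonneg T),
        Real.sqrt_sq hT.le]
    rw [hδ]
    linear_combination this / 256
  have h2 : 4 * δ ^ 2 * n⁻¹ * T = 1 / 1024 := by
    rw [hδ, div_pow, Real.sq_sqrt (by positivity)]
    field_simp
    norm_num
  have h3 : √(n * (2 * T + n * N)) ≤ 2 * z + n * √N := by
    refine Real.sqrt_le_iff.2 ⟨by positivity, ?_⟩
    have hs := Real.sq_sqrt hN
    have : 0 ≤ z * (n * √N) := by positivity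
    nlinarith [mul_pos hn0 hT]
  have h4 : n * √N / 1024 ≤ N / 4 + (n / 1024) ^ 2 := by
    nlinarith [Real.sq_sqrt hN, sq_nonneg (√N / 2 - n / 1024)]
  -- this is where `n ^ 3 ≤ 8 T` is used: the exploration outside `S` is not worth its cost
  have h5 : n ^ 2 ≤ 3 * z := by
    refine le_of_abs_le (abs_le_of_sq_le_sq ?_ (by positivity))
    have h6 := mul_le_mul_of_nonneg_left hnT hn0.le
    nlinarith [mul_pos hn0 hT]
  rw [h1, h2]
  nlinarith

/-- A set of arms on which observing the out-neighbours is of little help: a maximum independent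
set. If the independence number is one, such a set contains a single arm and would leave nothing to
learn, so two arms are taken instead. -/
lemma _root_.Digraph.exists_hard_set (hK : 2 ≤ K) (H : Digraph (Fin K)) :
    ∃ S : Finset (Fin K), 2 ≤ S.card ∧ H.independenceNumber ≤ S.card ∧
      S.card ≤ 2 * H.independenceNumber ∧
      ∀ i ∈ S, ∀ U ⊆ S, (∀ a ∈ U, H.Adj i a) → U.card ≤ 2 := by
  have : Nonempty (Fin K) := ⟨⟨0, by omega⟩⟩
  have h1 := H.one_le_independenceNumber
  by_cases h2 : 2 ≤ H.independenceNumber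
  · obtain ⟨S, hS⟩ := H.toSimpleGraphInclusive.exists_isNIndepSet_indepNum
    have hcard : S.card = H.independenceNumber := hS.card_eq
    refine ⟨S, hcard ▸ h2, hcard.ge, by omega, fun i hi U hU hadj => ?_⟩
    have hsub : U ⊆ {i} := fun a ha => by
      by_contra hne
      have hne' : i ≠ a := fun h => hne (by simp [h])
      refine hS.isIndepSet (Finset.mem_coe.2 hi) (Finset.mem_coe.2 (hU ha)) hne' ?_
      simp only [Digraph.toSimpleGraphInclusive, SimpleGraph.fromRel_adj]
      exact ⟨hne', Or.inl (hadj a ha)⟩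
    exact (Finset.card_le_card hsub).trans (by simp)
  · -- when the independence number is one, any two arms will do
    refine ⟨{⟨0, by omega⟩, ⟨1, by omega⟩}, ?_⟩
    have hc : ({⟨0, by omega⟩, ⟨1, by omega⟩} : Finset (Fin K)).card = 2 :=
      Finset.card_pair (by simp)
    rw [hc]
    exact ⟨le_rfl, by omega, by omega, fun i _ U hU _ => hc ▸ Finset.card_le_card hU⟩

end BanditProcess

theorem mainTheorem2 :
    -- the regret bound, with a constant depending only on a lower bound for `H(α₁) log (K T)`
    (∀ h : ℝ, 0 < h → ∃ C : ℝ, 0 < C ∧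
      ∀ (K T : ℕ) (_ : 1 ≤ T) (G : Fin T → Digraph (Fin K)) (_ : ∀ t i, (G t).Adj i i)
        (Ω : Type u) [MeasurableSpace Ω] (P : Measure Ω) [IsProbabilityMeasure P]
        (X : BanditProcess K T Ω) (_ : X.IsGraphBandit G P)
        (_ : X.IsTSU G P (1 / Real.sqrt T)) (_ : h ≤ X.priorEntropy P * Real.log (K * T)),
        X.regret P ≤ C * X.rate G P) ∧
    -- the regret bound with a universal constant and no condition on the prior
    (∃ C : ℝ, 0 < C ∧
      ∀ (K T : ℕ) (_ : 1 ≤ T) (G : Fin T → Digraph (Fin K)) (_ : ∀ t i, (G t).Adj i i)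
        (Ω : Type u) [MeasurableSpace Ω] (P : Measure Ω) [IsProbabilityMeasure P]
        (X : BanditProcess K T Ω) (_ : X.IsGraphBandit G P)
        (_ : X.IsTSU G P (1 / Real.sqrt T)),
        X.regret P ≤ Real.sqrt T + C * X.rate G P) ∧
    -- optimality up to logarithmic factors: a lower bound for all policies on every directed graph
    (∃ c : ℝ, 0 < c ∧
      ∀ (K T : ℕ) (_ : 2 ≤ K) (G : Digraph (Fin K)) (_ : ∀ i, G.Adj i i)
        (_ : G.independenceNumber ^ 3 ≤ T),
        ∃ ρ : Measure (Measure (Rewards K)), IsProbabilityMeasure ρ ∧ IsIndependentArmsPrior ρ ∧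
          ∀ (Ω : Type u) [MeasurableSpace Ω] (P : Measure Ω) [IsProbabilityMeasure P]
            (X : BanditProcess K T Ω) (_ : X.IsGraphBandit (fun _ => G) P)
            (_ : P.map X.pStar = ρ),
            c * Real.sqrt (G.independenceNumber * T) ≤ X.regret P) := by
  refine ⟨fun h hh => ⟨1 / √h + 4, by positivity, ?_⟩, ⟨4, by norm_num, ?_⟩,
    ⟨1 / 1024, by norm_num, ?_⟩⟩
  · intro K T hT G hG Ω _ P _ X hX hTS hH
    have h1 := hX.regret_le_add_rate hTS hT hG
    obtain ⟨ω⟩ := nonempty_of_isProbabilityMeasure P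
    have : Nonempty (Fin K) := ⟨X.aStar ω⟩
    have h2 := BanditProcess.sqrt_le_mul_rate (X := X) (P := P)
      (fun t => (G t).one_le_independenceNumber) hh hH
    rw [add_mul]
    linarith
  · intro K T hT G hG Ω _ P _ X hX hTS
    exact hX.regret_le_add_rate hTS hT hG
  · intro K T hK G hG hT
    have : Nonempty (Fin K) := ⟨⟨0, by omega⟩⟩
    have hβ : 1 ≤ G.independenceNumber := G.one_le_independenceNumber
    obtain ⟨S, hS2, hβS, hSβ, hS⟩ := G.exists_hard_set hK
    have hβT : G.independenceNumber ≤ T := (Nat.le_self_pow (by norm_num) _).trans hT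
    have hn : (2 : ℝ) ≤ S.card := by exact_mod_cast hS2
    have hT0 : (0 : ℝ) < T := by exact_mod_cast hβ.trans hβT
    have hnT : (S.card : ℝ) ≤ 2 * T := by
      exact_mod_cast hSβ.trans (Nat.mul_le_mul_left 2 hβT)
    have hnT3 : (S.card : ℝ) ^ 3 ≤ 8 * T := by
      have : S.card ^ 3 ≤ 8 * T :=
        calc S.card ^ 3 ≤ (2 * G.independenceNumber) ^ 3 := Nat.pow_le_pow_left hSβ 3
          _ = 8 * G.independenceNumber ^ 3 := by ring
          _ ≤ 8 * T := Nat.mul_le_mul_left 8 hT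
      exact_mod_cast this
    -- the gap of `sqrt_le_of_gap`; it is at most `1 / 4` since `S.card ≤ 2 * T`
    set δ : ℝ := √(S.card / T) / 64 with hδ
    have hδ0 : 0 < δ := by positivity
    have hδ1 : δ ≤ 1 / 4 := by
      have h1 : √((S.card : ℝ) / T) ≤ 2 := by
        refine Real.sqrt_le_iff.2 ⟨by norm_num, ?_⟩
        rw [div_le_iff₀ hT0]
        linarith
      rw [hδ]
      linarith
    have hq : (S.card : ℝ)⁻¹ ∈ Set.Icc (0 : ℝ) 1 :=
      ⟨by positivity, inv_le_one_of_one_le₀ (by linarith)⟩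
    have hx := BanditProcess.hardMean_mem_Icc S hδ0 hδ1
    refine ⟨twoPointPrior (BanditProcess.hardMean S δ) (S.card : ℝ)⁻¹,
      isProbabilityMeasure_twoPointPrior hq, isIndependentArmsPrior_twoPointPrior hx hq, ?_⟩
    intro Ω _ P _ X hX hρ
    obtain ⟨N, hN, hreg⟩ := hX.regret_ge hS2 (fun _ => hS) hδ0 hδ1 hρ
    refine le_trans ?_ ((BanditProcess.sqrt_le_of_gap hn hT0 hnT3 hN hδ).trans hreg)
    gcongr
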